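/- **Language.** Fix sets $\mathrm{Op}^m_{n_1,\dots,n_k}$ of primitive operations and $\mathrm{LOp}^m_{n_1,\dots,n_k;n'_1,\dots,n'_l}$ of linear operations ($k,l,m,n_i,n'_j\in\mathbb N$). Cartesian types $\tau$ and linear types $\underline\sigma$ are generated by $$\tau ::= \mathbf{reals}^n \mid \mathbf 1 \mid \tau * \tau' \mid \tau\to\tau' \mid \underline\sigma\multimap\underline\rho,\qquad \underline\sigma ::= \underline{\mathbf{reals}}^n \mid \underline{\mathbf 1}\mid \underline\sigma*\underline\rho\mid \tau\to\underline\sigma\mid {!\tau}\otimes\underline\sigma .$$ There are two judgements, $\Gamma\vdash t:\tau$ and $\Gamma;x:\underline\sigma\vdash t:\underline\rho$, where $\Gamma$ is a list of variables of Cartesian types and $x$ is one linear variable. Terms are taken up to renaming of bound variables. * $\Gamma\vdash t:\tau$ is generated by the simply typed $\lambda$-calculus with unit and binary products (variables, $\langle\rangle$, pairs, projections, $\lambda$-abstraction, application), by $\Gamma\vdash \mathrm{op}(t):\mathbf{reals}^m$ for $\mathrm{op}\in\mathrm{Op}^m_{n_1,\dots,n_k}$ and $\Gamma\vdash t:\mathbf{reals}^{n_1}*\cdots*\mathbf{reals}^{n_k}$,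 and by $\Gamma\vdash\underline\lambda x.t:\underline\sigma\multimap\underline\rho$ for $\Gamma;x:\underline\sigma\vdash t:\underline\rho$. * $\Gamma;x:\underline\sigma\vdash t:\underline\rho$ is generated by: $x:\underline\sigma$; $\langle\rangle:\underline{\mathbf 1}$, pairs and projections; $\lambda y.t:\tau\to\underline\rho$ for $\Gamma,y:\tau;x:\underline\sigma\vdash t:\underline\rho$; $t\,s:\underline\rho$ for $t:\tau\to\underline\rho$ and $\Gamma\vdash s:\tau$; $!t\otimes s:{!\tau}\otimes\underline\rho$ for $\Gamma\vdash t:\tau$ and $s:\underline\rho$; $\mathbf{case}\ t\ \mathbf{of}\ !y\otimes z\to s:\underline\rho'$ for $t:{!\tau}\otimes\underline\rho$ and $\Gamma,y:\tau;z:\underline\rho\vdash s:\underline\rho'$; $t\bullet s:\underline\rho'$ for $\Gamma\vdash t:\underline\rho\multimap\underline\rho'$ and $s:\underline\rho$; $\underline 0:\underline\rho$; $t+s:\underline\rho$ for $t,s:\underline\rho$; and $\mathrm{lop}(t;s):\underline{\mathbf{reals}}^m$ for $\mathrm{lop}\in\mathrm{LOp}^m_{n_1,\dots,n_k;n'_1,\dots,n'_l}$,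 $\Gamma\vdash t:\mathbf{reals}^{n_1}*\cdots*\mathbf{reals}^{n_k}$ and $s:\underline{\mathbf{reals}}^{n'_1}*\cdots*\underline{\mathbf{reals}}^{n'_l}$. (Subterms with no displayed context have context $\Gamma;x:\underline\sigma$.) **Equational theory.** $\beta\eta{+}$-equality, $t\overset{\beta\eta+}{=}s$, is the least congruence on terms of the same type in the same context (for both judgements) containing the usual $\beta\eta$-laws for $\mathbf 1,*,\to$ in both judgements (capture-avoiding substitution $t[s/x]$) and $$\mathbf{case}\ !t\otimes s\ \mathbf{of}\ !y\otimes z\to r = r[t/y,s/z],\qquad t[s/x]=\mathbf{case}\ s\ \mathbf{of}\ !y\otimes z\to t[!y\otimes z/x]\ (y,z\text{ fresh}),$$ $$(\underline\lambda x.t)\bullet s=t[s/x],\quad t=\underline\lambda x.\,t\bullet x,\quad t+\underline0=t=\underline0+t,\quad (t+s)+r=t+(s+r),\quad t+s=s+t,$$ and, for $\Gamma;x:\underline\rho\vdash t:\underline\rho'$, $\ t[\underline0/x]=\underline0$ and $t[s+r/x]=t[s/x]+t[r/x]$. **Models.** A *categorical model* is a Cartesian closed category $\mathcal C$ (chosen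 structure) with a locally indexed category $\mathcal L:\mathcal C^{op}\to\mathbf{Cat}$ (a strict functor such that all $\mathcal L(C)$ have the same objects and all $\mathcal L(f)$ are the identity on objects) such that * each $\mathcal L(C)$ has chosen finite biproducts $(\mathbb 1,\times)$, preserved strictly (with projections and injections) by each $\mathcal L(f)$; * for each projection $\pi_1:C\times D\to C$, $\mathcal L(\pi_1)$ has a left adjoint ${!D}\otimes-$ and a right adjoint $D\Rightarrow-$, with action on objects independent of $C$ and with adjunction bijections $\Phi:\mathcal L(C)({!D}\otimes L,L')\cong\mathcal L(C\times D)(L,L')$ and $\Psi:\mathcal L(C\times D)(L,L')\cong\mathcal L(C)(L,D\Rightarrow L')$ natural also in $C$ (Beck–Chevalley); * for all $L,L'$ there are an object $L\multimap L'$ of $\mathcal C$ and bijections $\underline\Lambda:\mathcal L(C)(L,L')\cong\mathcal C(C,L\multimap L')$ natural in $C$. An *interpretation* in a model is a choice of objects $[\![\mathbf{reals}^n]\!]$ of $\mathcal C$ and $[\![\underline{\mathbf{reals}}^n]\!]$ of $\mathcal L$ and of morphisms $[\![\mathrm{op}]\!]\in\mathcal C([\![\mathbf{reals}^{n_1}*\cdots*\mathbf{reals}^{n_k}]\!],[\![\mathbf{reals}^m]\!])$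 and $[\![\mathrm{lop}]\!]\in\mathcal L([\![\mathbf{reals}^{n_1}*\cdots*\mathbf{reals}^{n_k}]\!])([\![\underline{\mathbf{reals}}^{n'_1}*\cdots*\underline{\mathbf{reals}}^{n'_l}]\!],[\![\underline{\mathbf{reals}}^m]\!])$. Types are interpreted by the corresponding structure and contexts by products. Terms $\Gamma\vdash t:\tau$ are interpreted as $[\![t]\!]\in\mathcal C([\![\Gamma]\!],[\![\tau]\!])$ and terms $\Gamma;x:\underline\sigma\vdash t:\underline\rho$ as $[\![t]\!]\in\mathcal L([\![\Gamma]\!])([\![\underline\sigma]\!],[\![\underline\rho]\!])$: the simply typed part by the Cartesian closed structure, with $[\![\mathrm{op}(t)]\!]=[\![t]\!];[\![\mathrm{op}]\!]$; $x$, unit, pairs and projections in the linear judgement by the identity and the products of $\mathcal L([\![\Gamma]\!])$; and $$[\![\lambda y.t]\!]=\Psi[\![t]\!],\quad [\![t\,s]\!]=\mathcal L(\langle\mathrm{id},[\![s]\!]\rangle)(\Psi^{-1}[\![t]\!]),\quad [\![!t\otimes s]\!]=\mathcal L(\langle\mathrm{id},[\![t]\!]\rangle)(\Phi(\mathrm{id}));({!}[\![\tau]\!]\otimes[\![s]\!]),$$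 $$[\![\mathbf{case}\ t\ \mathbf{of}\ !y\otimes z\to s]\!]=[\![t]\!];\Phi^{-1}[\![s]\!],\quad [\![\underline\lambda x.t]\!]=\underline\Lambda[\![t]\!],\quad [\![t\bullet s]\!]=[\![s]\!];\underline\Lambda^{-1}[\![t]\!],$$ $$[\![\mathrm{lop}(t;s)]\!]=[\![s]\!];\mathcal L([\![t]\!])([\![\mathrm{lop}]\!]),\quad [\![\underline0]\!]=\text{the zero morphism},\quad [\![t+s]\!]=\langle\mathrm{id},\mathrm{id}\rangle;[[\![t]\!],[\![s]\!]].$$ **Proposition (soundness and completeness).** For all terms $t,s$ of the same judgement, context and type(s) (for either of the two judgements), $$t\overset{\beta\eta+}{=}s\iff [\![t]\!]=[\![s]\!]\text{ for every interpretation in every categorical model.}$$ Moreover, completeness is witnessed by a single model, the syntactic one: there are a categorical model and an interpretation in it such that $\tau\mapsto[\![\tau]\!]$ and $\underline\sigma\mapsto[\![\underline\sigma]\!]$ are bijections onto the objects of $\mathcal C$ and of $\mathcal L$, every morphism in $\mathcal C([\![\Gamma]\!],[\![\tau]\!])$ and in $\mathcal L([\![\Gamma]\!])([\![\underline\sigma]\!],[\![\underline\rho]\!])$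 is the interpretation of a term, and $[\![t]\!]=[\![s]\!]$ holds in it if and only if $t\overset{\beta\eta+}{=}s$. -/

import Mathlib

universe u v w

namespace LinLang

open CategoryTheory MonoidalCategory CartesianMonoidalCategory

/-! ## The language -/

mutual
/-- Cartesian types: `reals^n`, `1`, `τ * σ`, `τ → σ` and `σ ⊸ ρ` (for linear types `σ`, `ρ`). -/
inductive CTy : Type
  | real (n : ℕ) : CTy
  | unit : CTy
  | prod (τ₁ τ₂ : CTy) : CTy
  | arrow (τ₁ τ₂ : CTy) : CTy
  | lolli (σ ρ : LTy) : CTy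
/-- Linear types: linear `reals^n`, linear `1`, `σ * ρ`, `τ → ρ` and `!τ ⊗ ρ` (for a Cartesian
type `τ`). -/
inductive LTy : Type
  | real (n : ℕ) : LTy
  | unit : LTy
  | prod (σ ρ : LTy) : LTy
  | arrow (τ : CTy) (ρ : LTy) : LTy
  | tensor (τ : CTy) (ρ : LTy) : LTy
end

/-- The primitive operations `Op^m_{n₁,…,n_k}` and the linear operations
`LOp^m_{n₁,…,n_k; n'₁,…,n'_l}`: arbitrary sets, given as parameters of the language. -/
structure Signature where
  Op : List ℕ → ℕ → Type u
  LOp : List ℕ → List ℕ → ℕ → Type u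

/-- `reals^{n₁} * … * reals^{n_k}`, associated to the left; the unit type if `k = 0`. -/
def CTy.reals : List ℕ → CTy
  | [] => .unit
  | n :: ns => ns.foldl (fun τ m => .prod τ (.real m)) (.real n)

/-- The linear type `reals^{n₁} * … * reals^{n_l}`, associated to the left. -/
def LTy.reals : List ℕ → LTy
  | [] => .unit
  | n :: ns => ns.foldl (fun σ m => .prod σ (.real m)) (.real n)

/-- Contexts of Cartesian variables; the most recently bound variable is the head. -/
abbrev Ctx := List CTy

/-- `Var Γ τ`: the variables of type `τ` in the context `Γ` (de Bruijn indices). -/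
inductive Var : Ctx → CTy → Type
  | zero {Γ : Ctx} {τ : CTy} : Var (τ :: Γ) τ
  | succ {Γ : Ctx} {τ τ' : CTy} (x : Var Γ τ) : Var (τ' :: Γ) τ

mutual
/-- `CTm S Γ τ`: the well-typed terms `Γ ⊢ t : τ`, up to renaming of bound variables. -/
inductive CTm (S : Signature.{u}) : Ctx → CTy → Type u
  | var {Γ : Ctx} {τ : CTy} (x : Var Γ τ) : CTm S Γ τ
  | op {Γ : Ctx} {ns : List ℕ} {m : ℕ} (o : S.Op ns m) (t : CTm S Γ (CTy.reals ns)) :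
      CTm S Γ (.real m)
  | unit {Γ : Ctx} : CTm S Γ .unit
  | pair {Γ : Ctx} {τ₁ τ₂ : CTy} (t : CTm S Γ τ₁) (s : CTm S Γ τ₂) : CTm S Γ (.prod τ₁ τ₂)
  | fst {Γ : Ctx} {τ₁ τ₂ : CTy} (t : CTm S Γ (.prod τ₁ τ₂)) : CTm S Γ τ₁
  | snd {Γ : Ctx} {τ₁ τ₂ : CTy} (t : CTm S Γ (.prod τ₁ τ₂)) : CTm S Γ τ₂
  | lam {Γ : Ctx} {τ₁ τ₂ : CTy} (t : CTm S (τ₁ :: Γ) τ₂) : CTm S Γ (.arrow τ₁ τ₂)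
  | app {Γ : Ctx} {τ₁ τ₂ : CTy} (t : CTm S Γ (.arrow τ₁ τ₂)) (s : CTm S Γ τ₁) : CTm S Γ τ₂
  | llam {Γ : Ctx} {σ ρ : LTy} (t : LTm S Γ σ ρ) : CTm S Γ (.lolli σ ρ)
/-- `LTm S Γ σ ρ`: the well-typed terms `Γ; x : σ ⊢ t : ρ`, up to renaming of bound variables.
The constructor `var` is the unique linear variable `x`. -/
inductive LTm (S : Signature.{u}) : Ctx → LTy → LTy → Type u
  | var {Γ : Ctx} {σ : LTy} : LTm S Γ σ σ
  | lop {Γ : Ctx} {σ : LTy} {ns ms : List ℕ} {m : ℕ} (o : S.LOp ns ms m)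
      (t : CTm S Γ (CTy.reals ns)) (s : LTm S Γ σ (LTy.reals ms)) : LTm S Γ σ (.real m)
  | unit {Γ : Ctx} {σ : LTy} : LTm S Γ σ .unit
  | pair {Γ : Ctx} {σ ρ₁ ρ₂ : LTy} (t : LTm S Γ σ ρ₁) (s : LTm S Γ σ ρ₂) :
      LTm S Γ σ (.prod ρ₁ ρ₂)
  | fst {Γ : Ctx} {σ ρ₁ ρ₂ : LTy} (t : LTm S Γ σ (.prod ρ₁ ρ₂)) : LTm S Γ σ ρ₁
  | snd {Γ : Ctx} {σ ρ₁ ρ₂ : LTy} (t : LTm S Γ σ (.prod ρ₁ ρ₂)) : LTm S Γ σ ρ₂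
  | lam {Γ : Ctx} {σ ρ : LTy} {τ : CTy} (t : LTm S (τ :: Γ) σ ρ) : LTm S Γ σ (.arrow τ ρ)
  | app {Γ : Ctx} {σ ρ : LTy} {τ : CTy} (t : LTm S Γ σ (.arrow τ ρ)) (s : CTm S Γ τ) :
      LTm S Γ σ ρ
  | tens {Γ : Ctx} {σ ρ : LTy} {τ : CTy} (t : CTm S Γ τ) (s : LTm S Γ σ ρ) :
      LTm S Γ σ (.tensor τ ρ)
  | tmatch {Γ : Ctx} {σ ρ ρ' : LTy} {τ : CTy} (t : LTm S Γ σ (.tensor τ ρ))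
      (s : LTm S (τ :: Γ) ρ ρ') : LTm S Γ σ ρ'
  | lapp {Γ : Ctx} {σ ρ ρ' : LTy} (t : CTm S Γ (.lolli ρ ρ')) (s : LTm S Γ σ ρ) : LTm S Γ σ ρ'
  | zero {Γ : Ctx} {σ ρ : LTy} : LTm S Γ σ ρ
  | add {Γ : Ctx} {σ ρ : LTy} (t s : LTm S Γ σ ρ) : LTm S Γ σ ρ
end

/-! ## Renaming and capture-avoiding substitution -/

/-- Renamings of Cartesian variables. -/
def Ren (Γ Δ : Ctx) : Type := ∀ ⦃τ : CTy⦄, Var Γ τ → Var Δ τ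

/-- Extension of a renaming under a binder. -/
def Ren.lift {Γ Δ : Ctx} (r : Ren Γ Δ) (τ : CTy) : Ren (τ :: Γ) (τ :: Δ)
  | _, .zero => .zero
  | _, .succ x => .succ (r x)

/-- Weakening by a fresh variable. -/
def Ren.wk (Γ : Ctx) (τ : CTy) : Ren Γ (τ :: Γ) := fun _ x => .succ x

variable {S : Signature.{u}}

mutual
def CTm.rename : ∀ {Γ Δ : Ctx} {τ : CTy}, CTm S Γ τ → Ren Γ Δ → CTm S Δ τ
  | _, _, _, .var x, r => .var (r x)
  | _, _, _, .op o t, r => .op o (t.rename r)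
  | _, _, _, .unit, _ => .unit
  | _, _, _, .pair t s, r => .pair (t.rename r) (s.rename r)
  | _, _, _, .fst t, r => .fst (t.rename r)
  | _, _, _, .snd t, r => .snd (t.rename r)
  | _, _, _, .lam t, r => .lam (t.rename (r.lift _))
  | _, _, _, .app t s, r => .app (t.rename r) (s.rename r)
  | _, _, _, .llam t, r => .llam (t.rename r)
def LTm.rename : ∀ {Γ Δ : Ctx} {σ ρ : LTy}, LTm S Γ σ ρ → Ren Γ Δ → LTm S Δ σ ρ
  | _, _, _, _, .var, _ => .var
  | _, _, _, _, .lop o t s, r => .lop o (t.rename r) (s.rename r)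
  | _, _, _, _, .unit, _ => .unit
  | _, _, _, _, .pair t s, r => .pair (t.rename r) (s.rename r)
  | _, _, _, _, .fst t, r => .fst (t.rename r)
  | _, _, _, _, .snd t, r => .snd (t.rename r)
  | _, _, _, _, .lam t, r => .lam (t.rename (r.lift _))
  | _, _, _, _, .app t s, r => .app (t.rename r) (s.rename r)
  | _, _, _, _, .tens t s, r => .tens (t.rename r) (s.rename r)
  | _, _, _, _, .tmatch t s, r => .tmatch (t.rename r) (s.rename (r.lift _))
  | _, _, _, _, .lapp t s, r => .lapp (t.rename r) (s.rename r)
  | _, _, _, _, .zero, _ => .zero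
  | _, _, _, _, .add t s, r => .add (t.rename r) (s.rename r)
end

/-- The weakening of `Γ ⊢ t : τ` to `Γ, y : τ' ⊢ t : τ`. -/
def CTm.wk {Γ : Ctx} {τ : CTy} (t : CTm S Γ τ) (τ' : CTy) : CTm S (τ' :: Γ) τ :=
  t.rename (Ren.wk Γ τ')

/-- The weakening of `Γ; x : σ ⊢ t : ρ` to `Γ, y : τ'; x : σ ⊢ t : ρ`. -/
def LTm.wk {Γ : Ctx} {σ ρ : LTy} (t : LTm S Γ σ ρ) (τ' : CTy) : LTm S (τ' :: Γ) σ ρ :=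
  t.rename (Ren.wk Γ τ')

/-- Simultaneous substitutions for Cartesian variables. -/
def Sub (S : Signature.{u}) (Γ Δ : Ctx) : Type u := ∀ ⦃τ : CTy⦄, Var Γ τ → CTm S Δ τ

/-- Extension of a substitution under a binder. -/
def Sub.lift {Γ Δ : Ctx} (f : Sub S Γ Δ) (τ : CTy) : Sub S (τ :: Γ) (τ :: Δ)
  | _, .zero => .var .zero
  | _, .succ x => (f x).wk τ

/-- The substitution of one term for the most recent variable, fixing the other variables. -/
def Sub.single {Γ : Ctx} {τ : CTy} (s : CTm S Γ τ) : Sub S (τ :: Γ) Γ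
  | _, .zero => s
  | _, .succ x => .var x

mutual
def CTm.subst : ∀ {Γ Δ : Ctx} {τ : CTy}, CTm S Γ τ → Sub S Γ Δ → CTm S Δ τ
  | _, _, _, .var x, f => f x
  | _, _, _, .op o t, f => .op o (t.subst f)
  | _, _, _, .unit, _ => .unit
  | _, _, _, .pair t s, f => .pair (t.subst f) (s.subst f)
  | _, _, _, .fst t, f => .fst (t.subst f)
  | _, _, _, .snd t, f => .snd (t.subst f)
  | _, _, _, .lam t, f => .lam (t.subst (f.lift _))
  | _, _, _, .app t s, f => .app (t.subst f) (s.subst f)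
  | _, _, _, .llam t, f => .llam (t.subst f)
def LTm.subst : ∀ {Γ Δ : Ctx} {σ ρ : LTy}, LTm S Γ σ ρ → Sub S Γ Δ → LTm S Δ σ ρ
  | _, _, _, _, .var, _ => .var
  | _, _, _, _, .lop o t s, f => .lop o (t.subst f) (s.subst f)
  | _, _, _, _, .unit, _ => .unit
  | _, _, _, _, .pair t s, f => .pair (t.subst f) (s.subst f)
  | _, _, _, _, .fst t, f => .fst (t.subst f)
  | _, _, _, _, .snd t, f => .snd (t.subst f)
  | _, _, _, _, .lam t, f => .lam (t.subst (f.lift _))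
  | _, _, _, _, .app t s, f => .app (t.subst f) (s.subst f)
  | _, _, _, _, .tens t s, f => .tens (t.subst f) (s.subst f)
  | _, _, _, _, .tmatch t s, f => .tmatch (t.subst f) (s.subst (f.lift _))
  | _, _, _, _, .lapp t s, f => .lapp (t.subst f) (s.subst f)
  | _, _, _, _, .zero, _ => .zero
  | _, _, _, _, .add t s, f => .add (t.subst f) (s.subst f)
end

/-- `t[s/y]` for the most recent Cartesian variable `y` of `t`. -/
def CTm.inst {Γ : Ctx} {τ τ' : CTy} (t : CTm S (τ' :: Γ) τ) (s : CTm S Γ τ') : CTm S Γ τ :=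
  t.subst (Sub.single s)

/-- `t[s/y]` for the most recent Cartesian variable `y` of `t`. -/
def LTm.inst {Γ : Ctx} {σ ρ : LTy} {τ' : CTy} (t : LTm S (τ' :: Γ) σ ρ) (s : CTm S Γ τ') :
    LTm S Γ σ ρ :=
  t.subst (Sub.single s)

/-- `t[s/x]` for the linear variable `x` of `t`. -/
def LTm.lsubst : ∀ {Γ : Ctx} {σ' σ ρ : LTy}, LTm S Γ σ ρ → LTm S Γ σ' σ → LTm S Γ σ' ρ
  | _, _, _, _, .var, s => s
  | _, _, _, _, .lop o t r, s => .lop o t (r.lsubst s)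
  | _, _, _, _, .unit, _ => .unit
  | _, _, _, _, .pair t r, s => .pair (t.lsubst s) (r.lsubst s)
  | _, _, _, _, .fst t, s => .fst (t.lsubst s)
  | _, _, _, _, .snd t, s => .snd (t.lsubst s)
  | _, _, _, _, .lam t, s => .lam (t.lsubst (s.wk _))
  | _, _, _, _, .app t r, s => .app (t.lsubst s) r
  | _, _, _, _, .tens t r, s => .tens t (r.lsubst s)
  | _, _, _, _, .tmatch t r, s => .tmatch (t.lsubst s) r
  | _, _, _, _, .lapp t r, s => .lapp t (r.lsubst s)
  | _, _, _, _, .zero, _ => .zero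
  | _, _, _, _, .add t r, s => .add (t.lsubst s) (r.lsubst s)

/-! ## The `βη+`-equational theory -/

mutual
/-- `CEq t s`: the `βη+`-equality of the terms `Γ ⊢ t : τ` and `Γ ⊢ s : τ`. -/
inductive CEq {S : Signature.{u}} : ∀ {Γ : Ctx} {τ : CTy}, CTm S Γ τ → CTm S Γ τ → Prop
  | refl {Γ : Ctx} {τ : CTy} (t : CTm S Γ τ) : CEq t t
  | symm {Γ : Ctx} {τ : CTy} {t s : CTm S Γ τ} : CEq t s → CEq s t
  | trans {Γ : Ctx} {τ : CTy} {t s r : CTm S Γ τ} : CEq t s → CEq s r → CEq t r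
  | congr_op {Γ : Ctx} {ns : List ℕ} {m : ℕ} (o : S.Op ns m) {t t' : CTm S Γ (CTy.reals ns)} :
      CEq t t' → CEq (.op o t) (.op o t')
  | congr_pair {Γ : Ctx} {τ₁ τ₂ : CTy} {t t' : CTm S Γ τ₁} {s s' : CTm S Γ τ₂} :
      CEq t t' → CEq s s' → CEq (.pair t s) (.pair t' s')
  | congr_fst {Γ : Ctx} {τ₁ τ₂ : CTy} {t t' : CTm S Γ (.prod τ₁ τ₂)} :
      CEq t t' → CEq (.fst t) (.fst t')
  | congr_snd {Γ : Ctx} {τ₁ τ₂ : CTy} {t t' : CTm S Γ (.prod τ₁ τ₂)} :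
      CEq t t' → CEq (.snd t) (.snd t')
  | congr_lam {Γ : Ctx} {τ₁ τ₂ : CTy} {t t' : CTm S (τ₁ :: Γ) τ₂} :
      CEq t t' → CEq (.lam t) (.lam t')
  | congr_app {Γ : Ctx} {τ₁ τ₂ : CTy} {t t' : CTm S Γ (.arrow τ₁ τ₂)} {s s' : CTm S Γ τ₁} :
      CEq t t' → CEq s s' → CEq (.app t s) (.app t' s')
  | congr_llam {Γ : Ctx} {σ ρ : LTy} {t t' : LTm S Γ σ ρ} :
      LEq t t' → CEq (.llam t) (.llam t')
  | unit_eta {Γ : Ctx} (t : CTm S Γ .unit) : CEq t .unit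
  | fst_beta {Γ : Ctx} {τ₁ τ₂ : CTy} (t : CTm S Γ τ₁) (s : CTm S Γ τ₂) :
      CEq (.fst (.pair t s)) t
  | snd_beta {Γ : Ctx} {τ₁ τ₂ : CTy} (t : CTm S Γ τ₁) (s : CTm S Γ τ₂) :
      CEq (.snd (.pair t s)) s
  | pair_eta {Γ : Ctx} {τ₁ τ₂ : CTy} (t : CTm S Γ (.prod τ₁ τ₂)) :
      CEq t (.pair (.fst t) (.snd t))
  | lam_beta {Γ : Ctx} {τ₁ τ₂ : CTy} (t : CTm S (τ₁ :: Γ) τ₂) (s : CTm S Γ τ₁) :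
      CEq (.app (.lam t) s) (t.inst s)
  | lam_eta {Γ : Ctx} {τ₁ τ₂ : CTy} (t : CTm S Γ (.arrow τ₁ τ₂)) :
      CEq t (.lam (.app (t.wk τ₁) (.var .zero)))
  | llam_eta {Γ : Ctx} {σ ρ : LTy} (t : CTm S Γ (.lolli σ ρ)) : CEq t (.llam (.lapp t .var))
/-- `LEq t s`: the `βη+`-equality of the terms `Γ; x : σ ⊢ t : ρ` and `Γ; x : σ ⊢ s : ρ`. -/
inductive LEq {S : Signature.{u}} : ∀ {Γ : Ctx} {σ ρ : LTy}, LTm S Γ σ ρ → LTm S Γ σ ρ → Prop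
  | refl {Γ : Ctx} {σ ρ : LTy} (t : LTm S Γ σ ρ) : LEq t t
  | symm {Γ : Ctx} {σ ρ : LTy} {t s : LTm S Γ σ ρ} : LEq t s → LEq s t
  | trans {Γ : Ctx} {σ ρ : LTy} {t s r : LTm S Γ σ ρ} : LEq t s → LEq s r → LEq t r
  | congr_lop {Γ : Ctx} {σ : LTy} {ns ms : List ℕ} {m : ℕ} (o : S.LOp ns ms m)
      {t t' : CTm S Γ (CTy.reals ns)} {s s' : LTm S Γ σ (LTy.reals ms)} :
      CEq t t' → LEq s s' → LEq (.lop o t s) (.lop o t' s')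
  | congr_pair {Γ : Ctx} {σ ρ₁ ρ₂ : LTy} {t t' : LTm S Γ σ ρ₁} {s s' : LTm S Γ σ ρ₂} :
      LEq t t' → LEq s s' → LEq (.pair t s) (.pair t' s')
  | congr_fst {Γ : Ctx} {σ ρ₁ ρ₂ : LTy} {t t' : LTm S Γ σ (.prod ρ₁ ρ₂)} :
      LEq t t' → LEq (.fst t) (.fst t')
  | congr_snd {Γ : Ctx} {σ ρ₁ ρ₂ : LTy} {t t' : LTm S Γ σ (.prod ρ₁ ρ₂)} :
      LEq t t' → LEq (.snd t) (.snd t')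
  | congr_lam {Γ : Ctx} {σ ρ : LTy} {τ : CTy} {t t' : LTm S (τ :: Γ) σ ρ} :
      LEq t t' → LEq (.lam t) (.lam t')
  | congr_app {Γ : Ctx} {σ ρ : LTy} {τ : CTy} {t t' : LTm S Γ σ (.arrow τ ρ)}
      {s s' : CTm S Γ τ} : LEq t t' → CEq s s' → LEq (.app t s) (.app t' s')
  | congr_tens {Γ : Ctx} {σ ρ : LTy} {τ : CTy} {t t' : CTm S Γ τ} {s s' : LTm S Γ σ ρ} :
      CEq t t' → LEq s s' → LEq (.tens t s) (.tens t' s')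
  | congr_tmatch {Γ : Ctx} {σ ρ ρ' : LTy} {τ : CTy} {t t' : LTm S Γ σ (.tensor τ ρ)}
      {s s' : LTm S (τ :: Γ) ρ ρ'} : LEq t t' → LEq s s' → LEq (.tmatch t s) (.tmatch t' s')
  | congr_lapp {Γ : Ctx} {σ ρ ρ' : LTy} {t t' : CTm S Γ (.lolli ρ ρ')} {s s' : LTm S Γ σ ρ} :
      CEq t t' → LEq s s' → LEq (.lapp t s) (.lapp t' s')
  | congr_add {Γ : Ctx} {σ ρ : LTy} {t t' s s' : LTm S Γ σ ρ} :
      LEq t t' → LEq s s' → LEq (.add t s) (.add t' s')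
  | unit_eta {Γ : Ctx} {σ : LTy} (t : LTm S Γ σ .unit) : LEq t .unit
  | fst_beta {Γ : Ctx} {σ ρ₁ ρ₂ : LTy} (t : LTm S Γ σ ρ₁) (s : LTm S Γ σ ρ₂) :
      LEq (.fst (.pair t s)) t
  | snd_beta {Γ : Ctx} {σ ρ₁ ρ₂ : LTy} (t : LTm S Γ σ ρ₁) (s : LTm S Γ σ ρ₂) :
      LEq (.snd (.pair t s)) s
  | pair_eta {Γ : Ctx} {σ ρ₁ ρ₂ : LTy} (t : LTm S Γ σ (.prod ρ₁ ρ₂)) :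
      LEq t (.pair (.fst t) (.snd t))
  | lam_beta {Γ : Ctx} {σ ρ : LTy} {τ : CTy} (t : LTm S (τ :: Γ) σ ρ) (s : CTm S Γ τ) :
      LEq (.app (.lam t) s) (t.inst s)
  | lam_eta {Γ : Ctx} {σ ρ : LTy} {τ : CTy} (t : LTm S Γ σ (.arrow τ ρ)) :
      LEq t (.lam (.app (t.wk τ) (.var .zero)))
  /-- `case !t ⊗ s of !y ⊗ z → r = r[t/y, s/z]` -/
  | tens_beta {Γ : Ctx} {σ ρ ρ' : LTy} {τ : CTy} (t : CTm S Γ τ) (s : LTm S Γ σ ρ)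
      (r : LTm S (τ :: Γ) ρ ρ') : LEq (.tmatch (.tens t s) r) ((r.inst t).lsubst s)
  /-- `t[s/x] = case s of !y ⊗ z → t[!y ⊗ z/x]` with `y`, `z` fresh -/
  | tens_eta {Γ : Ctx} {σ ρ ρ' : LTy} {τ : CTy} (t : LTm S Γ (.tensor τ ρ) ρ')
      (s : LTm S Γ σ (.tensor τ ρ)) :
      LEq (t.lsubst s) (.tmatch s ((t.wk τ).lsubst (.tens (.var .zero) .var)))
  | llam_beta {Γ : Ctx} {σ ρ ρ' : LTy} (t : LTm S Γ ρ ρ') (s : LTm S Γ σ ρ) :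
      LEq (.lapp (.llam t) s) (t.lsubst s)
  | add_zero {Γ : Ctx} {σ ρ : LTy} (t : LTm S Γ σ ρ) : LEq (.add t .zero) t
  | zero_add {Γ : Ctx} {σ ρ : LTy} (t : LTm S Γ σ ρ) : LEq (.add .zero t) t
  | add_assoc {Γ : Ctx} {σ ρ : LTy} (t s r : LTm S Γ σ ρ) :
      LEq (.add (.add t s) r) (.add t (.add s r))
  | add_comm {Γ : Ctx} {σ ρ : LTy} (t s : LTm S Γ σ ρ) : LEq (.add t s) (.add s t)
  | subst_zero {Γ : Ctx} {σ ρ ρ' : LTy} (t : LTm S Γ ρ ρ') :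
      LEq (t.lsubst (.zero : LTm S Γ σ ρ)) .zero
  | subst_add {Γ : Ctx} {σ ρ ρ' : LTy} (t : LTm S Γ ρ ρ') (s r : LTm S Γ σ ρ) :
      LEq (t.lsubst (.add s r)) (.add (t.lsubst s) (t.lsubst r))
end

/-! ## Categorical models -/

/-- A locally indexed category over `C`, that is, a strict functor `L : Cᵒᵖ ⥤ Cat` such that all
the categories `L(c)` have the same objects and all the functors `L(f)` are the identity on
objects. Here `Hom c X Y` is the set of morphisms from `X` to `Y` in `L(c)`, `comp` is composition
in diagrammatic order, and `map f` is the action of `L(f)` on morphisms. -/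
structure LocallyIndexedCategory (C : Type w) [Category.{v} C] where
  Obj : Type w
  Hom : C → Obj → Obj → Type v
  id (c : C) (X : Obj) : Hom c X X
  comp {c : C} {X Y Z : Obj} (f : Hom c X Y) (g : Hom c Y Z) : Hom c X Z
  id_comp {c : C} {X Y : Obj} (f : Hom c X Y) : comp (id c X) f = f
  comp_id {c : C} {X Y : Obj} (f : Hom c X Y) : comp f (id c Y) = f
  assoc {c : C} {W X Y Z : Obj} (f : Hom c W X) (g : Hom c X Y) (h : Hom c Y Z) :
    comp (comp f g) h = comp f (comp g h)
  map {c c' : C} (a : c' ⟶ c) {X Y : Obj} (f : Hom c X Y) : Hom c' X Y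
  map_id {c c' : C} (a : c' ⟶ c) (X : Obj) : map a (id c X) = id c' X
  map_comp {c c' : C} (a : c' ⟶ c) {X Y Z : Obj} (f : Hom c X Y) (g : Hom c Y Z) :
    map a (comp f g) = comp (map a f) (map a g)
  id_map {c : C} {X Y : Obj} (f : Hom c X Y) : map (𝟙 c) f = f
  comp_map {c c' c'' : C} (b : c'' ⟶ c') (a : c' ⟶ c) {X Y : Obj} (f : Hom c X Y) :
    map (b ≫ a) f = map b (map a f)

variable {C : Type w} [Category.{v} C]

/-- Chosen finite biproducts in every `L(c)`, preserved by every `L(f)`: a zero object and, for all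
`X` and `Y`, an object that is both a product and a coproduct of `X` and `Y` in a compatible
way. -/
structure Biadditive (L : LocallyIndexedCategory.{v, w} C) where
  unit : L.Obj
  toUnit (c : C) (X : L.Obj) : L.Hom c X unit
  toUnit_unique {c : C} {X : L.Obj} (f : L.Hom c X unit) : f = toUnit c X
  fromUnit (c : C) (X : L.Obj) : L.Hom c unit X
  fromUnit_unique {c : C} {X : L.Obj} (f : L.Hom c unit X) : f = fromUnit c X
  prod : L.Obj → L.Obj → L.Obj
  fst (c : C) (X Y : L.Obj) : L.Hom c (prod X Y) X
  snd (c : C) (X Y : L.Obj) : L.Hom c (prod X Y) Y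
  pair {c : C} {Z X Y : L.Obj} (f : L.Hom c Z X) (g : L.Hom c Z Y) : L.Hom c Z (prod X Y)
  pair_fst {c : C} {Z X Y : L.Obj} (f : L.Hom c Z X) (g : L.Hom c Z Y) :
    L.comp (pair f g) (fst c X Y) = f
  pair_snd {c : C} {Z X Y : L.Obj} (f : L.Hom c Z X) (g : L.Hom c Z Y) :
    L.comp (pair f g) (snd c X Y) = g
  pair_unique {c : C} {Z X Y : L.Obj} (h : L.Hom c Z (prod X Y)) :
    h = pair (L.comp h (fst c X Y)) (L.comp h (snd c X Y))
  inl (c : C) (X Y : L.Obj) : L.Hom c X (prod X Y)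
  inr (c : C) (X Y : L.Obj) : L.Hom c Y (prod X Y)
  copair {c : C} {X Y Z : L.Obj} (f : L.Hom c X Z) (g : L.Hom c Y Z) : L.Hom c (prod X Y) Z
  inl_copair {c : C} {X Y Z : L.Obj} (f : L.Hom c X Z) (g : L.Hom c Y Z) :
    L.comp (inl c X Y) (copair f g) = f
  inr_copair {c : C} {X Y Z : L.Obj} (f : L.Hom c X Z) (g : L.Hom c Y Z) :
    L.comp (inr c X Y) (copair f g) = g
  copair_unique {c : C} {X Y Z : L.Obj} (h : L.Hom c (prod X Y) Z) :
    h = copair (L.comp (inl c X Y) h) (L.comp (inr c X Y) h)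
  inl_fst (c : C) (X Y : L.Obj) : L.comp (inl c X Y) (fst c X Y) = L.id c X
  inl_snd (c : C) (X Y : L.Obj) :
    L.comp (inl c X Y) (snd c X Y) = L.comp (toUnit c X) (fromUnit c Y)
  inr_fst (c : C) (X Y : L.Obj) :
    L.comp (inr c X Y) (fst c X Y) = L.comp (toUnit c Y) (fromUnit c X)
  inr_snd (c : C) (X Y : L.Obj) : L.comp (inr c X Y) (snd c X Y) = L.id c Y
  map_fst {c c' : C} (a : c' ⟶ c) (X Y : L.Obj) : L.map a (fst c X Y) = fst c' X Y
  map_snd {c c' : C} (a : c' ⟶ c) (X Y : L.Obj) : L.map a (snd c X Y) = snd c' X Y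
  map_inl {c c' : C} (a : c' ⟶ c) (X Y : L.Obj) : L.map a (inl c X Y) = inl c' X Y
  map_inr {c c' : C} (a : c' ⟶ c) (X Y : L.Obj) : L.map a (inr c X Y) = inr c' X Y

variable [CartesianMonoidalCategory C]

/-- Support for `!(-)⊗(-)`-types: for all `c` and `d`, the functor `L(π₁) : L(c) ⥤ L(c × d)` has a
left adjoint, given on objects by `X ↦ !d ⊗ X` (independently of `c`) and presented by the bijection
`Φ : L(c)(!d ⊗ X, Y) ≃ L(c × d)(X, Y)`, natural in `Y` and (the Beck-Chevalley condition) in `c`. -/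
structure TensorTypes (L : LocallyIndexedCategory.{v, w} C) where
  tensor : C → L.Obj → L.Obj
  Φ (c d : C) (X Y : L.Obj) : L.Hom c (tensor d X) Y ≃ L.Hom (c ⊗ d) X Y
  Φ_comp {c d : C} {X Y Z : L.Obj} (f : L.Hom c (tensor d X) Y) (g : L.Hom c Y Z) :
    Φ c d X Z (L.comp f g) = L.comp (Φ c d X Y f) (L.map (fst c d) g)
  Φ_map {c c' d : C} (a : c' ⟶ c) {X Y : L.Obj} (f : L.Hom c (tensor d X) Y) :
    Φ c' d X Y (L.map a f) = L.map (a ▷ d) (Φ c d X Y f)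

/-- The action on morphisms of the left adjoint `!d ⊗ (-) : L(c) ⥤ L(c)` of `L(π₁)`: the unique one
that makes `Φ` natural in `X`. -/
def TensorTypes.mapRight {L : LocallyIndexedCategory.{v, w} C} (T : TensorTypes L)
    {c : C} (d : C) {X Y : L.Obj} (h : L.Hom c X Y) :
    L.Hom c (T.tensor d X) (T.tensor d Y) :=
  (T.Φ c d X (T.tensor d Y)).symm
    (L.comp (L.map (fst c d) h) (T.Φ c d Y (T.tensor d Y) (L.id c (T.tensor d Y))))

/-- Support for `⇒`-types: for all `c` and `d`, the functor `L(π₁) : L(c) ⥤ L(c × d)` has a right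
adjoint, given on objects by `Y ↦ (d ⇒ Y)` (independently of `c`) and presented by the bijection
`Ψ : L(c × d)(X, Y) ≃ L(c)(X, d ⇒ Y)`, natural in `X` and (the Beck-Chevalley condition) in `c`. -/
structure ArrowTypes (L : LocallyIndexedCategory.{v, w} C) where
  arrow : C → L.Obj → L.Obj
  Ψ (c d : C) (X Y : L.Obj) : L.Hom (c ⊗ d) X Y ≃ L.Hom c X (arrow d Y)
  Ψ_comp {c d : C} {W X Y : L.Obj} (g : L.Hom c W X) (f : L.Hom (c ⊗ d) X Y) :
    Ψ c d W Y (L.comp (L.map (fst c d) g) f) = L.comp g (Ψ c d X Y f)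
  Ψ_map {c c' d : C} (a : c' ⟶ c) {X Y : L.Obj} (f : L.Hom (c ⊗ d) X Y) :
    Ψ c' d X Y (L.map (a ▷ d) f) = L.map a (Ψ c d X Y f)

/-- Support for Cartesian `⊸`-types: representability of `c ↦ L(c)(X, Y)` for all `X` and `Y`. -/
structure LolliTypes (L : LocallyIndexedCategory.{v, w} C) where
  lolli : L.Obj → L.Obj → C
  Λ (c : C) (X Y : L.Obj) : L.Hom c X Y ≃ (c ⟶ lolli X Y)
  Λ_map {c c' : C} (a : c' ⟶ c) {X Y : L.Obj} (f : L.Hom c X Y) :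
    Λ c' X Y (L.map a f) = a ≫ Λ c X Y f

/-- A categorical model: a Cartesian closed category `C` with a biadditive locally indexed category
over it that supports `!(-)⊗(-)`-types, `⇒`-types and Cartesian `⊸`-types. -/
structure CategoricalModel where
  C : Type w
  [category : Category.{v} C]
  [cartesian : CartesianMonoidalCategory C]
  [closed : MonoidalClosed C]
  L : LocallyIndexedCategory.{v, w} C
  biadditive : Biadditive L
  tensorTypes : TensorTypes L
  arrowTypes : ArrowTypes L
  lolliTypes : LolliTypes L

attribute [instance] CategoricalModel.category CategoricalModel.cartesian CategoricalModel.closed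

/-! ## Interpretation of the language in a categorical model -/

mutual
/-- The interpretation of Cartesian types, given that of the types `reals^n`. -/
def CTy.interp (M : CategoricalModel.{v, w}) (R : ℕ → M.C) (R' : ℕ → M.L.Obj) :
    CTy → M.C
  | .real n => R n
  | .unit => 𝟙_ M.C
  | .prod τ₁ τ₂ => τ₁.interp M R R' ⊗ τ₂.interp M R R'
  | .arrow τ₁ τ₂ => (ihom (τ₁.interp M R R')).obj (τ₂.interp M R R')
  | .lolli σ ρ => M.lolliTypes.lolli (σ.interp M R R') (ρ.interp M R R')
/-- The interpretation of linear types, given that of the types `reals^n`. -/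
def LTy.interp (M : CategoricalModel.{v, w}) (R : ℕ → M.C) (R' : ℕ → M.L.Obj) :
    LTy → M.L.Obj
  | .real n => R' n
  | .unit => M.biadditive.unit
  | .prod σ ρ => M.biadditive.prod (σ.interp M R R') (ρ.interp M R R')
  | .arrow τ ρ => M.arrowTypes.arrow (τ.interp M R R') (ρ.interp M R R')
  | .tensor τ ρ => M.tensorTypes.tensor (τ.interp M R R') (ρ.interp M R R')
end

/-- The choices that determine the interpretation of the language in `M`: objects for the Cartesian
and the linear types `reals^n`, and morphisms for the operations. -/
structure Interpretation (S : Signature.{u}) (M : CategoricalModel.{v, w}) where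
  real : ℕ → M.C
  lreal : ℕ → M.L.Obj
  op {ns : List ℕ} {m : ℕ} (o : S.Op ns m) :
    (CTy.reals ns).interp M real lreal ⟶ (CTy.real m).interp M real lreal
  lop {ns ms : List ℕ} {m : ℕ} (o : S.LOp ns ms m) :
    M.L.Hom ((CTy.reals ns).interp M real lreal) ((LTy.reals ms).interp M real lreal)
      ((LTy.real m).interp M real lreal)

namespace Interpretation

variable {M : CategoricalModel.{v, w}} (I : Interpretation S M)

/-- `⟦τ⟧` for a Cartesian type `τ`. -/
def cty (τ : CTy) : M.C := τ.interp M I.real I.lreal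

/-- `⟦σ⟧` for a linear type `σ`. -/
def lty (σ : LTy) : M.L.Obj := σ.interp M I.real I.lreal

/-- `⟦x₁ : τ₁, …, x_n : τ_n⟧ = ⟦τ₁⟧ × ⋯ × ⟦τ_n⟧`. -/
def ctx : Ctx → M.C
  | [] => 𝟙_ M.C
  | τ :: Γ => ctx Γ ⊗ I.cty τ

/-- The projection that interprets a variable. -/
def var : ∀ {Γ : Ctx} {τ : CTy}, Var Γ τ → (I.ctx Γ ⟶ I.cty τ)
  | _, _, .zero (Γ := Γ) (τ := τ) => snd (I.ctx Γ) (I.cty τ)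
  | _, _, .succ (Γ := Γ) (τ' := τ') x => fst (I.ctx Γ) (I.cty τ') ≫ var x

mutual
/-- `⟦Γ ⊢ t : τ⟧ ∈ C(⟦Γ⟧, ⟦τ⟧)`. -/
def ctm : ∀ {Γ : Ctx} {τ : CTy}, CTm S Γ τ → (I.ctx Γ ⟶ I.cty τ)
  | _, _, .var x => I.var x
  | _, _, .op o t => ctm t ≫ I.op o
  | _, _, .unit => toUnit _
  | _, _, .pair t s => lift (ctm t) (ctm s)
  | _, _, .fst (τ₁ := τ₁) (τ₂ := τ₂) t => ctm t ≫ fst (I.cty τ₁) (I.cty τ₂)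
  | _, _, .snd (τ₁ := τ₁) (τ₂ := τ₂) t => ctm t ≫ snd (I.cty τ₁) (I.cty τ₂)
  | _, _, .lam (Γ := Γ) (τ₁ := τ₁) t =>
      MonoidalClosed.curry (lift (snd (I.cty τ₁) (I.ctx Γ)) (fst (I.cty τ₁) (I.ctx Γ)) ≫ ctm t)
  | _, _, .app (τ₁ := τ₁) (τ₂ := τ₂) t s =>
      lift (ctm s) (ctm t) ≫ (ihom.ev (I.cty τ₁)).app (I.cty τ₂)
  | _, _, .llam (Γ := Γ) (σ := σ) (ρ := ρ) t =>
      M.lolliTypes.Λ (I.ctx Γ) (I.lty σ) (I.lty ρ) (ltm t)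
/-- `⟦Γ; x : σ ⊢ t : ρ⟧ ∈ L(⟦Γ⟧)(⟦σ⟧, ⟦ρ⟧)`. -/
def ltm : ∀ {Γ : Ctx} {σ ρ : LTy}, LTm S Γ σ ρ → M.L.Hom (I.ctx Γ) (I.lty σ) (I.lty ρ)
  | _, _, _, .var (Γ := Γ) (σ := σ) => M.L.id (I.ctx Γ) (I.lty σ)
  | _, _, _, .lop o t s => M.L.comp (ltm s) (M.L.map (ctm t) (I.lop o))
  | _, _, _, .unit (Γ := Γ) (σ := σ) => M.biadditive.toUnit (I.ctx Γ) (I.lty σ)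
  | _, _, _, .pair t s => M.biadditive.pair (ltm t) (ltm s)
  | _, _, _, .fst (Γ := Γ) (ρ₁ := ρ₁) (ρ₂ := ρ₂) t =>
      M.L.comp (ltm t) (M.biadditive.fst (I.ctx Γ) (I.lty ρ₁) (I.lty ρ₂))
  | _, _, _, .snd (Γ := Γ) (ρ₁ := ρ₁) (ρ₂ := ρ₂) t =>
      M.L.comp (ltm t) (M.biadditive.snd (I.ctx Γ) (I.lty ρ₁) (I.lty ρ₂))
  | _, _, _, .lam (Γ := Γ) (σ := σ) (ρ := ρ) (τ := τ) t =>
      M.arrowTypes.Ψ (I.ctx Γ) (I.cty τ) (I.lty σ) (I.lty ρ) (ltm t)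
  | _, _, _, .app (Γ := Γ) (σ := σ) (ρ := ρ) (τ := τ) t s =>
      M.L.map (lift (𝟙 (I.ctx Γ)) (ctm s))
        ((M.arrowTypes.Ψ (I.ctx Γ) (I.cty τ) (I.lty σ) (I.lty ρ)).symm (ltm t))
  | _, _, _, .tens (Γ := Γ) (σ := σ) (ρ := ρ) (τ := τ) t s =>
      M.L.comp
        (M.L.map (lift (𝟙 (I.ctx Γ)) (ctm t))
          (M.tensorTypes.Φ (I.ctx Γ) (I.cty τ) (I.lty σ)
            (M.tensorTypes.tensor (I.cty τ) (I.lty σ))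
            (M.L.id (I.ctx Γ) (M.tensorTypes.tensor (I.cty τ) (I.lty σ)))))
        (M.tensorTypes.mapRight (I.cty τ) (ltm (ρ := ρ) s))
  | _, _, _, .tmatch (Γ := Γ) (ρ := ρ) (ρ' := ρ') (τ := τ) t s =>
      M.L.comp (ltm t)
        ((M.tensorTypes.Φ (I.ctx Γ) (I.cty τ) (I.lty ρ) (I.lty ρ')).symm (ltm s))
  | _, _, _, .lapp (Γ := Γ) (ρ := ρ) (ρ' := ρ') t s =>
      M.L.comp (ltm s) ((M.lolliTypes.Λ (I.ctx Γ) (I.lty ρ) (I.lty ρ')).symm (ctm t))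
  | _, _, _, .zero (Γ := Γ) (σ := σ) (ρ := ρ) =>
      M.L.comp (M.biadditive.toUnit (I.ctx Γ) (I.lty σ)) (M.biadditive.fromUnit (I.ctx Γ) (I.lty ρ))
  | _, _, _, .add (Γ := Γ) (σ := σ) t s =>
      M.L.comp
        (M.biadditive.pair (M.L.id (I.ctx Γ) (I.lty σ)) (M.L.id (I.ctx Γ) (I.lty σ)))
        (M.biadditive.copair (ltm t) (ltm s))
end

/-- Interpretations that exhibit `M` as the term model, up to renaming of objects and isomorphism of
hom-sets: the objects are exactly the types, every morphism between denotations of contexts and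
types is the denotation of a term, and two terms have the same denotation exactly if they are
`βη+`-equal. -/
structure IsTermModel : Prop where
  cty_bijective : Function.Bijective I.cty
  lty_bijective : Function.Bijective I.lty
  ctm_surjective (Γ : Ctx) (τ : CTy) : Function.Surjective (I.ctm (Γ := Γ) (τ := τ))
  ltm_surjective (Γ : Ctx) (σ ρ : LTy) : Function.Surjective (I.ltm (Γ := Γ) (σ := σ) (ρ := ρ))
  ctm_eq_iff {Γ : Ctx} {τ : CTy} (t s : CTm S Γ τ) : I.ctm t = I.ctm s ↔ CEq t s
  ltm_eq_iff {Γ : Ctx} {σ ρ : LTy} (t s : LTm S Γ σ ρ) : I.ltm t = I.ltm s ↔ LEq t s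

end Interpretation

end LinLang

-- Soundness rests on one fact: interpretation turns substitution into the structure of the model.
-- Substitution for Cartesian variables becomes precomposition, or reindexing `L(a)` in the linear
-- judgement (`interp_subst`), and substitution for the linear variable becomes composition inside a
-- fibre (`ltm_lsubst`). Every axiom of the theory is then an identity of the model. The β- and
-- η-laws are the two round trips of `Φ`, `Ψ`, `Λ` and currying, read at a point of the base with
-- the help of Beck–Chevalley. The additive laws hold because biproducts make the hom-sets of a
-- fibre commutative monoids with bilinear composition. The inductions on derivations are
-- `ctm_sound` and `ltm_sound`.
--
-- Completeness uses the term model `synModel`: objects are types, morphisms are classes of terms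
-- with exactly one Cartesian variable (and the linear one, in a fibre), and composition is
-- substitution. Each axiom of a model is an equation of the theory; in particular `t[0/x] = 0` and
-- `t[s+r/x] = t[s/x] + t[r/x]` are what makes the unit type initial and product types coproducts
-- (`QL.fromUnit_eta`, `QL.copair_eta`).
--
-- The bridge to terms in arbitrary contexts is `synInterp_tm`: the interpretation of `t` in the
-- term model is the class of `t` with its variables replaced by the projections from the product of
-- its context. Substituting the tuple of all variables inverts this (`QSub.proj_comp_tuple`,
-- `QC.tuple_subst_proj`), so interpretation is a bijection from classes of terms to morphisms.
-- Injectivity is completeness, surjectivity is fullness. Since a type equals its own interpretation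
-- only propositionally, `synInterp_tm` is a heterogeneous equality.

namespace LinLang

open CategoryTheory MonoidalCategory CartesianMonoidalCategory

variable {S : Signature.{u}}

/-- Joint induction on the terms of the two judgements. -/
theorem tm_induction {P : ∀ {Γ : Ctx} {τ : CTy}, CTm S Γ τ → Prop}
    {Q : ∀ {Γ : Ctx} {σ ρ : LTy}, LTm S Γ σ ρ → Prop}
    (hvar : ∀ {Γ : Ctx} {τ : CTy} (x : Var Γ τ), P (.var x))
    (hop : ∀ {Γ : Ctx} {ns : List ℕ} {m : ℕ} (o : S.Op ns m) (t : CTm S Γ (CTy.reals ns)),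
      P t → P (.op o t))
    (hunit : ∀ {Γ : Ctx}, P (.unit : CTm S Γ .unit))
    (hpair : ∀ {Γ : Ctx} {τ₁ τ₂ : CTy} (t : CTm S Γ τ₁) (s : CTm S Γ τ₂), P t → P s →
      P (.pair t s))
    (hfst : ∀ {Γ : Ctx} {τ₁ τ₂ : CTy} (t : CTm S Γ (.prod τ₁ τ₂)), P t → P (.fst t))
    (hsnd : ∀ {Γ : Ctx} {τ₁ τ₂ : CTy} (t : CTm S Γ (.prod τ₁ τ₂)), P t → P (.snd t))
    (hlam : ∀ {Γ : Ctx} {τ₁ τ₂ : CTy} (t : CTm S (τ₁ :: Γ) τ₂), P t → P (.lam t))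
    (happ : ∀ {Γ : Ctx} {τ₁ τ₂ : CTy} (t : CTm S Γ (.arrow τ₁ τ₂)) (s : CTm S Γ τ₁), P t → P s →
      P (.app t s))
    (hllam : ∀ {Γ : Ctx} {σ ρ : LTy} (t : LTm S Γ σ ρ), Q t → P (.llam t))
    (lvar : ∀ {Γ : Ctx} {σ : LTy}, Q (.var : LTm S Γ σ σ))
    (llop : ∀ {Γ : Ctx} {σ : LTy} {ns ms : List ℕ} {m : ℕ} (o : S.LOp ns ms m)
      (t : CTm S Γ (CTy.reals ns)) (s : LTm S Γ σ (LTy.reals ms)), P t → Q s → Q (.lop o t s))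
    (lunit : ∀ {Γ : Ctx} {σ : LTy}, Q (.unit : LTm S Γ σ .unit))
    (lpair : ∀ {Γ : Ctx} {σ ρ₁ ρ₂ : LTy} (t : LTm S Γ σ ρ₁) (s : LTm S Γ σ ρ₂), Q t → Q s →
      Q (.pair t s))
    (lfst : ∀ {Γ : Ctx} {σ ρ₁ ρ₂ : LTy} (t : LTm S Γ σ (.prod ρ₁ ρ₂)), Q t → Q (.fst t))
    (lsnd : ∀ {Γ : Ctx} {σ ρ₁ ρ₂ : LTy} (t : LTm S Γ σ (.prod ρ₁ ρ₂)), Q t → Q (.snd t))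
    (llam : ∀ {Γ : Ctx} {σ ρ : LTy} {τ : CTy} (t : LTm S (τ :: Γ) σ ρ), Q t → Q (.lam t))
    (lapp : ∀ {Γ : Ctx} {σ ρ : LTy} {τ : CTy} (t : LTm S Γ σ (.arrow τ ρ)) (s : CTm S Γ τ),
      Q t → P s → Q (.app t s))
    (ltens : ∀ {Γ : Ctx} {σ ρ : LTy} {τ : CTy} (t : CTm S Γ τ) (s : LTm S Γ σ ρ), P t → Q s →
      Q (.tens t s))
    (ltmatch : ∀ {Γ : Ctx} {σ ρ ρ' : LTy} {τ : CTy} (t : LTm S Γ σ (.tensor τ ρ))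
      (s : LTm S (τ :: Γ) ρ ρ'), Q t → Q s → Q (.tmatch t s))
    (llapp : ∀ {Γ : Ctx} {σ ρ ρ' : LTy} (t : CTm S Γ (.lolli ρ ρ')) (s : LTm S Γ σ ρ), P t → Q s →
      Q (.lapp t s))
    (lzero : ∀ {Γ : Ctx} {σ ρ : LTy}, Q (.zero : LTm S Γ σ ρ))
    (ladd : ∀ {Γ : Ctx} {σ ρ : LTy} (t s : LTm S Γ σ ρ), Q t → Q s → Q (.add t s)) :
    (∀ {Γ : Ctx} {τ : CTy} (t : CTm S Γ τ), P t) ∧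
      (∀ {Γ : Ctx} {σ ρ : LTy} (t : LTm S Γ σ ρ), Q t) :=
  ⟨CTm.rec (motive_1 := fun _ _ t => P t) (motive_2 := fun _ _ _ t => Q t) hvar hop hunit hpair hfst
      hsnd hlam happ hllam lvar llop lunit lpair lfst lsnd llam lapp ltens ltmatch llapp lzero ladd,
    LTm.rec (motive_1 := fun _ _ t => P t) (motive_2 := fun _ _ _ t => Q t) hvar hop hunit hpair
      hfst hsnd hlam happ hllam lvar llop lunit lpair lfst lsnd llam lapp ltens ltmatch llapp lzero
      ladd⟩

/-! ## Renaming and substitution lemmas -/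

/-- The order of the composition laws is forced by binders: a substitution is extended under a
binder by weakening, which is a renaming. So renaming after substitution needs the law for two
renamings, and composition of substitutions needs both mixed laws. -/
theorem Ren.lift_comp {Γ Δ Θ : Ctx} (r : Ren Γ Δ) (r' : Ren Δ Θ) (τ : CTy) :
    (fun _ x => r'.lift τ (r.lift τ x) : Ren (τ :: Γ) (τ :: Θ)) =
      Ren.lift (fun _ x => r' (r x)) τ := by
  funext _ x; cases x <;> rfl

theorem rename_rename :
    (∀ {Γ : Ctx} {τ : CTy} (t : CTm S Γ τ) {Δ Θ : Ctx} (r : Ren Γ Δ) (r' : Ren Δ Θ),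
      (t.rename r).rename r' = t.rename (fun _ x => r' (r x))) ∧
    (∀ {Γ : Ctx} {σ ρ : LTy} (t : LTm S Γ σ ρ) {Δ Θ : Ctx} (r : Ren Γ Δ) (r' : Ren Δ Θ),
      (t.rename r).rename r' = t.rename (fun _ x => r' (r x))) := by
  apply tm_induction <;> intros <;> simp_all [CTm.rename, LTm.rename, Ren.lift_comp]

theorem Sub.lift_ren_comp {Γ Δ Θ : Ctx} (r : Ren Γ Δ) (f : Sub S Δ Θ) (τ : CTy) :
    (fun _ x => f.lift τ (r.lift τ x) : Sub S (τ :: Γ) (τ :: Θ)) =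
      Sub.lift (fun _ x => f (r x)) τ := by
  funext _ x; cases x <;> rfl

theorem rename_subst :
    (∀ {Γ : Ctx} {τ : CTy} (t : CTm S Γ τ) {Δ Θ : Ctx} (r : Ren Γ Δ) (f : Sub S Δ Θ),
      (t.rename r).subst f = t.subst (fun _ x => f (r x))) ∧
    (∀ {Γ : Ctx} {σ ρ : LTy} (t : LTm S Γ σ ρ) {Δ Θ : Ctx} (r : Ren Γ Δ) (f : Sub S Δ Θ),
      (t.rename r).subst f = t.subst (fun _ x => f (r x))) := by
  apply tm_induction <;> intros <;>
    simp_all [CTm.rename, LTm.rename, CTm.subst, LTm.subst, Sub.lift_ren_comp]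

theorem Sub.lift_comp_ren {Γ Δ Θ : Ctx} (f : Sub S Γ Δ) (r : Ren Δ Θ) (τ : CTy) :
    (fun _ x => (f.lift τ x).rename (r.lift τ) : Sub S (τ :: Γ) (τ :: Θ)) =
      Sub.lift (fun _ x => (f x).rename r) τ := by
  funext _ x
  cases x with
  | zero => rfl
  | succ x => simp only [Sub.lift, CTm.wk, rename_rename.1]; rfl

theorem subst_rename :
    (∀ {Γ : Ctx} {τ : CTy} (t : CTm S Γ τ) {Δ Θ : Ctx} (f : Sub S Γ Δ) (r : Ren Δ Θ),
      (t.subst f).rename r = t.subst (fun _ x => (f x).rename r)) ∧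
    (∀ {Γ : Ctx} {σ ρ : LTy} (t : LTm S Γ σ ρ) {Δ Θ : Ctx} (f : Sub S Γ Δ) (r : Ren Δ Θ),
      (t.subst f).rename r = t.subst (fun _ x => (f x).rename r)) := by
  apply tm_induction <;> intros <;>
    simp_all [CTm.rename, LTm.rename, CTm.subst, LTm.subst, Sub.lift_comp_ren]

theorem CTm.wk_subst_lift {Γ Δ : Ctx} {τ : CTy} (t : CTm S Γ τ) (f : Sub S Γ Δ) (τ' : CTy) :
    (t.wk τ').subst (f.lift τ') = (t.subst f).wk τ' := by
  simp only [CTm.wk, rename_subst.1, subst_rename.1]; rfl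

theorem LTm.wk_subst_lift {Γ Δ : Ctx} {σ ρ : LTy} (t : LTm S Γ σ ρ) (f : Sub S Γ Δ) (τ' : CTy) :
    (t.wk τ').subst (f.lift τ') = (t.subst f).wk τ' := by
  simp only [LTm.wk, rename_subst.2, subst_rename.2]; rfl

theorem Sub.lift_comp {Γ Δ Θ : Ctx} (f : Sub S Γ Δ) (g : Sub S Δ Θ) (τ : CTy) :
    (fun _ x => (f.lift τ x).subst (g.lift τ) : Sub S (τ :: Γ) (τ :: Θ)) =
      Sub.lift (fun _ x => (f x).subst g) τ := by
  funext _ x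
  cases x with
  | zero => rfl
  | succ x => exact CTm.wk_subst_lift _ _ _

theorem subst_subst :
    (∀ {Γ : Ctx} {τ : CTy} (t : CTm S Γ τ) {Δ Θ : Ctx} (f : Sub S Γ Δ) (g : Sub S Δ Θ),
      (t.subst f).subst g = t.subst (fun _ x => (f x).subst g)) ∧
    (∀ {Γ : Ctx} {σ ρ : LTy} (t : LTm S Γ σ ρ) {Δ Θ : Ctx} (f : Sub S Γ Δ) (g : Sub S Δ Θ),
      (t.subst f).subst g = t.subst (fun _ x => (f x).subst g)) := by
  apply tm_induction <;> intros <;> simp_all [CTm.subst, LTm.subst, Sub.lift_comp]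

theorem Sub.lift_var (Γ : Ctx) (τ : CTy) :
    Sub.lift (fun _ x => .var x : Sub S Γ Γ) τ = fun _ x => .var x := by
  funext _ x; cases x <;> rfl

theorem subst_var :
    (∀ {Γ : Ctx} {τ : CTy} (t : CTm S Γ τ), t.subst (fun _ x => .var x) = t) ∧
    (∀ {Γ : Ctx} {σ ρ : LTy} (t : LTm S Γ σ ρ), t.subst (fun _ x => .var x) = t) := by
  apply tm_induction <;> intros <;> simp_all [CTm.subst, LTm.subst, Sub.lift_var]

/-- Makes renaming a special case of substitution, so that facts about weakening can be read off
from facts about substitution. -/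
theorem CTm.rename_eq_subst {Γ Δ : Ctx} {τ : CTy} (t : CTm S Γ τ) (r : Ren Γ Δ) :
    t.rename r = t.subst (fun _ x => .var (r x)) :=
  (subst_var.1 (t.rename r)).symm.trans (rename_subst.1 t r _)

theorem LTm.rename_eq_subst {Γ Δ : Ctx} {σ ρ : LTy} (t : LTm S Γ σ ρ) (r : Ren Γ Δ) :
    t.rename r = t.subst (fun _ x => .var (r x)) :=
  (subst_var.2 (t.rename r)).symm.trans (rename_subst.2 t r _)

theorem LTm.lsubst_subst : ∀ {Γ : Ctx} {σ ρ : LTy} (t : LTm S Γ σ ρ) {Δ : Ctx} {σ' : LTy}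
    (s : LTm S Γ σ' σ) (f : Sub S Γ Δ), (t.lsubst s).subst f = (t.subst f).lsubst (s.subst f) := by
  -- Joint induction with the trivial predicate on Cartesian terms: linear substitution never enters
  -- a Cartesian subterm, so nothing is needed about them.
  suffices h : (∀ {Γ : Ctx} {τ : CTy} (_ : CTm S Γ τ), True) ∧
      ∀ {Γ : Ctx} {σ ρ : LTy} (t : LTm S Γ σ ρ) {Δ : Ctx} {σ' : LTy}
    (s : LTm S Γ σ' σ) (f : Sub S Γ Δ), (t.lsubst s).subst f = (t.subst f).lsubst (s.subst f) by
    obtain ⟨_, h⟩ := h; exact @h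
  apply tm_induction <;> intros <;>
    simp_all [LTm.subst, LTm.lsubst, LTm.wk_subst_lift]

theorem LTm.lsubst_wk {Γ : Ctx} {σ σ' ρ : LTy} (t : LTm S Γ σ ρ) (s : LTm S Γ σ' σ) (τ : CTy) :
    (t.lsubst s).wk τ = (t.wk τ).lsubst (s.wk τ) := by
  simp only [LTm.wk, LTm.rename_eq_subst]
  exact LTm.lsubst_subst t s _

theorem LTm.lsubst_lsubst : ∀ {Γ : Ctx} {σ ρ : LTy} (t : LTm S Γ σ ρ) {σ' σ'' : LTy}
    (s : LTm S Γ σ' σ) (r : LTm S Γ σ'' σ'), (t.lsubst s).lsubst r = t.lsubst (s.lsubst r) := by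
  suffices h : (∀ {Γ : Ctx} {τ : CTy} (_ : CTm S Γ τ), True) ∧
      ∀ {Γ : Ctx} {σ ρ : LTy} (t : LTm S Γ σ ρ) {σ' σ'' : LTy}
    (s : LTm S Γ σ' σ) (r : LTm S Γ σ'' σ'), (t.lsubst s).lsubst r = t.lsubst (s.lsubst r) by
    obtain ⟨_, h⟩ := h; exact @h
  apply tm_induction <;> intros <;>
    simp_all [LTm.lsubst, LTm.lsubst_wk]

theorem LTm.lsubst_var : ∀ {Γ : Ctx} {σ ρ : LTy} (t : LTm S Γ σ ρ), t.lsubst .var = t := by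
  suffices h : (∀ {Γ : Ctx} {τ : CTy} (_ : CTm S Γ τ), True) ∧
      ∀ {Γ : Ctx} {σ ρ : LTy} (t : LTm S Γ σ ρ), t.lsubst .var = t by
    obtain ⟨_, h⟩ := h; exact @h
  apply tm_induction <;> intros <;>
    simp_all [LTm.lsubst, LTm.wk, LTm.rename]

/-- Both sides are a single substitution, sending the last variable to `s.subst f` and acting as `f`
on the others; for these, weakening followed by instantiation cancels. -/
theorem CTm.inst_subst {Γ Δ : Ctx} {τ τ' : CTy} (t : CTm S (τ' :: Γ) τ) (s : CTm S Γ τ')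
    (f : Sub S Γ Δ) : (t.inst s).subst f = (t.subst (f.lift τ')).inst (s.subst f) := by
  simp only [CTm.inst, subst_subst.1]
  congr 1; funext _ x
  cases x with
  | zero => rfl
  | succ x =>
    simp only [Sub.single, Sub.lift, CTm.subst, CTm.wk, rename_subst.1, Ren.wk, subst_var.1]

theorem LTm.inst_subst {Γ Δ : Ctx} {σ ρ : LTy} {τ' : CTy} (t : LTm S (τ' :: Γ) σ ρ)
    (s : CTm S Γ τ') (f : Sub S Γ Δ) :
    (t.inst s).subst f = (t.subst (f.lift τ')).inst (s.subst f) := by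
  simp only [LTm.inst, subst_subst.2]
  congr 1; funext _ x
  cases x with
  | zero => rfl
  | succ x =>
    simp only [Sub.single, Sub.lift, CTm.subst, CTm.wk, rename_subst.1, Ren.wk, subst_var.1]

/-! ## Stability of `βη+`-equality under substitution -/

-- Axioms without substitution or weakening are stable because substitution commutes with the
-- constructors. The remaining ones use the commutation lemmas `inst_subst`, `wk_subst_lift` and
-- `lsubst_subst`.
mutual
theorem CEq.subst : ∀ {Γ : Ctx} {τ : CTy} {t s : CTm S Γ τ}, CEq t s →
    ∀ {Δ : Ctx} (f : Sub S Γ Δ), CEq (t.subst f) (s.subst f)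
  | _, _, _, _, .refl t, _, f => .refl _
  | _, _, _, _, .symm h, _, f => .symm (h.subst f)
  | _, _, _, _, .trans h h', _, f => .trans (h.subst f) (h'.subst f)
  | _, _, _, _, .congr_op o h, _, f => .congr_op o (h.subst f)
  | _, _, _, _, .congr_pair h h', _, f => .congr_pair (h.subst f) (h'.subst f)
  | _, _, _, _, .congr_fst h, _, f => .congr_fst (h.subst f)
  | _, _, _, _, .congr_snd h, _, f => .congr_snd (h.subst f)
  | _, _, _, _, .congr_lam h, _, f => .congr_lam (h.subst (f.lift _))
  | _, _, _, _, .congr_app h h', _, f => .congr_app (h.subst f) (h'.subst f)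
  | _, _, _, _, .congr_llam h, _, f => .congr_llam (h.subst f)
  | _, _, _, _, .unit_eta t, _, f => .unit_eta _
  | _, _, _, _, .fst_beta t s, _, f => .fst_beta _ _
  | _, _, _, _, .snd_beta t s, _, f => .snd_beta _ _
  | _, _, _, _, .pair_eta t, _, f => .pair_eta _
  | _, _, _, _, .lam_beta t s, _, f => by
    rw [CTm.inst_subst]; exact .lam_beta _ _
  | _, _, _, _, .lam_eta t, _, f => by
    simp only [CTm.subst, CTm.wk_subst_lift]; exact .lam_eta _
  | _, _, _, _, .llam_eta t, _, f => .llam_eta _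
theorem LEq.subst : ∀ {Γ : Ctx} {σ ρ : LTy} {t s : LTm S Γ σ ρ}, LEq t s →
    ∀ {Δ : Ctx} (f : Sub S Γ Δ), LEq (t.subst f) (s.subst f)
  | _, _, _, _, _, .refl t, _, f => .refl _
  | _, _, _, _, _, .symm h, _, f => .symm (h.subst f)
  | _, _, _, _, _, .trans h h', _, f => .trans (h.subst f) (h'.subst f)
  | _, _, _, _, _, .congr_lop o h h', _, f => .congr_lop o (h.subst f) (h'.subst f)
  | _, _, _, _, _, .congr_pair h h', _, f => .congr_pair (h.subst f) (h'.subst f)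
  | _, _, _, _, _, .congr_fst h, _, f => .congr_fst (h.subst f)
  | _, _, _, _, _, .congr_snd h, _, f => .congr_snd (h.subst f)
  | _, _, _, _, _, .congr_lam h, _, f => .congr_lam (h.subst (f.lift _))
  | _, _, _, _, _, .congr_app h h', _, f => .congr_app (h.subst f) (h'.subst f)
  | _, _, _, _, _, .congr_tens h h', _, f => .congr_tens (h.subst f) (h'.subst f)
  | _, _, _, _, _, .congr_tmatch h h', _, f => .congr_tmatch (h.subst f) (h'.subst (f.lift _))
  | _, _, _, _, _, .congr_lapp h h', _, f => .congr_lapp (h.subst f) (h'.subst f)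
  | _, _, _, _, _, .congr_add h h', _, f => .congr_add (h.subst f) (h'.subst f)
  | _, _, _, _, _, .unit_eta t, _, f => .unit_eta _
  | _, _, _, _, _, .fst_beta t s, _, f => .fst_beta _ _
  | _, _, _, _, _, .snd_beta t s, _, f => .snd_beta _ _
  | _, _, _, _, _, .pair_eta t, _, f => .pair_eta _
  | _, _, _, _, _, .lam_beta t s, _, f => by
    rw [LTm.inst_subst]; exact .lam_beta _ _
  | _, _, _, _, _, .lam_eta t, _, f => by
    simp only [LTm.subst, LTm.wk_subst_lift]; exact .lam_eta _
  | _, _, _, _, _, .tens_beta t s r, _, f => by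
    rw [LTm.lsubst_subst, LTm.inst_subst]; exact .tens_beta _ _ _
  | _, _, _, _, _, .tens_eta t s, _, f => by
    simp only [LTm.subst, LTm.lsubst_subst, LTm.wk_subst_lift]; exact .tens_eta _ _
  | _, _, _, _, _, .llam_beta t s, _, f => by
    rw [LTm.lsubst_subst]; exact .llam_beta _ _
  | _, _, _, _, _, .add_zero t, _, f => .add_zero _
  | _, _, _, _, _, .zero_add t, _, f => .zero_add _
  | _, _, _, _, _, .add_assoc t s r, _, f => .add_assoc _ _ _
  | _, _, _, _, _, .add_comm t s, _, f => .add_comm _ _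
  | _, _, _, _, _, .subst_zero t, _, f => by
    rw [LTm.lsubst_subst]; exact .subst_zero _
  | _, _, _, _, _, .subst_add t s r, _, f => by
    simp only [LTm.subst, LTm.lsubst_subst]; exact .subst_add _ _ _
end

theorem Sub.lift_ceq {Γ Δ : Ctx} {f g : Sub S Γ Δ} (h : ∀ ⦃τ⦄ (x : Var Γ τ), CEq (f x) (g x))
    {τ : CTy} ⦃τ' : CTy⦄ (x : Var (τ :: Γ) τ') : CEq (f.lift τ x) (g.lift τ x) := by
  cases x with
  | zero => exact .refl _
  | succ x =>
    simp only [Sub.lift, CTm.wk, CTm.rename_eq_subst]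
    exact (h x).subst _

/-- Complements `CEq.subst`: here the term is fixed and the substitution varies, so the induction is
on the term and uses only the congruence rules. Together the two make substitution well defined on
classes. -/
theorem subst_congr :
    (∀ {Γ : Ctx} {τ : CTy} (t : CTm S Γ τ) {Δ : Ctx} {f g : Sub S Γ Δ},
      (∀ ⦃τ⦄ (x : Var Γ τ), CEq (f x) (g x)) → CEq (t.subst f) (t.subst g)) ∧
    (∀ {Γ : Ctx} {σ ρ : LTy} (t : LTm S Γ σ ρ) {Δ : Ctx} {f g : Sub S Γ Δ},
      (∀ ⦃τ⦄ (x : Var Γ τ), CEq (f x) (g x)) → LEq (t.subst f) (t.subst g)) := by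
  apply tm_induction
  · exact fun x _ _ _ h => h x
  · exact fun o t ih _ _ _ h => .congr_op o (ih h)
  · exact fun _ => .refl _
  · exact fun _ _ ih ih' _ _ _ h => .congr_pair (ih h) (ih' h)
  · exact fun _ ih _ _ _ h => .congr_fst (ih h)
  · exact fun _ ih _ _ _ h => .congr_snd (ih h)
  · exact fun _ ih _ _ _ h => .congr_lam (ih (Sub.lift_ceq h))
  · exact fun _ _ ih ih' _ _ _ h => .congr_app (ih h) (ih' h)
  · exact fun _ ih _ _ _ h => .congr_llam (ih h)
  · exact fun _ => .refl _
  · exact fun o _ _ ih ih' _ _ _ h => .congr_lop o (ih h) (ih' h)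
  · exact fun _ => .refl _
  · exact fun _ _ ih ih' _ _ _ h => .congr_pair (ih h) (ih' h)
  · exact fun _ ih _ _ _ h => .congr_fst (ih h)
  · exact fun _ ih _ _ _ h => .congr_snd (ih h)
  · exact fun _ ih _ _ _ h => .congr_lam (ih (Sub.lift_ceq h))
  · exact fun _ _ ih ih' _ _ _ h => .congr_app (ih h) (ih' h)
  · exact fun _ _ ih ih' _ _ _ h => .congr_tens (ih h) (ih' h)
  · exact fun _ _ ih ih' _ _ _ h => .congr_tmatch (ih h) (ih' (Sub.lift_ceq h))
  · exact fun _ _ ih ih' _ _ _ h => .congr_lapp (ih h) (ih' h)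
  · exact fun _ => .refl _
  · exact fun _ _ ih ih' _ _ _ h => .congr_add (ih h) (ih' h)

/-- No induction is needed: `t[s/x]` is the β-reduct of the linear abstraction of `t` applied to
`s`, and abstraction and application are congruences. -/
theorem LEq.lsubst {Γ : Ctx} {σ σ' ρ : LTy} {t t' : LTm S Γ σ ρ} {s s' : LTm S Γ σ' σ}
    (h : LEq t t') (h' : LEq s s') : LEq (t.lsubst s) (t'.lsubst s') :=
  (LEq.llam_beta t s).symm.trans
    ((LEq.congr_lapp (.congr_llam h) h').trans (.llam_beta t' s'))

/-! ## Biproducts -/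

namespace Biadditive

variable {C : Type w} [Category.{v} C] {L : LocallyIndexedCategory.{v, w} C} (B : Biadditive L)

/-- The zero morphism. -/
def zero (c : C) (X Y : L.Obj) : L.Hom c X Y := L.comp (B.toUnit c X) (B.fromUnit c Y)

/-- The sum of two morphisms. -/
def add {c : C} {X Y : L.Obj} (f g : L.Hom c X Y) : L.Hom c X Y :=
  L.comp (B.pair (L.id c X) (L.id c X)) (B.copair f g)

theorem pair_ext {c : C} {X Y Z : L.Obj} {f g : L.Hom c Z (B.prod X Y)}
    (h : L.comp f (B.fst c X Y) = L.comp g (B.fst c X Y))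
    (h' : L.comp f (B.snd c X Y) = L.comp g (B.snd c X Y)) : f = g := by
  rw [B.pair_unique f, h, h', ← B.pair_unique g]

theorem copair_ext {c : C} {X Y Z : L.Obj} {f g : L.Hom c (B.prod X Y) Z}
    (h : L.comp (B.inl c X Y) f = L.comp (B.inl c X Y) g)
    (h' : L.comp (B.inr c X Y) f = L.comp (B.inr c X Y) g) : f = g := by
  rw [B.copair_unique f, h, h', ← B.copair_unique g]

theorem zero_comp {c : C} {X Y Z : L.Obj} (f : L.Hom c Y Z) :
    L.comp (B.zero c X Y) f = B.zero c X Z := by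
  rw [zero, L.assoc, B.fromUnit_unique (L.comp _ f), zero]

theorem comp_zero {c : C} {X Y Z : L.Obj} (f : L.Hom c X Y) :
    L.comp f (B.zero c Y Z) = B.zero c X Z := by
  rw [zero, ← L.assoc, B.toUnit_unique (L.comp f _), zero]

theorem comp_pair {c : C} {W X Y Z : L.Obj} (h : L.Hom c W Z) (f : L.Hom c Z X)
    (g : L.Hom c Z Y) : L.comp h (B.pair f g) = B.pair (L.comp h f) (L.comp h g) := by
  apply B.pair_ext <;> simp only [L.assoc, pair_fst, pair_snd]

theorem copair_comp {c : C} {W X Y Z : L.Obj} (f : L.Hom c X Z) (g : L.Hom c Y Z)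
    (h : L.Hom c Z W) : L.comp (B.copair f g) h = B.copair (L.comp f h) (L.comp g h) := by
  apply B.copair_ext <;> simp only [← L.assoc, inl_copair, inr_copair]

theorem add_comp {c : C} {X Y Z : L.Obj} (f g : L.Hom c X Y) (h : L.Hom c Y Z) :
    L.comp (B.add f g) h = B.add (L.comp f h) (L.comp g h) := by
  rw [add, L.assoc, copair_comp, add]

/-- The compatibility of injections with projections identifies the copairing of `f` and zero with
the first projection followed by `f`, which cancels the diagonal. -/
theorem add_zero {c : C} {X Y : L.Obj} (f : L.Hom c X Y) : B.add f (B.zero c X Y) = f := by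
  have h : B.copair f (B.zero c X Y) = L.comp (B.fst c X X) f := by
    apply B.copair_ext
    · rw [inl_copair, ← L.assoc, inl_fst, L.id_comp]
    · rw [inr_copair, ← L.assoc, inr_fst]; exact (B.zero_comp f).symm
  rw [add, h, ← L.assoc, pair_fst, L.id_comp]

theorem zero_add {c : C} {X Y : L.Obj} (f : L.Hom c X Y) : B.add (B.zero c X Y) f = f := by
  have h : B.copair (B.zero c X Y) f = L.comp (B.snd c X X) f := by
    apply B.copair_ext
    · rw [inl_copair, ← L.assoc, inl_snd]; exact (B.zero_comp f).symm
    · rw [inr_copair, ← L.assoc, inr_snd, L.id_comp]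
  rw [add, h, ← L.assoc, pair_snd, L.id_comp]

/-- Additivity on this side, unlike `add_comp`, is not formal from the universal property of the
coproduct: it needs the diagonal to be natural. -/
theorem comp_add {c : C} {X Y Z : L.Obj} (h : L.Hom c X Y) (f g : L.Hom c Y Z) :
    L.comp h (B.add f g) = B.add (L.comp h f) (L.comp h g) := by
  -- The copairing is `h ⊕ h`, so `e` says that the diagonal followed by `h ⊕ h` is the pairing of
  -- `h` with itself. It is checked on the two projections, where zero summands drop out.
  have e : L.comp (B.pair (L.id c X) (L.id c X))
      (B.copair (L.comp h (B.inl c Y Y)) (L.comp h (B.inr c Y Y))) = B.pair h h := by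
    change B.add _ _ = _
    apply B.pair_ext
    · rw [add_comp, L.assoc, L.assoc, inl_fst, inr_fst, L.comp_id, pair_fst]
      exact (congrArg _ (B.comp_zero h)).trans (B.add_zero h)
    · rw [add_comp, L.assoc, L.assoc, inl_snd, inr_snd, L.comp_id, pair_snd]
      exact (congrArg (B.add · h) (B.comp_zero h)).trans (B.zero_add h)
  have e' : B.copair (L.comp h f) (L.comp h g) =
      L.comp (B.copair (L.comp h (B.inl c Y Y)) (L.comp h (B.inr c Y Y))) (B.copair f g) := by
    rw [copair_comp, L.assoc, L.assoc, inl_copair, inr_copair]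
  rw [add, add, e', ← L.assoc, ← L.assoc, e, comp_pair, L.comp_id]

/-- The interchange law, obtained because a copairing of sums is the sum of copairings. With the
unit laws it yields associativity and commutativity by the Eckmann–Hilton argument. -/
theorem add_add_add_comm {c : C} {X Y : L.Obj} (f g h k : L.Hom c X Y) :
    B.add (B.add f g) (B.add h k) = B.add (B.add f h) (B.add g k) := by
  have e : B.copair (B.add f g) (B.add h k) = B.add (B.copair f h) (B.copair g k) := by
    apply B.copair_ext <;> simp only [comp_add, inl_copair, inr_copair]
  rw [add, e, comp_add]; rfl

theorem add_assoc {c : C} {X Y : L.Obj} (f g h : L.Hom c X Y) :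
    B.add (B.add f g) h = B.add f (B.add g h) := by
  have := B.add_add_add_comm f g (B.zero c X Y) h
  rwa [zero_add, add_zero] at this

theorem add_comm {c : C} {X Y : L.Obj} (f g : L.Hom c X Y) : B.add f g = B.add g f := by
  have := B.add_add_add_comm (B.zero c X Y) f g (B.zero c X Y)
  rwa [zero_add, add_zero, zero_add, add_zero] at this

/-- Strict preservation of the projections forces preservation of pairings, by uniqueness. -/
theorem map_pair {c c' : C} (a : c' ⟶ c) {X Y Z : L.Obj} (f : L.Hom c Z X) (g : L.Hom c Z Y) :
    L.map a (B.pair f g) = B.pair (L.map a f) (L.map a g) := by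
  apply B.pair_ext
  · rw [← B.map_fst a, ← L.map_comp, pair_fst, B.map_fst, pair_fst]
  · rw [← B.map_snd a, ← L.map_comp, pair_snd, B.map_snd, pair_snd]

theorem map_copair {c c' : C} (a : c' ⟶ c) {X Y Z : L.Obj} (f : L.Hom c X Z) (g : L.Hom c Y Z) :
    L.map a (B.copair f g) = B.copair (L.map a f) (L.map a g) := by
  apply B.copair_ext
  · rw [← B.map_inl a, ← L.map_comp, inl_copair, B.map_inl, inl_copair]
  · rw [← B.map_inr a, ← L.map_comp, inr_copair, B.map_inr, inr_copair]

theorem map_zero {c c' : C} (a : c' ⟶ c) (X Y : L.Obj) :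
    L.map a (B.zero c X Y) = B.zero c' X Y := by
  rw [zero, L.map_comp, B.toUnit_unique (L.map a _), B.fromUnit_unique (L.map a _), zero]

theorem map_add {c c' : C} (a : c' ⟶ c) {X Y : L.Obj} (f g : L.Hom c X Y) :
    L.map a (B.add f g) = B.add (L.map a f) (L.map a g) := by
  rw [add, L.map_comp, map_pair, map_copair, L.map_id, add]

end Biadditive

/-! ## Naturality of the structure of a model -/

section Naturality

variable {C : Type w} [Category.{v} C] [CartesianMonoidalCategory C]
  {L : LocallyIndexedCategory.{v, w} C}

/-- The unit `X → !A ⊗ X` of the adjunction, at a point of `A`. -/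
def TensorTypes.unitAt (T : TensorTypes L) {c A : C} (t : c ⟶ A) (X : L.Obj) :
    L.Hom c X (T.tensor A X) :=
  L.map (lift (𝟙 c) t) (T.Φ c A X (T.tensor A X) (L.id c (T.tensor A X)))

/-- Naturality of the adjunction unit. It replaces the functorial action in the interpretation of
`!t ⊗ s` by plain composition of `s` with the unit at `t`. -/
theorem TensorTypes.unitAt_mapRight (T : TensorTypes L) {c A : C} (t : c ⟶ A) {X Y : L.Obj}
    (s : L.Hom c X Y) :
    L.comp (T.unitAt t X) (T.mapRight A s) = L.comp s (T.unitAt t Y) := by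
  have h : L.map (lift (𝟙 c) t) (T.Φ c A X _ (T.mapRight A s)) = L.comp s (T.unitAt t Y) := by
    rw [mapRight, Equiv.apply_symm_apply, L.map_comp, ← L.comp_map, lift_fst, L.id_map, unitAt]
  have h' := T.Φ_comp (L.id c (T.tensor A X)) (T.mapRight A s)
  rw [L.id_comp] at h'
  rw [← h, h', L.map_comp, ← L.comp_map, lift_fst, L.id_map, unitAt]

theorem TensorTypes.map_unitAt (T : TensorTypes L) {c c' A : C} (a : c' ⟶ c) (t : c ⟶ A)
    (X : L.Obj) : L.map a (T.unitAt t X) = T.unitAt (a ≫ t) X := by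
  rw [unitAt, unitAt, ← L.map_id a, T.Φ_map, ← L.comp_map, ← L.comp_map]
  congr 1
  ext <;> simp

/-- Naturality of `Φ` applied to the identity writes `s` as `Φ(id)` followed by the reindexed
`Φ⁻¹(s)`; pulling back along `⟨id, t⟩` cancels the projection. This is the semantic β-law for
`case`. -/
theorem TensorTypes.unitAt_comp (T : TensorTypes L) {c A : C} (t : c ⟶ A) {X Y : L.Obj}
    (s : L.Hom (c ⊗ A) X Y) :
    L.comp (T.unitAt t X) ((T.Φ c A X Y).symm s) = L.map (lift (𝟙 c) t) s := by
  have h := T.Φ_comp (L.id c (T.tensor A X)) ((T.Φ c A X Y).symm s)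
  rw [L.id_comp, Equiv.apply_symm_apply] at h
  conv_rhs => rw [h]
  rw [L.map_comp, ← L.comp_map, lift_fst, L.id_map, unitAt]

/-- The unit itself is the unit evaluated at the generic point `snd` of `A`. This is how `!y ⊗ z`,
with fresh variables, appears in the η-law. -/
theorem TensorTypes.Φ_id (T : TensorTypes L) (c A : C) (X : L.Obj) :
    T.Φ c A X _ (L.id c (T.tensor A X)) = T.unitAt (snd c A) X := by
  rw [unitAt, ← L.map_id (fst c A), T.Φ_map, ← L.comp_map]
  have : lift (𝟙 (c ⊗ A)) (snd c A) ≫ fst c A ▷ A = 𝟙 _ := by ext <;> simp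
  rw [this, L.id_map]

theorem TensorTypes.eta (T : TensorTypes L) {c A : C} {X Y : L.Obj}
    (t : L.Hom c (T.tensor A X) Y) :
    (T.Φ c A X Y).symm (L.comp (T.unitAt (snd c A) X) (L.map (fst c A) t)) = t := by
  rw [Equiv.symm_apply_eq, ← T.Φ_id, ← T.Φ_comp, L.id_comp]

theorem TensorTypes.map_Φ_symm (T : TensorTypes L) {c c' A : C} (a : c' ⟶ c) {X Y : L.Obj}
    (s : L.Hom (c ⊗ A) X Y) :
    (T.Φ c' A X Y).symm (L.map (a ▷ A) s) = L.map a ((T.Φ c A X Y).symm s) := by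
  rw [Equiv.symm_apply_eq, T.Φ_map, Equiv.apply_symm_apply]

theorem ArrowTypes.map_Ψ_symm (T : ArrowTypes L) {c c' A : C} (a : c' ⟶ c) {X Y : L.Obj}
    (s : L.Hom c X (T.arrow A Y)) :
    (T.Ψ c' A X Y).symm (L.map a s) = L.map (a ▷ A) ((T.Ψ c A X Y).symm s) := by
  rw [Equiv.symm_apply_eq, T.Ψ_map, Equiv.apply_symm_apply]

theorem ArrowTypes.comp_Ψ_symm (T : ArrowTypes L) {c A : C} {W X Y : L.Obj} (g : L.Hom c W X)
    (s : L.Hom c X (T.arrow A Y)) :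
    (T.Ψ c A W Y).symm (L.comp g s) = L.comp (L.map (fst c A) g) ((T.Ψ c A X Y).symm s) := by
  rw [Equiv.symm_apply_eq, T.Ψ_comp, Equiv.apply_symm_apply]

omit [CartesianMonoidalCategory C] in
theorem LolliTypes.map_Λ_symm (T : LolliTypes L) {c c' : C} (a : c' ⟶ c) {X Y : L.Obj}
    (s : c ⟶ T.lolli X Y) :
    (T.Λ c' X Y).symm (a ≫ s) = L.map a ((T.Λ c X Y).symm s) := by
  rw [Equiv.symm_apply_eq, T.Λ_map, Equiv.apply_symm_apply]

theorem TensorTypes.map_comp_unitAt (T : TensorTypes L) {c c' A : C} (a : c' ⟶ c) (t : c ⟶ A)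
    {X Y : L.Obj} (s : L.Hom c X Y) :
    L.comp (L.map a s) (T.unitAt (a ≫ t) Y) = L.map a (L.comp s (T.unitAt t Y)) := by
  rw [L.map_comp, map_unitAt]

theorem TensorTypes.map_comp_Φ_symm (T : TensorTypes L) {c c' A : C} (a : c' ⟶ c) {W X Y : L.Obj}
    (t : L.Hom c W (T.tensor A X)) (s : L.Hom (c ⊗ A) X Y) :
    L.comp (L.map a t) ((T.Φ c' A X Y).symm (L.map (a ▷ A) s)) =
      L.map a (L.comp t ((T.Φ c A X Y).symm s)) := by
  rw [map_Φ_symm, L.map_comp]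

/-- Application of a morphism into `A ⇒ Y` to a point of `A`. -/
def ArrowTypes.appAt (T : ArrowTypes L) {c A : C} {X Y : L.Obj} (t : L.Hom c X (T.arrow A Y))
    (s : c ⟶ A) : L.Hom c X Y :=
  L.map (lift (𝟙 c) s) ((T.Ψ c A X Y).symm t)

theorem ArrowTypes.map_appAt (T : ArrowTypes L) {c c' A : C} (a : c' ⟶ c) {X Y : L.Obj}
    (t : L.Hom c X (T.arrow A Y)) (s : c ⟶ A) :
    T.appAt (L.map a t) (a ≫ s) = L.map a (T.appAt t s) := by
  rw [appAt, appAt, map_Ψ_symm, ← L.comp_map, ← L.comp_map]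
  congr 1
  ext <;> simp

theorem ArrowTypes.comp_appAt (T : ArrowTypes L) {c A : C} {W X Y : L.Obj} (g : L.Hom c W X)
    (t : L.Hom c X (T.arrow A Y)) (s : c ⟶ A) :
    T.appAt (L.comp g t) s = L.comp g (T.appAt t s) := by
  rw [appAt, appAt, comp_Ψ_symm, L.map_comp, ← L.comp_map, lift_fst, L.id_map]

theorem ArrowTypes.appAt_Ψ (T : ArrowTypes L) {c A : C} {X Y : L.Obj} (t : L.Hom (c ⊗ A) X Y)
    (s : c ⟶ A) : T.appAt (T.Ψ c A X Y t) s = L.map (lift (𝟙 c) s) t := by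
  rw [appAt, Equiv.symm_apply_apply]

/-- The η-law: weakening and then applying to the generic point is just `Ψ⁻¹`, because the two
reindexings compose to the identity of `c ⊗ A`. -/
theorem ArrowTypes.Ψ_appAt (T : ArrowTypes L) {c A : C} {X Y : L.Obj}
    (t : L.Hom c X (T.arrow A Y)) :
    T.Ψ c A X Y (T.appAt (L.map (fst c A) t) (snd c A)) = t := by
  rw [appAt, map_Ψ_symm, ← L.comp_map]
  have : lift (𝟙 (c ⊗ A)) (snd c A) ≫ fst c A ▷ A = 𝟙 _ := by ext <;> simp
  rw [this, L.id_map, Equiv.apply_symm_apply]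

omit [CartesianMonoidalCategory C] in
theorem LolliTypes.map_comp_Λ_symm (T : LolliTypes L) {c c' : C} (a : c' ⟶ c) {W X Y : L.Obj}
    (s : L.Hom c W X) (t : c ⟶ T.lolli X Y) :
    L.comp (L.map a s) ((T.Λ c' X Y).symm (a ≫ t)) =
      L.map a (L.comp s ((T.Λ c X Y).symm t)) := by
  rw [map_Λ_symm, L.map_comp]

omit [CartesianMonoidalCategory C] in
theorem LocallyIndexedCategory.map_comp_map (L : LocallyIndexedCategory.{v, w} C) {c c' d : C}
    (a : c' ⟶ c) (t : c ⟶ d) {X Y Z : L.Obj} (s : L.Hom c X Y) (o : L.Hom d Y Z) :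
    L.comp (L.map a s) (L.map (a ≫ t) o) = L.map a (L.comp s (L.map t o)) := by
  rw [L.map_comp, L.comp_map]

-- Exponentials with the argument as last factor.

variable [MonoidalClosed C]

/-- Currying of the last variable. -/
def curryLast {c A B : C} (t : c ⊗ A ⟶ B) : c ⟶ (ihom A).obj B :=
  MonoidalClosed.curry (lift (snd A c) (fst A c) ≫ t)

theorem comp_curryLast {c c' A B : C} (a : c' ⟶ c) (t : c ⊗ A ⟶ B) :
    curryLast (a ▷ A ≫ t) = a ≫ curryLast t := by
  rw [curryLast, curryLast, ← MonoidalClosed.curry_natural_left, ← Category.assoc,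
    ← Category.assoc]
  congr 2
  ext <;> simp

theorem curryLast_ev {c A B : C} (t : c ⊗ A ⟶ B) (s : c ⟶ A) :
    lift s (curryLast t) ≫ (ihom.ev A).app B = lift (𝟙 c) s ≫ t := by
  have h : lift s (curryLast t) = lift s (𝟙 c) ≫ A ◁ curryLast t := by ext <;> simp
  rw [h, Category.assoc, ← MonoidalClosed.uncurry_eq, curryLast, MonoidalClosed.uncurry_curry,
    ← Category.assoc]
  congr 1
  ext <;> simp

theorem curryLast_eta {c A B : C} (t : c ⟶ (ihom A).obj B) :
    curryLast (lift (snd c A) (fst c A ≫ t) ≫ (ihom.ev A).app B) = t := by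
  rw [curryLast, MonoidalClosed.curry_eq_iff, MonoidalClosed.uncurry_eq, ← Category.assoc]
  congr 1
  ext <;> simp

end Naturality

namespace Interpretation

variable {M : CategoricalModel.{v, w}} (I : Interpretation S M)

/-! ## The interpretation of renaming and substitution -/

/-- The form of the interpretation used in all later arguments: it is visibly natural in the base
and in the linear variable. -/
theorem ltm_tens {Γ : Ctx} {σ ρ : LTy} {τ : CTy} (t : CTm S Γ τ) (s : LTm S Γ σ ρ) :
    I.ltm (.tens t s) =
      M.L.comp (I.ltm s) (M.tensorTypes.unitAt (I.ctm t) (I.lty ρ)) := by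
  rw [← TensorTypes.unitAt_mapRight]
  rfl

/-- The interpretation is natural with respect to every class `K` of pairs of a substitution and a
morphism that interprets it that is closed under binders. -/
theorem interp_subst_of_class
    (K : ∀ {Γ Δ : Ctx}, Sub S Γ Δ → (I.ctx Δ ⟶ I.ctx Γ) → Prop)
    (hK : ∀ {Γ Δ : Ctx} {f : Sub S Γ Δ} {a : I.ctx Δ ⟶ I.ctx Γ}, K f a →
      ∀ ⦃τ : CTy⦄ (x : Var Γ τ), I.ctm (f x) = a ≫ I.var x)
    (hlift : ∀ {Γ Δ : Ctx} {f : Sub S Γ Δ} {a : I.ctx Δ ⟶ I.ctx Γ}, K f a → ∀ τ : CTy,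
      K (Γ := τ :: Γ) (Δ := τ :: Δ) (f.lift τ) (a ▷ I.cty τ)) :
    (∀ {Γ : Ctx} {τ : CTy} (t : CTm S Γ τ) {Δ : Ctx} (f : Sub S Γ Δ) (a : I.ctx Δ ⟶ I.ctx Γ),
      K f a → I.ctm (t.subst f) = a ≫ I.ctm t) ∧
    (∀ {Γ : Ctx} {σ ρ : LTy} (t : LTm S Γ σ ρ) {Δ : Ctx} (f : Sub S Γ Δ) (a : I.ctx Δ ⟶ I.ctx Γ),
      K f a → I.ltm (t.subst f) = M.L.map a (I.ltm t)) := by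
  -- In every case the induction hypotheses enter by congruence, followed by naturality in the base
  -- of the structure that interprets the constructor. Only variables and binders use the closure
  -- properties of `K`.
  apply tm_induction
  · exact fun x _ _ _ h => hK h x
  · exact fun o t ih _ r a h => (congrArg (· ≫ I.op o) (ih r a h)).trans (Category.assoc _ _ _)
  · exact fun _ _ _ => toUnit_unique _ _
  · exact fun t s ih ih' _ r a h =>
      (congrArg₂ lift (ih r a h) (ih' r a h)).trans (comp_lift a (I.ctm t) (I.ctm s)).symm
  · exact fun t ih _ r a h => (congrArg (· ≫ fst _ _) (ih r a h)).trans (Category.assoc _ _ _)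
  · exact fun t ih _ r a h => (congrArg (· ≫ snd _ _) (ih r a h)).trans (Category.assoc _ _ _)
  · exact fun t ih _ r a h =>
      (congrArg curryLast (ih _ _ (hlift h _))).trans (comp_curryLast a (I.ctm t))
  · exact fun {_ τ₁ τ₂} t s ih ih' _ r a h =>
      (congrArg (· ≫ (ihom.ev (I.cty τ₁)).app (I.cty τ₂))
        ((congrArg₂ lift (ih' r a h) (ih r a h)).trans
          (comp_lift a (I.ctm s) (I.ctm t)).symm)).trans (Category.assoc _ _ _)
  · exact fun t ih _ r a h => (congrArg (M.lolliTypes.Λ _ _ _) (ih r a h)).trans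
      (M.lolliTypes.Λ_map a _)
  · exact fun _ a _ => (M.L.map_id a _).symm
  · exact fun o t s ih ih' _ r a h =>
      (congrArg₂ (fun x y => M.L.comp y (M.L.map x (I.lop o))) (ih r a h) (ih' r a h)).trans
        (M.L.map_comp_map a (I.ctm t) (I.ltm s) (I.lop o))
  · exact fun _ a _ => (M.biadditive.toUnit_unique _).symm
  · exact fun t s ih ih' _ r a h =>
      (congrArg₂ M.biadditive.pair (ih r a h) (ih' r a h)).trans (M.biadditive.map_pair a _ _).symm
  · exact fun t ih _ r a h =>
      (congrArg₂ M.L.comp (ih r a h) (M.biadditive.map_fst a _ _).symm).trans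
        (M.L.map_comp a _ _).symm
  · exact fun t ih _ r a h =>
      (congrArg₂ M.L.comp (ih r a h) (M.biadditive.map_snd a _ _).symm).trans
        (M.L.map_comp a _ _).symm
  · exact fun t ih _ r a h => (congrArg (M.arrowTypes.Ψ _ _ _ _) (ih _ _ (hlift h _))).trans
      (M.arrowTypes.Ψ_map a _)
  · exact fun t s ih ih' _ r a h =>
      (congrArg₂ M.arrowTypes.appAt (ih r a h) (ih' r a h)).trans (M.arrowTypes.map_appAt a _ _)
  · intro Γ σ ρ τ t s ih ih' _ r a h
    refine (I.ltm_tens _ _).trans ((congrArg₂ (fun x y => M.L.comp y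
      (M.tensorTypes.unitAt x (I.lty ρ))) (ih r a h) (ih' r a h)).trans
      ((M.tensorTypes.map_comp_unitAt a (I.ctm t) (I.ltm s)).trans ?_))
    exact congrArg (M.L.map a) (I.ltm_tens t s).symm
  · exact fun t s ih ih' _ r a h =>
      (congrArg₂ (fun x y => M.L.comp x ((M.tensorTypes.Φ _ _ _ _).symm y))
        (ih r a h) (ih' _ _ (hlift h _))).trans (M.tensorTypes.map_comp_Φ_symm a _ _)
  · exact fun t s ih ih' _ r a h =>
      (congrArg₂ (fun x y => M.L.comp y ((M.lolliTypes.Λ _ _ _).symm x))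
        (ih r a h) (ih' r a h)).trans (M.lolliTypes.map_comp_Λ_symm a _ _)
  · exact fun _ a _ => (M.biadditive.map_zero a _ _).symm
  · exact fun t s ih ih' _ r a h =>
      (congrArg₂ M.biadditive.add (ih r a h) (ih' r a h)).trans (M.biadditive.map_add a _ _).symm

theorem var_lift_zero {Γ Δ : Ctx} (τ : CTy) (a : I.ctx Δ ⟶ I.ctx Γ) :
    I.var (.zero : Var (τ :: Δ) τ) =
      (a ▷ I.cty τ : I.ctx (τ :: Δ) ⟶ I.ctx (τ :: Γ)) ≫ I.var .zero :=
  (whiskerRight_snd a (I.cty τ)).symm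

theorem var_lift_succ {Γ Δ : Ctx} (τ : CTy) (a : I.ctx Δ ⟶ I.ctx Γ) {τ' : CTy} (x : Var Γ τ')
    {b : I.ctx Δ ⟶ I.cty τ'} (h : b = a ≫ I.var x) :
    fst (I.ctx Δ) (I.cty τ) ≫ b =
      (a ▷ I.cty τ : I.ctx (τ :: Δ) ⟶ I.ctx (τ :: Γ)) ≫ I.var (.succ x) := by
  subst h
  change fst (I.ctx Δ) (I.cty τ) ≫ a ≫ I.var x =
    (a ▷ I.cty τ) ≫ (fst (I.ctx Γ) (I.cty τ) ≫ I.var x)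
  rw [whiskerRight_fst_assoc]

theorem interp_rename :
    (∀ {Γ : Ctx} {τ : CTy} (t : CTm S Γ τ) {Δ : Ctx} (r : Ren Γ Δ) (a : I.ctx Δ ⟶ I.ctx Γ),
      (∀ ⦃τ⦄ (x : Var Γ τ), I.var (r x) = a ≫ I.var x) → I.ctm (t.rename r) = a ≫ I.ctm t) ∧
    (∀ {Γ : Ctx} {σ ρ : LTy} (t : LTm S Γ σ ρ) {Δ : Ctx} (r : Ren Γ Δ) (a : I.ctx Δ ⟶ I.ctx Γ),
      (∀ ⦃τ⦄ (x : Var Γ τ), I.var (r x) = a ≫ I.var x) →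
        I.ltm (t.rename r) = M.L.map a (I.ltm t)) := by
  -- `K` consists here of substitutions by variables. This case comes first because extending a
  -- general substitution under a binder weakens its terms, and the interpretation of weakening must
  -- already be known.
  have key := I.interp_subst_of_class
    (fun {Γ Δ} f a => ∃ r : Ren Γ Δ, (∀ ⦃τ : CTy⦄ (x : Var Γ τ), f x = .var (r x)) ∧
      ∀ ⦃τ : CTy⦄ (x : Var Γ τ), I.var (r x) = a ≫ I.var x) ?_ ?_
  · refine ⟨fun t _ r a h => ?_, fun t _ r a h => ?_⟩
    · rw [t.rename_eq_subst]
      exact key.1 t _ a ⟨r, fun _ _ => rfl, h⟩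
    · rw [t.rename_eq_subst]
      exact key.2 t _ a ⟨r, fun _ _ => rfl, h⟩
  · rintro Γ Δ f a ⟨r, hr, h⟩ τ x
    rw [hr, ← h]; rfl
  · rintro Γ Δ f a ⟨r, hr, h⟩ τ
    refine ⟨r.lift τ, fun τ' x => ?_, fun τ' x => ?_⟩
    · cases x with
      | zero => rfl
      | succ x => exact congrArg (CTm.wk · τ) (hr x)
    · cases x with
      | zero => exact I.var_lift_zero τ a
      | succ x => exact I.var_lift_succ τ a x (h x)

theorem var_wk {Γ : Ctx} (τ : CTy) ⦃τ' : CTy⦄ (x : Var Γ τ') :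
    I.var (Ren.wk Γ τ x) = (fst (I.ctx Γ) (I.cty τ) : I.ctx (τ :: Γ) ⟶ I.ctx Γ) ≫ I.var x :=
  rfl

theorem ctm_wk {Γ : Ctx} {τ : CTy} (t : CTm S Γ τ) (τ' : CTy) :
    I.ctm (t.wk τ') = fst (I.ctx Γ) (I.cty τ') ≫ I.ctm t :=
  I.interp_rename.1 t _ _ (I.var_wk τ')

theorem ltm_wk {Γ : Ctx} {σ ρ : LTy} (t : LTm S Γ σ ρ) (τ' : CTy) :
    I.ltm (t.wk τ') = M.L.map (fst (I.ctx Γ) (I.cty τ')) (I.ltm t) :=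
  I.interp_rename.2 t _ _ (I.var_wk τ')

/-- Now `K` contains all substitutions interpreted by the given morphism; closure under binders is
supplied by `ctm_wk`, the renaming case. -/
theorem interp_subst :
    (∀ {Γ : Ctx} {τ : CTy} (t : CTm S Γ τ) {Δ : Ctx} (f : Sub S Γ Δ) (a : I.ctx Δ ⟶ I.ctx Γ),
      (∀ ⦃τ⦄ (x : Var Γ τ), I.ctm (f x) = a ≫ I.var x) → I.ctm (t.subst f) = a ≫ I.ctm t) ∧
    (∀ {Γ : Ctx} {σ ρ : LTy} (t : LTm S Γ σ ρ) {Δ : Ctx} (f : Sub S Γ Δ) (a : I.ctx Δ ⟶ I.ctx Γ),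
      (∀ ⦃τ⦄ (x : Var Γ τ), I.ctm (f x) = a ≫ I.var x) →
        I.ltm (t.subst f) = M.L.map a (I.ltm t)) := by
  refine I.interp_subst_of_class
    (fun {Γ Δ} f a => ∀ ⦃τ : CTy⦄ (x : Var Γ τ), I.ctm (f x) = a ≫ I.var x) (fun h => h) ?_
  intro Γ Δ f a h τ τ' x
  cases x with
  | zero => exact I.var_lift_zero τ a
  | succ x => exact (I.ctm_wk _ _).trans (I.var_lift_succ τ a x (h x))

theorem ctm_single {Γ : Ctx} {τ' : CTy} (s : CTm S Γ τ') ⦃τ : CTy⦄ (x : Var (τ' :: Γ) τ) :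
    I.ctm (Sub.single s x) =
      (lift (𝟙 (I.ctx Γ)) (I.ctm s) : I.ctx Γ ⟶ I.ctx (τ' :: Γ)) ≫ I.var x := by
  cases x with
  | zero => exact (lift_snd (𝟙 (I.ctx Γ)) (I.ctm s)).symm
  | succ x =>
    exact (Category.id_comp (I.var x)).symm.trans
      (lift_fst_assoc (𝟙 (I.ctx Γ)) (I.ctm s) (I.var x)).symm

theorem ctm_inst {Γ : Ctx} {τ τ' : CTy} (t : CTm S (τ' :: Γ) τ) (s : CTm S Γ τ') :
    I.ctm (t.inst s) = lift (𝟙 (I.ctx Γ)) (I.ctm s) ≫ I.ctm t :=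
  I.interp_subst.1 t _ _ (I.ctm_single s)

theorem ltm_inst {Γ : Ctx} {σ ρ : LTy} {τ' : CTy} (t : LTm S (τ' :: Γ) σ ρ) (s : CTm S Γ τ') :
    I.ltm (t.inst s) = M.L.map (lift (𝟙 (I.ctx Γ)) (I.ctm s)) (I.ltm t) :=
  I.interp_subst.2 t _ _ (I.ctm_single s)

/-- Each construct of the linear judgement is natural in the domain of its linear argument. Under a
Cartesian binder the substituted term is weakened, which matches the reindexing along `fst` in
`Ψ_comp`. -/
theorem ltm_lsubst : ∀ {Γ : Ctx} {σ ρ : LTy} (t : LTm S Γ σ ρ) {σ' : LTy} (s : LTm S Γ σ' σ),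
    I.ltm (t.lsubst s) = M.L.comp (I.ltm s) (I.ltm t) := by
  suffices h : (∀ {Γ : Ctx} {τ : CTy} (_ : CTm S Γ τ), True) ∧
      ∀ {Γ : Ctx} {σ ρ : LTy} (t : LTm S Γ σ ρ) {σ' : LTy} (s : LTm S Γ σ' σ),
        I.ltm (t.lsubst s) = M.L.comp (I.ltm s) (I.ltm t) by
    obtain ⟨_, h⟩ := h; exact @h
  apply tm_induction
  iterate 9 intros; trivial
  · exact fun s => (M.L.comp_id _).symm
  · exact fun o t r _ ih _ s =>
      (congrArg (M.L.comp · (M.L.map (I.ctm t) (I.lop o))) (ih s)).trans (M.L.assoc _ _ _)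
  · exact fun s => (M.biadditive.toUnit_unique _).symm
  · exact fun t r ih ih' _ s =>
      (congrArg₂ M.biadditive.pair (ih s) (ih' s)).trans (M.biadditive.comp_pair _ _ _).symm
  · exact fun t ih _ s => (congrArg (M.L.comp · (M.biadditive.fst _ _ _)) (ih s)).trans
      (M.L.assoc _ _ _)
  · exact fun t ih _ s => (congrArg (M.L.comp · (M.biadditive.snd _ _ _)) (ih s)).trans
      (M.L.assoc _ _ _)
  · exact fun t ih _ s => (congrArg (M.arrowTypes.Ψ _ _ _ _) ((ih _).trans
      (congrArg (M.L.comp · (I.ltm t)) (I.ltm_wk s _)))).trans (M.arrowTypes.Ψ_comp _ _)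
  · exact fun t r ih _ _ s => (congrArg (M.arrowTypes.appAt · (I.ctm r)) (ih s)).trans
      (M.arrowTypes.comp_appAt _ _ _)
  · exact fun {_ _ ρ _} t r _ ih _ s => (I.ltm_tens _ _).trans
      ((congrArg (M.L.comp · (M.tensorTypes.unitAt (I.ctm t) (I.lty ρ))) (ih s)).trans
        ((M.L.assoc _ _ _).trans (congrArg (M.L.comp (I.ltm s)) (I.ltm_tens t r).symm)))
  · exact fun t r ih _ _ s =>
      (congrArg (M.L.comp · ((M.tensorTypes.Φ _ _ _ _).symm (I.ltm r))) (ih s)).trans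
        (M.L.assoc _ _ _)
  · exact fun t r _ ih _ s =>
      (congrArg (M.L.comp · ((M.lolliTypes.Λ _ _ _).symm (I.ctm t))) (ih s)).trans
        (M.L.assoc _ _ _)
  · exact fun s => (M.biadditive.comp_zero _).symm
  · exact fun t r ih ih' _ s =>
      (congrArg₂ M.biadditive.add (ih s) (ih' s)).trans (M.biadditive.comp_add _ _ _).symm

/-! ## Soundness -/

-- Congruence rules are congruences of the model's operations, and each axiom reduces to one law of
-- the model once `ctm_inst`, `ltm_inst`, `ltm_lsubst` and the weakening lemmas have rewritten its
-- substitutions.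
mutual
theorem ctm_sound : ∀ {Γ : Ctx} {τ : CTy} {t s : CTm S Γ τ}, CEq t s → I.ctm t = I.ctm s
  | _, _, _, _, .refl t => rfl
  | _, _, _, _, .symm h => (ctm_sound h).symm
  | _, _, _, _, .trans h h' => (ctm_sound h).trans (ctm_sound h')
  | _, _, _, _, .congr_op o h => congrArg (· ≫ I.op o) (ctm_sound h)
  | _, _, _, _, .congr_pair h h' => congrArg₂ lift (ctm_sound h) (ctm_sound h')
  | _, _, _, _, .congr_fst h => congrArg (· ≫ fst _ _) (ctm_sound h)
  | _, _, _, _, .congr_snd h => congrArg (· ≫ snd _ _) (ctm_sound h)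
  | _, _, _, _, .congr_lam h => congrArg curryLast (ctm_sound h)
  | _, _, _, _, .congr_app (τ₁ := τ₁) (τ₂ := τ₂) h h' =>
    congrArg (· ≫ (ihom.ev (I.cty τ₁)).app (I.cty τ₂))
      (congrArg₂ lift (ctm_sound h') (ctm_sound h))
  | _, _, _, _, .congr_llam h => congrArg (M.lolliTypes.Λ _ _ _) (ltm_sound h)
  | _, _, _, _, .unit_eta t => toUnit_unique _ _
  | _, _, _, _, .fst_beta t s => lift_fst (I.ctm t) (I.ctm s)
  | _, _, _, _, .snd_beta t s => lift_snd (I.ctm t) (I.ctm s)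
  | _, _, _, _, .pair_eta (τ₁ := τ₁) (τ₂ := τ₂) t =>
    (lift_comp_fst_snd (Y := I.cty τ₁) (Z := I.cty τ₂) (I.ctm t)).symm
  | _, _, _, _, .lam_beta t s => (curryLast_ev (I.ctm t) (I.ctm s)).trans (I.ctm_inst t s).symm
  | _, _, _, _, .lam_eta (τ₁ := τ₁) (τ₂ := τ₂) t =>
    (curryLast_eta (A := I.cty τ₁) (B := I.cty τ₂) (I.ctm t)).symm.trans
      (congrArg (fun x => curryLast (lift (snd _ _) x ≫ (ihom.ev (I.cty τ₁)).app (I.cty τ₂)))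
        (I.ctm_wk t τ₁).symm)
  | _, _, _, _, .llam_eta (σ := σ) (ρ := ρ) t =>
    ((M.lolliTypes.Λ _ _ _).apply_symm_apply _).symm.trans
      (congrArg (M.lolliTypes.Λ _ (I.lty σ) (I.lty ρ)) (M.L.id_comp _).symm)
theorem ltm_sound : ∀ {Γ : Ctx} {σ ρ : LTy} {t s : LTm S Γ σ ρ}, LEq t s → I.ltm t = I.ltm s
  | _, _, _, _, _, .refl t => rfl
  | _, _, _, _, _, .symm h => (ltm_sound h).symm
  | _, _, _, _, _, .trans h h' => (ltm_sound h).trans (ltm_sound h')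
  | _, _, _, _, _, .congr_lop o h h' =>
    congrArg₂ (fun x y => M.L.comp y (M.L.map x (I.lop o))) (ctm_sound h) (ltm_sound h')
  | _, _, _, _, _, .congr_pair h h' => congrArg₂ M.biadditive.pair (ltm_sound h) (ltm_sound h')
  | _, _, _, _, _, .congr_fst h => congrArg (M.L.comp · (M.biadditive.fst _ _ _)) (ltm_sound h)
  | _, _, _, _, _, .congr_snd h => congrArg (M.L.comp · (M.biadditive.snd _ _ _)) (ltm_sound h)
  | _, _, _, _, _, .congr_lam h => congrArg (M.arrowTypes.Ψ _ _ _ _) (ltm_sound h)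
  | _, _, _, _, _, .congr_app h h' =>
    congrArg₂ M.arrowTypes.appAt (ltm_sound h) (ctm_sound h')
  | _, _, _, _, _, .congr_tens (ρ := ρ) h h' =>
    (I.ltm_tens _ _).trans ((congrArg₂ (fun x y => M.L.comp y
      (M.tensorTypes.unitAt x (I.lty ρ))) (ctm_sound h) (ltm_sound h')).trans (I.ltm_tens _ _).symm)
  | _, _, _, _, _, .congr_tmatch h h' =>
    congrArg₂ (fun x y => M.L.comp x ((M.tensorTypes.Φ _ _ _ _).symm y))
      (ltm_sound h) (ltm_sound h')
  | _, _, _, _, _, .congr_lapp h h' =>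
    congrArg₂ (fun x y => M.L.comp y ((M.lolliTypes.Λ _ _ _).symm x)) (ctm_sound h) (ltm_sound h')
  | _, _, _, _, _, .congr_add h h' => congrArg₂ M.biadditive.add (ltm_sound h) (ltm_sound h')
  | _, _, _, _, _, .unit_eta t => M.biadditive.toUnit_unique _
  | _, _, _, _, _, .fst_beta t s => M.biadditive.pair_fst _ _
  | _, _, _, _, _, .snd_beta t s => M.biadditive.pair_snd _ _
  | _, _, _, _, _, .pair_eta t => M.biadditive.pair_unique _
  | _, _, _, _, _, .lam_beta t s =>
    (M.arrowTypes.appAt_Ψ (I.ltm t) (I.ctm s)).trans (I.ltm_inst t s).symm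
  | _, _, _, _, _, .lam_eta (ρ := ρ) (τ := τ) t =>
    (M.arrowTypes.Ψ_appAt (A := I.cty τ) (Y := I.lty ρ) (I.ltm t)).symm.trans
      (congrArg (fun x => M.arrowTypes.Ψ _ _ _ _ (M.arrowTypes.appAt x (snd _ _)))
        (I.ltm_wk t τ).symm)
  | _, _, _, _, _, .tens_beta t s r =>
    (congrArg (M.L.comp · ((M.tensorTypes.Φ _ _ _ _).symm (I.ltm r))) (I.ltm_tens t s)).trans
      ((M.L.assoc _ _ _).trans
        ((congrArg (M.L.comp (I.ltm s)) ((M.tensorTypes.unitAt_comp (I.ctm t) (I.ltm r)).trans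
          (I.ltm_inst r t).symm)).trans (I.ltm_lsubst _ _).symm))
  | _, _, _, _, _, .tens_eta (Γ := Γ) (ρ := ρ) (ρ' := ρ') (τ := τ) t s => by
    refine (I.ltm_lsubst t s).trans (congrArg (M.L.comp (I.ltm s)) ?_)
    -- With the common factor `s` removed, `t` is recovered as the transpose of its composite with
    -- the unit at the generic point, and by `e` this unit interprets `!y ⊗ z`.
    refine (M.tensorTypes.eta (A := I.cty τ) (X := I.lty ρ) (I.ltm t)).symm.trans
      (congrArg (M.tensorTypes.Φ _ _ _ _).symm ?_)
    refine Eq.trans ?_ (I.ltm_lsubst (t.wk τ) (.tens (.var .zero) .var)).symm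
    have e : I.ltm (.tens (.var .zero) .var : LTm S (τ :: Γ) ρ (.tensor τ ρ)) =
        M.tensorTypes.unitAt (snd (I.ctx Γ) (I.cty τ)) (I.lty ρ) :=
      (I.ltm_tens (.var .zero) .var).trans (by exact M.L.id_comp _)
    exact congrArg₂ M.L.comp e.symm (I.ltm_wk t τ).symm
  | _, _, _, _, _, .llam_beta t s =>
    (congrArg (M.L.comp (I.ltm s)) ((M.lolliTypes.Λ _ _ _).symm_apply_apply _)).trans
      (I.ltm_lsubst t s).symm
  | _, _, _, _, _, .add_zero t => M.biadditive.add_zero _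
  | _, _, _, _, _, .zero_add t => M.biadditive.zero_add _
  | _, _, _, _, _, .add_assoc t s r => M.biadditive.add_assoc _ _ _
  | _, _, _, _, _, .add_comm t s => M.biadditive.add_comm _ _
  | _, _, _, _, _, .subst_zero t => (I.ltm_lsubst _ _).trans (M.biadditive.zero_comp _)
  | _, _, _, _, _, .subst_add t s r =>
    (I.ltm_lsubst _ _).trans ((M.biadditive.add_comp _ _ _).trans
      (congrArg₂ M.biadditive.add (I.ltm_lsubst _ _).symm (I.ltm_lsubst _ _).symm))
end

end Interpretation

/-! ## Terms modulo `βη+`-equality -/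

/-- `βη+`-equality as an equivalence relation on the terms `Γ ⊢ t : τ`. -/
def ceqSetoid (S : Signature.{u}) (Γ : Ctx) (τ : CTy) : Setoid (CTm S Γ τ) :=
  ⟨CEq, .refl, .symm, .trans⟩

/-- `βη+`-equality as an equivalence relation on the terms `Γ; x : σ ⊢ t : ρ`. -/
def leqSetoid (S : Signature.{u}) (Γ : Ctx) (σ ρ : LTy) : Setoid (LTm S Γ σ ρ) :=
  ⟨LEq, .refl, .symm, .trans⟩

/-- The terms `Γ ⊢ t : τ` modulo `βη+`-equality. -/
def QC (S : Signature.{u}) (Γ : Ctx) (τ : CTy) : Type u := Quotient (ceqSetoid S Γ τ)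

/-- The terms `Γ; x : σ ⊢ t : ρ` modulo `βη+`-equality. -/
def QL (S : Signature.{u}) (Γ : Ctx) (σ ρ : LTy) : Type u := Quotient (leqSetoid S Γ σ ρ)

/-- Simultaneous substitutions modulo `βη+`-equality. -/
def QSub (S : Signature.{u}) (Γ Δ : Ctx) : Type u := ∀ ⦃τ : CTy⦄, Var Γ τ → QC S Δ τ

/-- The class of a term. -/
def QC.mk {Γ : Ctx} {τ : CTy} (t : CTm S Γ τ) : QC S Γ τ := Quotient.mk (ceqSetoid S Γ τ) t

/-- The class of a term. -/
def QL.mk {Γ : Ctx} {σ ρ : LTy} (t : LTm S Γ σ ρ) : QL S Γ σ ρ := Quotient.mk (leqSetoid S Γ σ ρ) t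

theorem QC.mk_eq_iff {Γ : Ctx} {τ : CTy} {t s : CTm S Γ τ} : QC.mk t = QC.mk s ↔ CEq t s :=
  ⟨fun h => Quotient.exact h, fun h => Quotient.sound (s := ceqSetoid S Γ τ) h⟩

theorem QL.mk_eq_iff {Γ : Ctx} {σ ρ : LTy} {t s : LTm S Γ σ ρ} : QL.mk t = QL.mk s ↔ LEq t s :=
  ⟨fun h => Quotient.exact h, fun h => Quotient.sound (s := leqSetoid S Γ σ ρ) h⟩

theorem QC.mk_surjective {Γ : Ctx} {τ : CTy} (q : QC S Γ τ) : ∃ t, QC.mk t = q :=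
  Quotient.exists_rep q

theorem QL.mk_surjective {Γ : Ctx} {σ ρ : LTy} (q : QL S Γ σ ρ) : ∃ t, QL.mk t = q :=
  Quotient.exists_rep q

/-- A representative of a class of terms. -/
noncomputable def QC.rep {Γ : Ctx} {τ : CTy} (q : QC S Γ τ) : CTm S Γ τ :=
  Classical.choose q.mk_surjective

theorem QC.mk_rep {Γ : Ctx} {τ : CTy} (q : QC S Γ τ) : QC.mk q.rep = q :=
  Classical.choose_spec q.mk_surjective

-- Term formers on classes.

namespace QC

variable {Γ : Ctx}

def var {τ : CTy} (x : Var Γ τ) : QC S Γ τ := mk (.var x)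

def op {ns : List ℕ} {m : ℕ} (o : S.Op ns m) : QC S Γ (CTy.reals ns) → QC S Γ (.real m) :=
  Quotient.map (.op o) fun _ _ h => CEq.congr_op o h

def unit : QC S Γ .unit := mk .unit

def pair {τ₁ τ₂ : CTy} : QC S Γ τ₁ → QC S Γ τ₂ → QC S Γ (.prod τ₁ τ₂) :=
  Quotient.map₂ .pair fun _ _ h _ _ h' => CEq.congr_pair h h'

def fst {τ₁ τ₂ : CTy} : QC S Γ (.prod τ₁ τ₂) → QC S Γ τ₁ :=
  Quotient.map .fst fun _ _ h => CEq.congr_fst h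

def snd {τ₁ τ₂ : CTy} : QC S Γ (.prod τ₁ τ₂) → QC S Γ τ₂ :=
  Quotient.map .snd fun _ _ h => CEq.congr_snd h

def lam {τ₁ τ₂ : CTy} : QC S (τ₁ :: Γ) τ₂ → QC S Γ (.arrow τ₁ τ₂) :=
  Quotient.map .lam fun _ _ h => CEq.congr_lam h

def app {τ₁ τ₂ : CTy} : QC S Γ (.arrow τ₁ τ₂) → QC S Γ τ₁ → QC S Γ τ₂ :=
  Quotient.map₂ .app fun _ _ h _ _ h' => CEq.congr_app h h'

def llam {σ ρ : LTy} : QL S Γ σ ρ → QC S Γ (.lolli σ ρ) :=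
  Quotient.map .llam fun _ _ h => CEq.congr_llam h

end QC

namespace QL

variable {Γ : Ctx}

def var {σ : LTy} : QL S Γ σ σ := mk .var

def lop {σ : LTy} {ns ms : List ℕ} {m : ℕ} (o : S.LOp ns ms m) :
    QC S Γ (CTy.reals ns) → QL S Γ σ (LTy.reals ms) → QL S Γ σ (.real m) :=
  Quotient.map₂ (.lop o) fun _ _ h _ _ h' => LEq.congr_lop o h h'

def unit {σ : LTy} : QL S Γ σ .unit := mk .unit

def pair {σ ρ₁ ρ₂ : LTy} : QL S Γ σ ρ₁ → QL S Γ σ ρ₂ → QL S Γ σ (.prod ρ₁ ρ₂) :=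
  Quotient.map₂ .pair fun _ _ h _ _ h' => LEq.congr_pair h h'

def fst {σ ρ₁ ρ₂ : LTy} : QL S Γ σ (.prod ρ₁ ρ₂) → QL S Γ σ ρ₁ :=
  Quotient.map .fst fun _ _ h => LEq.congr_fst h

def snd {σ ρ₁ ρ₂ : LTy} : QL S Γ σ (.prod ρ₁ ρ₂) → QL S Γ σ ρ₂ :=
  Quotient.map .snd fun _ _ h => LEq.congr_snd h

def lam {σ ρ : LTy} {τ : CTy} : QL S (τ :: Γ) σ ρ → QL S Γ σ (.arrow τ ρ) :=
  Quotient.map .lam fun _ _ h => LEq.congr_lam h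

def app {σ ρ : LTy} {τ : CTy} : QL S Γ σ (.arrow τ ρ) → QC S Γ τ → QL S Γ σ ρ :=
  Quotient.map₂ .app fun _ _ h _ _ h' => LEq.congr_app h h'

def tens {σ ρ : LTy} {τ : CTy} : QC S Γ τ → QL S Γ σ ρ → QL S Γ σ (.tensor τ ρ) :=
  Quotient.map₂ .tens fun _ _ h _ _ h' => LEq.congr_tens h h'

def tmatch {σ ρ ρ' : LTy} {τ : CTy} :
    QL S Γ σ (.tensor τ ρ) → QL S (τ :: Γ) ρ ρ' → QL S Γ σ ρ' :=
  Quotient.map₂ .tmatch fun _ _ h _ _ h' => LEq.congr_tmatch h h'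

def lapp {σ ρ ρ' : LTy} : QC S Γ (.lolli ρ ρ') → QL S Γ σ ρ → QL S Γ σ ρ' :=
  Quotient.map₂ .lapp fun _ _ h _ _ h' => LEq.congr_lapp h h'

def zero {σ ρ : LTy} : QL S Γ σ ρ := mk .zero

def add {σ ρ : LTy} : QL S Γ σ ρ → QL S Γ σ ρ → QL S Γ σ ρ :=
  Quotient.map₂ .add fun _ _ h _ _ h' => LEq.congr_add h h'

/-- Substitution for the linear variable. -/
def lsubst {σ' σ ρ : LTy} : QL S Γ σ ρ → QL S Γ σ' σ → QL S Γ σ' ρ :=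
  Quotient.map₂ LTm.lsubst fun _ _ h _ _ h' => LEq.lsubst h h'

end QL

/-- Substitution for the Cartesian variables. -/
noncomputable def QC.subst {Γ Δ : Ctx} {τ : CTy} (q : QC S Γ τ) (f : QSub S Γ Δ) : QC S Δ τ :=
  Quotient.map (sa := ceqSetoid S Γ τ) (sb := ceqSetoid S Δ τ)
    (fun t => t.subst fun _ x => (f x).rep) (fun _ _ h => CEq.subst h _) q

/-- Substitution for the Cartesian variables. -/
noncomputable def QL.subst {Γ Δ : Ctx} {σ ρ : LTy} (q : QL S Γ σ ρ) (f : QSub S Γ Δ) :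
    QL S Δ σ ρ :=
  Quotient.map (sa := leqSetoid S Γ σ ρ) (sb := leqSetoid S Δ σ ρ)
    (fun t => t.subst fun _ x => (f x).rep) (fun _ _ h => LEq.subst h _) q

/-- Substitution on classes is defined through chosen representatives; this shows that any other
family of representatives gives the same class. -/
theorem QC.mk_subst {Γ Δ : Ctx} {τ : CTy} (t : CTm S Γ τ) (f : QSub S Γ Δ) (g : Sub S Γ Δ)
    (h : ∀ ⦃τ⦄ (x : Var Γ τ), f x = QC.mk (g x)) : (QC.mk t).subst f = QC.mk (t.subst g) :=
  QC.mk_eq_iff.2 (subst_congr.1 t fun _ x => QC.mk_eq_iff.1 ((f x).mk_rep.trans (h x)))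

theorem QL.mk_subst {Γ Δ : Ctx} {σ ρ : LTy} (t : LTm S Γ σ ρ) (f : QSub S Γ Δ) (g : Sub S Γ Δ)
    (h : ∀ ⦃τ⦄ (x : Var Γ τ), f x = QC.mk (g x)) : (QL.mk t).subst f = QL.mk (t.subst g) :=
  QL.mk_eq_iff.2 (subst_congr.2 t fun _ x => QC.mk_eq_iff.1 ((f x).mk_rep.trans (h x)))

namespace QSub

def id (Γ : Ctx) : QSub S Γ Γ := fun _ x => .var x

noncomputable def comp {Γ Δ Θ : Ctx} (f : QSub S Γ Δ) (g : QSub S Δ Θ) : QSub S Γ Θ :=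
  fun _ x => (f x).subst g

/-- Weakening. -/
def wk (Γ : Ctx) (τ : CTy) : QSub S Γ (τ :: Γ) := fun _ x => .var (.succ x)

/-- The substitution for the empty context. -/
def nil (Δ : Ctx) : QSub S [] Δ := fun _ x => nomatch x

/-- Extension of a substitution by the value of one more variable. -/
def cons {Γ Δ : Ctx} {τ : CTy} (q : QC S Δ τ) (f : QSub S Γ Δ) : QSub S (τ :: Γ) Δ
  | _, .zero => q
  | _, .succ x => f x

theorem eq_nil {Δ : Ctx} (f : QSub S [] Δ) : f = nil Δ := by
  funext _ x; cases x

theorem eq_cons {Γ Δ : Ctx} {τ : CTy} (f : QSub S (τ :: Γ) Δ) :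
    f = cons (f .zero) (fun _ x => f (.succ x)) := by
  funext _ x; cases x <;> rfl

theorem exists_rep {Γ Δ : Ctx} (f : QSub S Γ Δ) :
    ∃ g : Sub S Γ Δ, ∀ ⦃τ⦄ (x : Var Γ τ), f x = QC.mk (g x) :=
  ⟨fun _ x => (f x).rep, fun _ x => (f x).mk_rep.symm⟩

end QSub

open QSub

-- The substitution calculus and the equational theory on classes, as rewrite rules.

section Calculus

variable {Γ Δ Θ : Ctx}

@[simp] theorem cons_zero {τ : CTy} (q : QC S Δ τ) (f : QSub S Γ Δ) : cons q f .zero = q := rfl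

@[simp] theorem cons_succ {τ τ' : CTy} (q : QC S Δ τ) (f : QSub S Γ Δ) (x : Var Γ τ') :
    cons q f (.succ x) = f x := rfl

theorem QC.mk_wk {τ : CTy} (t : CTm S Γ τ) (τ' : CTy) :
    (QC.mk t).subst (wk Γ τ') = QC.mk (t.wk τ') :=
  (QC.mk_subst t _ (fun _ x => .var (.succ x)) fun _ _ => rfl).trans
    (congrArg QC.mk (t.rename_eq_subst _).symm)

theorem QL.mk_wk {σ ρ : LTy} (t : LTm S Γ σ ρ) (τ' : CTy) :
    (QL.mk t).subst (wk Γ τ') = QL.mk (t.wk τ') :=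
  (QL.mk_subst t _ (fun _ x => .var (.succ x)) fun _ _ => rfl).trans
    (congrArg QL.mk (t.rename_eq_subst _).symm)

/-- Extension of a substitution under a binder. -/
noncomputable abbrev QSub.lift (f : QSub S Γ Δ) (τ : CTy) : QSub S (τ :: Γ) (τ :: Δ) :=
  cons (.var .zero) (f.comp (wk Δ τ))

theorem QSub.lift_rep {f : QSub S Γ Δ} {g : Sub S Γ Δ}
    (h : ∀ ⦃τ⦄ (x : Var Γ τ), f x = QC.mk (g x)) (τ : CTy) ⦃τ' : CTy⦄ (x : Var (τ :: Γ) τ') :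
    f.lift τ x = QC.mk (g.lift τ x) := by
  cases x with
  | zero => rfl
  | succ x =>
    change (f x).subst _ = _
    rw [h, QC.mk_wk]; rfl

@[simp] theorem QC.var_subst {τ : CTy} (x : Var Γ τ) (f : QSub S Γ Δ) : (QC.var x).subst f = f x :=
  (f x).mk_rep

@[simp] theorem QC.op_subst {ns : List ℕ} {m : ℕ} (o : S.Op ns m) (t : QC S Γ (CTy.reals ns))
    (f : QSub S Γ Δ) : (QC.op o t).subst f = .op o (t.subst f) := by
  obtain ⟨t, rfl⟩ := t.mk_surjective; rfl

@[simp] theorem QC.unit_subst (f : QSub S Γ Δ) : QC.unit.subst f = .unit := rfl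

@[simp] theorem QC.pair_subst {τ₁ τ₂ : CTy} (t : QC S Γ τ₁) (s : QC S Γ τ₂) (f : QSub S Γ Δ) :
    (QC.pair t s).subst f = .pair (t.subst f) (s.subst f) := by
  obtain ⟨t, rfl⟩ := t.mk_surjective; obtain ⟨s, rfl⟩ := s.mk_surjective; rfl

@[simp] theorem QC.fst_subst {τ₁ τ₂ : CTy} (t : QC S Γ (.prod τ₁ τ₂)) (f : QSub S Γ Δ) :
    t.fst.subst f = (t.subst f).fst := by
  obtain ⟨t, rfl⟩ := t.mk_surjective; rfl

@[simp] theorem QC.snd_subst {τ₁ τ₂ : CTy} (t : QC S Γ (.prod τ₁ τ₂)) (f : QSub S Γ Δ) :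
    t.snd.subst f = (t.subst f).snd := by
  obtain ⟨t, rfl⟩ := t.mk_surjective; rfl

-- The chosen representatives for `f.lift` need not be the lifts of those for `f`, so `rfl` does not
-- suffice as it does for constructors without binders. Both sides are computed from a common
-- representative `g` and its lift.
@[simp] theorem QC.lam_subst {τ₁ τ₂ : CTy} (t : QC S (τ₁ :: Γ) τ₂) (f : QSub S Γ Δ) :
    t.lam.subst f = (t.subst (f.lift τ₁)).lam := by
  obtain ⟨t, rfl⟩ := t.mk_surjective
  obtain ⟨g, hg⟩ := f.exists_rep
  rw [QC.mk_subst t _ _ (QSub.lift_rep hg τ₁)]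
  exact QC.mk_subst t.lam f g hg

@[simp] theorem QC.app_subst {τ₁ τ₂ : CTy} (t : QC S Γ (.arrow τ₁ τ₂)) (s : QC S Γ τ₁)
    (f : QSub S Γ Δ) : (QC.app t s).subst f = .app (t.subst f) (s.subst f) := by
  obtain ⟨t, rfl⟩ := t.mk_surjective; obtain ⟨s, rfl⟩ := s.mk_surjective; rfl

@[simp] theorem QC.llam_subst {σ ρ : LTy} (t : QL S Γ σ ρ) (f : QSub S Γ Δ) :
    (QC.llam t).subst f = .llam (t.subst f) := by
  obtain ⟨t, rfl⟩ := t.mk_surjective; rfl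

@[simp] theorem QL.var_subst {σ : LTy} (f : QSub S Γ Δ) :
    (QL.var : QL S Γ σ σ).subst f = .var := rfl

@[simp] theorem QL.lop_subst {σ : LTy} {ns ms : List ℕ} {m : ℕ} (o : S.LOp ns ms m)
    (t : QC S Γ (CTy.reals ns)) (s : QL S Γ σ (LTy.reals ms)) (f : QSub S Γ Δ) :
    (QL.lop o t s).subst f = .lop o (t.subst f) (s.subst f) := by
  obtain ⟨t, rfl⟩ := t.mk_surjective; obtain ⟨s, rfl⟩ := s.mk_surjective; rfl

@[simp] theorem QL.unit_subst {σ : LTy} (f : QSub S Γ Δ) :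
    (QL.unit : QL S Γ σ _).subst f = .unit := rfl

@[simp] theorem QL.pair_subst {σ ρ₁ ρ₂ : LTy} (t : QL S Γ σ ρ₁) (s : QL S Γ σ ρ₂)
    (f : QSub S Γ Δ) : (QL.pair t s).subst f = .pair (t.subst f) (s.subst f) := by
  obtain ⟨t, rfl⟩ := t.mk_surjective; obtain ⟨s, rfl⟩ := s.mk_surjective; rfl

@[simp] theorem QL.fst_subst {σ ρ₁ ρ₂ : LTy} (t : QL S Γ σ (.prod ρ₁ ρ₂)) (f : QSub S Γ Δ) :
    t.fst.subst f = (t.subst f).fst := by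
  obtain ⟨t, rfl⟩ := t.mk_surjective; rfl

@[simp] theorem QL.snd_subst {σ ρ₁ ρ₂ : LTy} (t : QL S Γ σ (.prod ρ₁ ρ₂)) (f : QSub S Γ Δ) :
    t.snd.subst f = (t.subst f).snd := by
  obtain ⟨t, rfl⟩ := t.mk_surjective; rfl

@[simp] theorem QL.lam_subst {σ ρ : LTy} {τ : CTy} (t : QL S (τ :: Γ) σ ρ) (f : QSub S Γ Δ) :
    t.lam.subst f = (t.subst (f.lift τ)).lam := by
  obtain ⟨t, rfl⟩ := t.mk_surjective
  obtain ⟨g, hg⟩ := f.exists_rep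
  rw [QL.mk_subst t _ _ (QSub.lift_rep hg τ)]
  exact QL.mk_subst t.lam f g hg

@[simp] theorem QL.app_subst {σ ρ : LTy} {τ : CTy} (t : QL S Γ σ (.arrow τ ρ)) (s : QC S Γ τ)
    (f : QSub S Γ Δ) : (QL.app t s).subst f = .app (t.subst f) (s.subst f) := by
  obtain ⟨t, rfl⟩ := t.mk_surjective; obtain ⟨s, rfl⟩ := s.mk_surjective; rfl

@[simp] theorem QL.tens_subst {σ ρ : LTy} {τ : CTy} (t : QC S Γ τ) (s : QL S Γ σ ρ)
    (f : QSub S Γ Δ) : (QL.tens t s).subst f = .tens (t.subst f) (s.subst f) := by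
  obtain ⟨t, rfl⟩ := t.mk_surjective; obtain ⟨s, rfl⟩ := s.mk_surjective; rfl

@[simp] theorem QL.tmatch_subst {σ ρ ρ' : LTy} {τ : CTy} (t : QL S Γ σ (.tensor τ ρ))
    (s : QL S (τ :: Γ) ρ ρ') (f : QSub S Γ Δ) :
    (QL.tmatch t s).subst f = .tmatch (t.subst f) (s.subst (f.lift τ)) := by
  obtain ⟨t, rfl⟩ := t.mk_surjective
  obtain ⟨s, rfl⟩ := s.mk_surjective
  obtain ⟨g, hg⟩ := f.exists_rep
  rw [QL.mk_subst s _ _ (QSub.lift_rep hg τ), QL.mk_subst t _ _ hg]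
  exact QL.mk_subst (t.tmatch s) f g hg

@[simp] theorem QL.lapp_subst {σ ρ ρ' : LTy} (t : QC S Γ (.lolli ρ ρ')) (s : QL S Γ σ ρ)
    (f : QSub S Γ Δ) : (QL.lapp t s).subst f = .lapp (t.subst f) (s.subst f) := by
  obtain ⟨t, rfl⟩ := t.mk_surjective; obtain ⟨s, rfl⟩ := s.mk_surjective; rfl

@[simp] theorem QL.zero_subst {σ ρ : LTy} (f : QSub S Γ Δ) :
    (QL.zero : QL S Γ σ ρ).subst f = .zero := rfl

@[simp] theorem QL.add_subst {σ ρ : LTy} (t s : QL S Γ σ ρ) (f : QSub S Γ Δ) :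
    (QL.add t s).subst f = .add (t.subst f) (s.subst f) := by
  obtain ⟨t, rfl⟩ := t.mk_surjective; obtain ⟨s, rfl⟩ := s.mk_surjective; rfl

@[simp] theorem QL.lsubst_subst {σ σ' ρ : LTy} (t : QL S Γ σ ρ) (s : QL S Γ σ' σ)
    (f : QSub S Γ Δ) : (t.lsubst s).subst f = (t.subst f).lsubst (s.subst f) := by
  obtain ⟨t, rfl⟩ := t.mk_surjective; obtain ⟨s, rfl⟩ := s.mk_surjective
  exact congrArg QL.mk (LTm.lsubst_subst t s _)

@[simp] theorem QC.subst_subst {τ : CTy} (t : QC S Γ τ) (f : QSub S Γ Δ) (g : QSub S Δ Θ) :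
    (t.subst f).subst g = t.subst (f.comp g) := by
  obtain ⟨t, rfl⟩ := t.mk_surjective
  obtain ⟨f', hf⟩ := f.exists_rep
  obtain ⟨g', hg⟩ := g.exists_rep
  rw [QC.mk_subst t _ _ hf, QC.mk_subst _ _ _ hg, LinLang.subst_subst.1]
  refine (QC.mk_subst t _ _ fun _ x => ?_).symm
  rw [comp, hf, QC.mk_subst _ _ _ hg]

@[simp] theorem QL.subst_subst {σ ρ : LTy} (t : QL S Γ σ ρ) (f : QSub S Γ Δ) (g : QSub S Δ Θ) :
    (t.subst f).subst g = t.subst (f.comp g) := by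
  obtain ⟨t, rfl⟩ := t.mk_surjective
  obtain ⟨f', hf⟩ := f.exists_rep
  obtain ⟨g', hg⟩ := g.exists_rep
  rw [QL.mk_subst t _ _ hf, QL.mk_subst _ _ _ hg, LinLang.subst_subst.2]
  refine (QL.mk_subst t _ _ fun _ x => ?_).symm
  rw [comp, hf, QC.mk_subst _ _ _ hg]

theorem QC.subst_id {τ : CTy} (t : QC S Γ τ) : t.subst (QSub.id Γ) = t := by
  obtain ⟨t, rfl⟩ := t.mk_surjective
  exact (QC.mk_subst t _ _ fun _ x => rfl).trans (congrArg QC.mk (subst_var.1 t))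

theorem QL.subst_id {σ ρ : LTy} (t : QL S Γ σ ρ) : t.subst (QSub.id Γ) = t := by
  obtain ⟨t, rfl⟩ := t.mk_surjective
  exact (QL.mk_subst t _ _ fun _ x => rfl).trans (congrArg QL.mk (subst_var.2 t))

-- Over a context with one variable this substitution is the identity; it gives the identity law of
-- the syntactic category.
@[simp] theorem QC.subst_cons_nil {A τ : CTy} (t : QC S [A] τ) :
    t.subst (cons (.var .zero) (nil [A])) = t := by
  conv_rhs => rw [← t.subst_id, (QSub.id [A]).eq_cons]
  congr 2; exact (QSub.eq_nil _).symm

@[simp] theorem QL.subst_cons_nil {A : CTy} {σ ρ : LTy} (t : QL S [A] σ ρ) :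
    t.subst (cons (.var .zero) (nil [A])) = t := by
  conv_rhs => rw [← t.subst_id, (QSub.id [A]).eq_cons]
  congr 2; exact (QSub.eq_nil _).symm

@[simp] theorem QSub.cons_comp {τ : CTy} (q : QC S Δ τ) (f : QSub S Γ Δ) (g : QSub S Δ Θ) :
    (cons q f).comp g = cons (q.subst g) (f.comp g) := by
  funext _ x; cases x <;> rfl

@[simp] theorem QSub.nil_comp (g : QSub S Δ Θ) : (nil Δ).comp g = nil Θ := QSub.eq_nil _

@[simp] theorem QSub.wk_comp_cons {τ : CTy} (q : QC S Δ τ) (f : QSub S Γ Δ) :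
    (wk Γ τ).comp (cons q f) = f := by
  funext _ x; exact QC.var_subst _ _

theorem QSub.comp_assoc {Ξ : Ctx} (f : QSub S Γ Δ) (g : QSub S Δ Θ) (h : QSub S Θ Ξ) :
    (f.comp g).comp h = f.comp (g.comp h) := by
  funext _ x; exact QC.subst_subst _ _ _

@[simp] theorem QSub.wk_apply {τ τ' : CTy} (x : Var Γ τ') :
    (wk Γ τ : QSub S _ _) x = .var (.succ x) := rfl

@[simp] theorem QSub.wk_one {τ τ' : CTy} :
    (wk [τ'] τ : QSub S _ _) = cons (.var (.succ .zero)) (nil _) := by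
  rw [QSub.eq_cons (wk [τ'] τ)]; congr 1; exact QSub.eq_nil _

/-! ### Substitution for the linear variable -/

@[simp] theorem QL.var_lsubst {σ' σ : LTy} (s : QL S Γ σ' σ) : QL.var.lsubst s = s := by
  obtain ⟨s, rfl⟩ := s.mk_surjective; rfl

@[simp] theorem QL.lop_lsubst {σ' σ : LTy} {ns ms : List ℕ} {m : ℕ} (o : S.LOp ns ms m)
    (t : QC S Γ (CTy.reals ns)) (r : QL S Γ σ (LTy.reals ms)) (s : QL S Γ σ' σ) :
    (QL.lop o t r).lsubst s = .lop o t (r.lsubst s) := by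
  obtain ⟨s, rfl⟩ := s.mk_surjective; obtain ⟨t, rfl⟩ := t.mk_surjective
  obtain ⟨r, rfl⟩ := r.mk_surjective; rfl

@[simp] theorem QL.pair_lsubst {σ' σ ρ₁ ρ₂ : LTy} (t : QL S Γ σ ρ₁) (r : QL S Γ σ ρ₂)
    (s : QL S Γ σ' σ) : (QL.pair t r).lsubst s = .pair (t.lsubst s) (r.lsubst s) := by
  obtain ⟨s, rfl⟩ := s.mk_surjective; obtain ⟨t, rfl⟩ := t.mk_surjective
  obtain ⟨r, rfl⟩ := r.mk_surjective; rfl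

@[simp] theorem QL.fst_lsubst {σ' σ ρ₁ ρ₂ : LTy} (t : QL S Γ σ (.prod ρ₁ ρ₂)) (s : QL S Γ σ' σ) :
    t.fst.lsubst s = (t.lsubst s).fst := by
  obtain ⟨s, rfl⟩ := s.mk_surjective; obtain ⟨t, rfl⟩ := t.mk_surjective; rfl

@[simp] theorem QL.snd_lsubst {σ' σ ρ₁ ρ₂ : LTy} (t : QL S Γ σ (.prod ρ₁ ρ₂)) (s : QL S Γ σ' σ) :
    t.snd.lsubst s = (t.lsubst s).snd := by
  obtain ⟨s, rfl⟩ := s.mk_surjective; obtain ⟨t, rfl⟩ := t.mk_surjective; rfl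

@[simp] theorem QL.lam_lsubst {σ' σ ρ : LTy} {τ : CTy} (t : QL S (τ :: Γ) σ ρ) (s : QL S Γ σ' σ) :
    t.lam.lsubst s = (t.lsubst (s.subst (wk Γ τ))).lam := by
  obtain ⟨s, rfl⟩ := s.mk_surjective; obtain ⟨t, rfl⟩ := t.mk_surjective
  rw [QL.mk_wk]; rfl

@[simp] theorem QL.tens_lsubst {σ' σ ρ : LTy} {τ : CTy} (t : QC S Γ τ) (r : QL S Γ σ ρ)
    (s : QL S Γ σ' σ) : (QL.tens t r).lsubst s = .tens t (r.lsubst s) := by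
  obtain ⟨s, rfl⟩ := s.mk_surjective; obtain ⟨t, rfl⟩ := t.mk_surjective
  obtain ⟨r, rfl⟩ := r.mk_surjective; rfl

@[simp] theorem QL.tmatch_lsubst {σ' σ ρ ρ' : LTy} {τ : CTy} (t : QL S Γ σ (.tensor τ ρ))
    (r : QL S (τ :: Γ) ρ ρ') (s : QL S Γ σ' σ) :
    (QL.tmatch t r).lsubst s = .tmatch (t.lsubst s) r := by
  obtain ⟨s, rfl⟩ := s.mk_surjective; obtain ⟨t, rfl⟩ := t.mk_surjective
  obtain ⟨r, rfl⟩ := r.mk_surjective; rfl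

@[simp] theorem QL.lapp_lsubst {σ' σ ρ ρ' : LTy} (t : QC S Γ (.lolli ρ ρ')) (r : QL S Γ σ ρ)
    (s : QL S Γ σ' σ) : (QL.lapp t r).lsubst s = .lapp t (r.lsubst s) := by
  obtain ⟨s, rfl⟩ := s.mk_surjective; obtain ⟨t, rfl⟩ := t.mk_surjective
  obtain ⟨r, rfl⟩ := r.mk_surjective; rfl

@[simp] theorem QL.zero_lsubst {σ' σ ρ : LTy} (s : QL S Γ σ' σ) :
    (QL.zero : QL S Γ σ ρ).lsubst s = .zero := by
  obtain ⟨s, rfl⟩ := s.mk_surjective; rfl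

@[simp] theorem QL.add_lsubst {σ' σ ρ : LTy} (t r : QL S Γ σ ρ) (s : QL S Γ σ' σ) :
    (QL.add t r).lsubst s = .add (t.lsubst s) (r.lsubst s) := by
  obtain ⟨s, rfl⟩ := s.mk_surjective; obtain ⟨t, rfl⟩ := t.mk_surjective
  obtain ⟨r, rfl⟩ := r.mk_surjective; rfl

@[simp] theorem QL.lsubst_lsubst {σ'' σ' σ ρ : LTy} (t : QL S Γ σ ρ) (s : QL S Γ σ' σ)
    (r : QL S Γ σ'' σ') : (t.lsubst s).lsubst r = t.lsubst (s.lsubst r) := by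
  obtain ⟨s, rfl⟩ := s.mk_surjective; obtain ⟨t, rfl⟩ := t.mk_surjective
  obtain ⟨r, rfl⟩ := r.mk_surjective
  exact congrArg QL.mk (LTm.lsubst_lsubst t s r)

@[simp] theorem QL.lsubst_var {σ ρ : LTy} (t : QL S Γ σ ρ) : t.lsubst .var = t := by
  obtain ⟨t, rfl⟩ := t.mk_surjective
  exact congrArg QL.mk (LTm.lsubst_var t)

@[simp] theorem QL.lsubst_zero {σ' σ ρ : LTy} (t : QL S Γ σ ρ) :
    t.lsubst (.zero : QL S Γ σ' σ) = .zero := by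
  obtain ⟨t, rfl⟩ := t.mk_surjective
  exact QL.mk_eq_iff.2 (.subst_zero t)

@[simp] theorem QL.lsubst_add {σ' σ ρ : LTy} (t : QL S Γ σ ρ) (s r : QL S Γ σ' σ) :
    t.lsubst (.add s r) = .add (t.lsubst s) (t.lsubst r) := by
  obtain ⟨s, rfl⟩ := s.mk_surjective; obtain ⟨t, rfl⟩ := t.mk_surjective
  obtain ⟨r, rfl⟩ := r.mk_surjective
  exact QL.mk_eq_iff.2 (.subst_add t s r)

/-! ### The laws of the theory -/

theorem QC.unit_eta (t : QC S Γ .unit) : t = .unit := by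
  obtain ⟨t, rfl⟩ := t.mk_surjective
  exact QC.mk_eq_iff.2 (.unit_eta t)

@[simp] theorem QC.fst_pair {τ₁ τ₂ : CTy} (t : QC S Γ τ₁) (s : QC S Γ τ₂) :
    (QC.pair t s).fst = t := by
  obtain ⟨t, rfl⟩ := t.mk_surjective; obtain ⟨s, rfl⟩ := s.mk_surjective
  exact QC.mk_eq_iff.2 (.fst_beta t s)

@[simp] theorem QC.snd_pair {τ₁ τ₂ : CTy} (t : QC S Γ τ₁) (s : QC S Γ τ₂) :
    (QC.pair t s).snd = s := by
  obtain ⟨t, rfl⟩ := t.mk_surjective; obtain ⟨s, rfl⟩ := s.mk_surjective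
  exact QC.mk_eq_iff.2 (.snd_beta t s)

@[simp] theorem QC.pair_fst_snd {τ₁ τ₂ : CTy} (t : QC S Γ (.prod τ₁ τ₂)) :
    QC.pair t.fst t.snd = t := by
  obtain ⟨t, rfl⟩ := t.mk_surjective
  exact (QC.mk_eq_iff.2 (.pair_eta t)).symm

@[simp] theorem QC.app_lam {τ₁ τ₂ : CTy} (t : QC S (τ₁ :: Γ) τ₂) (s : QC S Γ τ₁) :
    QC.app t.lam s = t.subst (cons s (QSub.id Γ)) := by
  obtain ⟨t, rfl⟩ := t.mk_surjective; obtain ⟨s, rfl⟩ := s.mk_surjective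
  refine (QC.mk_eq_iff.2 (.lam_beta t s)).trans (QC.mk_subst t _ _ fun _ x => ?_).symm
  cases x <;> rfl

theorem QC.lam_app {τ₁ τ₂ : CTy} (t : QC S Γ (.arrow τ₁ τ₂)) :
    (QC.app (t.subst (wk Γ τ₁)) (.var .zero)).lam = t := by
  obtain ⟨t, rfl⟩ := t.mk_surjective
  rw [QC.mk_wk]
  exact (QC.mk_eq_iff.2 (.lam_eta t)).symm

@[simp] theorem QC.llam_lapp {σ ρ : LTy} (t : QC S Γ (.lolli σ ρ)) :
    QC.llam (QL.lapp t .var) = t := by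
  obtain ⟨t, rfl⟩ := t.mk_surjective
  exact (QC.mk_eq_iff.2 (.llam_eta t)).symm

theorem QL.unit_eta {σ : LTy} (t : QL S Γ σ .unit) : t = .unit := by
  obtain ⟨t, rfl⟩ := t.mk_surjective
  exact QL.mk_eq_iff.2 (.unit_eta t)

@[simp] theorem QL.fst_pair {σ ρ₁ ρ₂ : LTy} (t : QL S Γ σ ρ₁) (s : QL S Γ σ ρ₂) :
    (QL.pair t s).fst = t := by
  obtain ⟨t, rfl⟩ := t.mk_surjective; obtain ⟨s, rfl⟩ := s.mk_surjective
  exact QL.mk_eq_iff.2 (.fst_beta t s)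

@[simp] theorem QL.snd_pair {σ ρ₁ ρ₂ : LTy} (t : QL S Γ σ ρ₁) (s : QL S Γ σ ρ₂) :
    (QL.pair t s).snd = s := by
  obtain ⟨t, rfl⟩ := t.mk_surjective; obtain ⟨s, rfl⟩ := s.mk_surjective
  exact QL.mk_eq_iff.2 (.snd_beta t s)

@[simp] theorem QL.pair_fst_snd {σ ρ₁ ρ₂ : LTy} (t : QL S Γ σ (.prod ρ₁ ρ₂)) :
    QL.pair t.fst t.snd = t := by
  obtain ⟨t, rfl⟩ := t.mk_surjective
  exact (QL.mk_eq_iff.2 (.pair_eta t)).symm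

@[simp] theorem QL.app_lam {σ ρ : LTy} {τ : CTy} (t : QL S (τ :: Γ) σ ρ) (s : QC S Γ τ) :
    QL.app t.lam s = t.subst (cons s (QSub.id Γ)) := by
  obtain ⟨t, rfl⟩ := t.mk_surjective; obtain ⟨s, rfl⟩ := s.mk_surjective
  refine (QL.mk_eq_iff.2 (.lam_beta t s)).trans (QL.mk_subst t _ _ fun _ x => ?_).symm
  cases x <;> rfl

theorem QL.lam_app {σ ρ : LTy} {τ : CTy} (t : QL S Γ σ (.arrow τ ρ)) :
    (QL.app (t.subst (wk Γ τ)) (.var .zero)).lam = t := by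
  obtain ⟨t, rfl⟩ := t.mk_surjective
  rw [QL.mk_wk]
  exact (QL.mk_eq_iff.2 (.lam_eta t)).symm

@[simp] theorem QL.tmatch_tens {σ ρ ρ' : LTy} {τ : CTy} (t : QC S Γ τ) (s : QL S Γ σ ρ)
    (r : QL S (τ :: Γ) ρ ρ') :
    QL.tmatch (.tens t s) r = (r.subst (cons t (QSub.id Γ))).lsubst s := by
  obtain ⟨t, rfl⟩ := t.mk_surjective; obtain ⟨s, rfl⟩ := s.mk_surjective
  obtain ⟨r, rfl⟩ := r.mk_surjective
  rw [QL.mk_subst r _ (Sub.single t) fun _ x => by cases x <;> rfl]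
  exact QL.mk_eq_iff.2 (.tens_beta t s r)

/-- The η-axiom with the linear variable itself as scrutinee; general scrutinees then follow by
linear substitution. -/
theorem QL.tmatch_eta {ρ ρ' : LTy} {τ : CTy} (t : QL S Γ (.tensor τ ρ) ρ') :
    QL.tmatch .var ((t.subst (wk Γ τ)).lsubst (.tens (.var .zero) .var)) = t := by
  obtain ⟨t, rfl⟩ := t.mk_surjective
  rw [QL.mk_wk]
  refine (QL.mk_eq_iff.2 (.tens_eta t .var)).symm.trans ?_
  rw [LTm.lsubst_var]

@[simp] theorem QL.lapp_llam {σ ρ ρ' : LTy} (t : QL S Γ ρ ρ') (s : QL S Γ σ ρ) :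
    QL.lapp (.llam t) s = t.lsubst s := by
  obtain ⟨t, rfl⟩ := t.mk_surjective; obtain ⟨s, rfl⟩ := s.mk_surjective
  exact QL.mk_eq_iff.2 (.llam_beta t s)

@[simp] theorem QL.add_zero {σ ρ : LTy} (t : QL S Γ σ ρ) : QL.add t .zero = t := by
  obtain ⟨t, rfl⟩ := t.mk_surjective
  exact QL.mk_eq_iff.2 (.add_zero t)

@[simp] theorem QL.zero_add {σ ρ : LTy} (t : QL S Γ σ ρ) : QL.add .zero t = t := by
  obtain ⟨t, rfl⟩ := t.mk_surjective
  exact QL.mk_eq_iff.2 (.zero_add t)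

/-- Additivity of linear substitution, applied to the term `fst x`. -/
theorem QL.fst_add {σ ρ₁ ρ₂ : LTy} (t s : QL S Γ σ (.prod ρ₁ ρ₂)) :
    (QL.add t s).fst = .add t.fst s.fst := by
  have h := QL.lsubst_add (QL.var : QL S Γ (.prod ρ₁ ρ₂) _).fst t s
  simpa only [QL.fst_lsubst, QL.snd_lsubst, QL.var_lsubst] using h

theorem QL.snd_add {σ ρ₁ ρ₂ : LTy} (t s : QL S Γ σ (.prod ρ₁ ρ₂)) :
    (QL.add t s).snd = .add t.snd s.snd := by
  have h := QL.lsubst_add (QL.var : QL S Γ (.prod ρ₁ ρ₂) _).snd t s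
  simpa only [QL.fst_lsubst, QL.snd_lsubst, QL.var_lsubst] using h

theorem QL.pair_add_pair {σ ρ₁ ρ₂ : LTy} (t t' : QL S Γ σ ρ₁) (s s' : QL S Γ σ ρ₂) :
    QL.add (.pair t s) (.pair t' s') = .pair (.add t t') (.add s s') := by
  rw [← QL.pair_fst_snd (QL.add _ _), QL.fst_add, QL.snd_add]
  simp

@[simp] theorem QSub.id_one {τ : CTy} :
    (QSub.id [τ] : QSub S _ _) = cons (.var .zero) (nil _) := by
  rw [QSub.eq_cons (QSub.id [τ])]; congr 1; exact QSub.eq_nil _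

end Calculus

open QSub

/-! ## The syntactic Cartesian closed category -/

namespace QC

/-- Substitution of a term for the only variable. -/
noncomputable abbrev substOne {Γ : Ctx} {A B : CTy} (g : QC S [A] B) (f : QC S Γ A) : QC S Γ B :=
  g.subst (cons f (nil Γ))

theorem at_at {A B D E : CTy} (h : QC S [D] E) (g : QC S [B] D) (f : QC S [A] B) :
    substOne (substOne h g) f = substOne h (substOne g f) := by simp

theorem fst_at_pair {T A B : CTy} (f : QC S [T] A) (g : QC S [T] B) :
    substOne (fst (var .zero)) (pair f g) = f := by simp

theorem snd_at_pair {T A B : CTy} (f : QC S [T] A) (g : QC S [T] B) :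
    substOne (snd (var .zero)) (pair f g) = g := by simp

theorem pair_at_fst_snd {T A B : CTy} (m : QC S [T] (.prod A B)) :
    m = pair (substOne (fst (var .zero)) m) (substOne (snd (var .zero)) m) := by simp

/-- Currying of terms. -/
noncomputable def curryEquiv (A X Y : CTy) : QC S [.prod A X] Y ≃ QC S [X] (.arrow A Y) where
  toFun f := lam (substOne f (pair (var .zero) (var (.succ .zero))))
  invFun g := app (substOne g (snd (var .zero))) (fst (var .zero))
  left_inv f := by simp
  right_inv g := by simpa using QC.lam_app g

theorem curryEquiv_at {A X X' Y : CTy} (f : QC S [X'] X) (g : QC S [.prod A X] Y) :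
    curryEquiv A X' Y
        (substOne g (pair (substOne (var .zero) (fst (var .zero))) (substOne f (snd (var .zero))))) =
      substOne (curryEquiv A X Y g) f := by
  simp [curryEquiv]

/-- The universal property of evaluation, with every composite written as a substitution: evaluation
is the uncurried identity. It serves to recognise the abstract `curry` of the closed structure in
`SynC.curry_def`. -/
theorem ev_at_curryEquiv {A X Y : CTy} (f : QC S [.prod A X] Y) :
    f = substOne ((curryEquiv A (.arrow A Y) Y).symm (var .zero))
      (pair (substOne (var .zero) (fst (var .zero)))
        (substOne (curryEquiv A X Y f) (snd (var .zero)))) := by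
  simp [curryEquiv]

end QC

/-- The objects of the syntactic category: the Cartesian types. -/
def SynC (_ : Signature.{u}) : Type := CTy

/-- A Cartesian type as an object of the syntactic category. -/
def SynC.of (τ : CTy) : SynC S := τ

namespace SynC

/-- Objects are single types rather than contexts, so that the interpretation of types can be a
bijection onto objects. A context is represented by the product of its types. -/
noncomputable instance : Category.{u} (SynC S) where
  Hom A B := QC S [A] B
  id _ := QC.var .zero
  comp f g := QC.substOne g f
  id_comp f := QC.subst_cons_nil f
  comp_id _ := QC.var_subst _ _
  assoc f g h := (QC.at_at h g f).symm

open Limits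

/-- The unit type is terminal. -/
noncomputable def terminalCone : LimitCone (Functor.empty.{0} (SynC S)) where
  cone := asEmptyCone (SynC.of .unit)
  isLimit := IsTerminal.ofUniqueHom (fun A => (QC.unit : QC S [A] .unit))
    fun _ m => QC.unit_eta m

/-- Product types are products. -/
noncomputable def prodCone (A B : SynC S) : LimitCone (Limits.pair A B) where
  cone := BinaryFan.mk (P := SynC.of (S := S) (.prod A B))
    (QC.fst (QC.var .zero) : QC S [.prod A B] A) (QC.snd (QC.var .zero) : QC S [.prod A B] B)
  isLimit := BinaryFan.IsLimit.mk _ (fun {T} f g => (QC.pair f g : QC S [T] (.prod A B)))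
    (fun {T} f g => QC.fst_at_pair (T := T) f g)
    (fun {T} f g => QC.snd_at_pair (T := T) f g)
    (fun {T} f g m hf hg => by
      subst hf hg
      exact QC.pair_at_fst_snd (T := T) m)

noncomputable instance : CartesianMonoidalCategory (SynC S) :=
  .ofChosenFiniteProducts terminalCone prodCone

noncomputable instance : MonoidalClosed (SynC S) where
  closed A :=
    { rightAdj := Adjunction.rightAdjointOfEquiv (F := tensorLeft A)
        (G_obj := fun B => SynC.of (.arrow A B)) (fun X Y => QC.curryEquiv A X Y)
        fun X' X _ f g => QC.curryEquiv_at (X := X) (X' := X') f g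
      adj := Adjunction.adjunctionOfEquivRight _ _ }

/-- Currying in the closed structure comes from an adjunction; it is identified through its
uncurrying, which determines it. -/
theorem curry_def {A B X : SynC S} (f : A ⊗ X ⟶ B) :
    MonoidalClosed.curry f = QC.curryEquiv A X B f := by
  let g : X ⟶ (ihom A).obj B := QC.curryEquiv A X B f
  exact (MonoidalClosed.curry_eq_iff f g).2
    (Eq.trans (QC.ev_at_curryEquiv (X := X) f) (MonoidalClosed.uncurry_eq g).symm)

end SynC

/-! ## The syntactic locally indexed category -/

namespace QL

/-- Substitution of a Cartesian term for the only Cartesian variable. -/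
noncomputable abbrev substOne {Γ : Ctx} {A : CTy} {σ ρ : LTy} (g : QL S [A] σ ρ) (f : QC S Γ A) :
    QL S Γ σ ρ :=
  g.subst (cons f (nil Γ))

theorem at_at {A B D : CTy} {σ ρ : LTy} (h : QL S [D] σ ρ) (g : QC S [B] D) (f : QC S [A] B) :
    substOne (substOne h g) f = substOne h (QC.substOne g f) := by simp

/-- The linear variable has unit type, hence equals `zero` by η, and substituting `zero` into any
linear term gives `zero`. -/
theorem fromUnit_eta {A : CTy} {ρ : LTy} (t : QL S [A] .unit ρ) : t = .zero := by
  rw [← lsubst_var t, unit_eta var, ← unit_eta zero, lsubst_zero]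

/-- The morphism out of a biproduct with given components. -/
def copair {A : CTy} {σ₁ σ₂ ρ : LTy} (t : QL S [A] σ₁ ρ) (s : QL S [A] σ₂ ρ) :
    QL S [A] (.prod σ₁ σ₂) ρ :=
  add (t.lsubst (fst var)) (s.lsubst (snd var))

/-- The linear variable decomposes as `⟨x.1, 0⟩ + ⟨0, x.2⟩`, and `t` is additive in it. -/
theorem copair_eta {A : CTy} {σ₁ σ₂ ρ : LTy} (t : QL S [A] (.prod σ₁ σ₂) ρ) :
    t = copair (t.lsubst (pair var zero)) (t.lsubst (pair zero var)) := by
  simp [copair, ← lsubst_add, pair_add_pair]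

theorem pair_zero_copair {A : CTy} {σ₁ σ₂ ρ : LTy} (t : QL S [A] σ₁ ρ) (s : QL S [A] σ₂ ρ) :
    (copair t s).lsubst (pair var zero) = t := by
  simp [copair]

theorem zero_pair_copair {A : CTy} {σ₁ σ₂ ρ : LTy} (t : QL S [A] σ₁ ρ) (s : QL S [A] σ₂ ρ) :
    (copair t s).lsubst (pair zero var) = s := by
  simp [copair]

theorem fst_var_lsubst_pair {A : CTy} {σ ρ₁ ρ₂ : LTy} (t : QL S [A] σ ρ₁) (s : QL S [A] σ ρ₂) :
    (fst var).lsubst (pair t s) = t := by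
  simp

theorem snd_var_lsubst_pair {A : CTy} {σ ρ₁ ρ₂ : LTy} (t : QL S [A] σ ρ₁) (s : QL S [A] σ ρ₂) :
    (snd var).lsubst (pair t s) = s := by
  simp

theorem pair_eta {A : CTy} {σ ρ₁ ρ₂ : LTy} (t : QL S [A] σ (.prod ρ₁ ρ₂)) :
    t = pair ((fst var).lsubst t) ((snd var).lsubst t) := by
  simp

/-- Terms out of a tensor type as terms with one more Cartesian variable. -/
noncomputable def tensorEquiv (A B : CTy) (σ ρ : LTy) :
    QL S [A] (.tensor B σ) ρ ≃ QL S [.prod A B] σ ρ where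
  toFun t := (substOne t (.fst (.var .zero))).lsubst (tens (.snd (.var .zero)) var)
  invFun s := tmatch var (substOne s (.pair (.var (.succ .zero)) (.var .zero)))
  left_inv t := by simpa using tmatch_eta t
  right_inv s := by simp

theorem tensorEquiv_lsubst {A B : CTy} {σ ρ ρ' : LTy} (t : QL S [A] (.tensor B σ) ρ)
    (s : QL S [A] ρ ρ') :
    tensorEquiv A B σ ρ' (s.lsubst t) =
      (substOne s (.fst (.var .zero))).lsubst (tensorEquiv A B σ ρ t) := by
  simp [tensorEquiv]

theorem tensorEquiv_at {A A' B : CTy} {σ ρ : LTy} (t : QL S [A] (.tensor B σ) ρ) (f : QC S [A'] A) :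
    tensorEquiv A' B σ ρ (substOne t f) = substOne (tensorEquiv A B σ ρ t)
      (.pair (.substOne f (.fst (.var .zero))) (.substOne (.var .zero) (.snd (.var .zero)))) := by
  simp [tensorEquiv]

/-- Terms with one more Cartesian variable as terms into a function type. -/
noncomputable def arrowEquiv (A B : CTy) (σ ρ : LTy) :
    QL S [.prod A B] σ ρ ≃ QL S [A] σ (.arrow B ρ) where
  toFun s := lam (substOne s (.pair (.var (.succ .zero)) (.var .zero)))
  invFun t := app (substOne t (.fst (.var .zero))) (.snd (.var .zero))
  left_inv s := by simp
  right_inv t := by simpa using lam_app t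

theorem arrowEquiv_lsubst {A B : CTy} {σ σ' ρ : LTy} (t : QL S [A] σ' σ)
    (s : QL S [.prod A B] σ ρ) :
    arrowEquiv A B σ' ρ (s.lsubst (substOne t (.fst (.var .zero)))) =
      (arrowEquiv A B σ ρ s).lsubst t := by
  simp [arrowEquiv]

theorem arrowEquiv_at {A A' B : CTy} {σ ρ : LTy} (f : QC S [A'] A) (s : QL S [.prod A B] σ ρ) :
    arrowEquiv A' B σ ρ (substOne s
      (.pair (.substOne f (.fst (.var .zero))) (.substOne (.var .zero) (.snd (.var .zero))))) =
      substOne (arrowEquiv A B σ ρ s) f := by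
  simp [arrowEquiv]

/-- Linear terms as Cartesian terms of a linear function type. -/
def lolliEquiv (A : CTy) (σ ρ : LTy) : QL S [A] σ ρ ≃ QC S [A] (.lolli σ ρ) where
  toFun := QC.llam
  invFun t := lapp t var
  left_inv t := by simp
  right_inv t := by simp

end QL

/-- The syntactic locally indexed category. -/
noncomputable def synL (S : Signature.{u}) : LocallyIndexedCategory.{u, 0} (SynC S) where
  Obj := LTy
  Hom A σ ρ := QL S [A] σ ρ
  id _ _ := QL.var
  comp f g := QL.lsubst g f
  id_comp f := QL.lsubst_var f
  comp_id f := QL.var_lsubst f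
  assoc f g h := (QL.lsubst_lsubst h g f).symm
  map a _ _ f := QL.substOne f a
  map_id _ _ := QL.var_subst _
  map_comp _ _ _ _ f g := QL.lsubst_subst g f _
  id_map f := QL.subst_cons_nil f
  comp_map b a _ _ f := (QL.at_at f a b).symm

/-- Its biproducts. -/
noncomputable def synBiadditive (S : Signature.{u}) : Biadditive (synL S) where
  unit := .unit
  toUnit _ _ := QL.unit
  toUnit_unique f := QL.unit_eta f
  fromUnit _ _ := QL.zero
  fromUnit_unique f := QL.fromUnit_eta f
  prod := .prod
  fst _ _ _ := QL.fst .var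
  snd _ _ _ := QL.snd .var
  pair f g := QL.pair f g
  pair_fst f g := QL.fst_var_lsubst_pair f g
  pair_snd f g := QL.snd_var_lsubst_pair f g
  pair_unique h := QL.pair_eta h
  inl _ _ _ := QL.pair .var .zero
  inr _ _ _ := QL.pair .zero .var
  copair f g := QL.copair f g
  inl_copair f g := QL.pair_zero_copair f g
  inr_copair f g := QL.zero_pair_copair f g
  copair_unique h := QL.copair_eta h
  inl_fst A σ ρ := QL.fst_var_lsubst_pair (A := A) (.var : QL S [A] σ σ) (.zero : QL S [A] σ ρ)
  inl_snd A σ ρ :=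
    (QL.snd_var_lsubst_pair (A := A) (.var : QL S [A] σ σ) (.zero : QL S [A] σ ρ)).trans
    (QL.zero_lsubst (Γ := [A]) (.unit : QL S [A] σ .unit)).symm
  inr_fst A σ ρ :=
    (QL.fst_var_lsubst_pair (A := A) (.zero : QL S [A] ρ σ) (.var : QL S [A] ρ ρ)).trans
    (QL.zero_lsubst (Γ := [A]) (.unit : QL S [A] ρ .unit)).symm
  inr_snd A σ ρ := QL.snd_var_lsubst_pair (A := A) (.zero : QL S [A] ρ σ) (.var : QL S [A] ρ ρ)
  map_fst {A A'} a σ ρ := QL.fst_subst (Γ := [A]) (Δ := [A'])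
    (.var : QL S [A] (.prod σ ρ) _) (cons a (nil _))
  map_snd {A A'} a σ ρ := QL.snd_subst (Γ := [A]) (Δ := [A'])
    (.var : QL S [A] (.prod σ ρ) _) (cons a (nil _))
  map_inl {A A'} a σ ρ := QL.pair_subst (Γ := [A]) (Δ := [A'])
    (.var : QL S [A] σ σ) (.zero : QL S [A] σ ρ) (cons a (nil _))
  map_inr {A A'} a σ ρ := QL.pair_subst (Γ := [A]) (Δ := [A'])
    (.zero : QL S [A] ρ σ) (.var : QL S [A] ρ ρ) (cons a (nil _))

/-- Its tensor types. -/
noncomputable def synTensorTypes (S : Signature.{u}) : TensorTypes (synL S) where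
  tensor A σ := .tensor A σ
  Φ A B σ ρ := QL.tensorEquiv A B σ ρ
  Φ_comp {A B _ _ _} f g := QL.tensorEquiv_lsubst (A := A) (B := B) f g
  Φ_map {A A' B} a _ _ f := QL.tensorEquiv_at (A := A) (A' := A') (B := B) f a

/-- Its function types. -/
noncomputable def synArrowTypes (S : Signature.{u}) : ArrowTypes (synL S) where
  arrow A σ := .arrow A σ
  Ψ A B σ ρ := QL.arrowEquiv A B σ ρ
  Ψ_comp {A B _ _ _} g f := QL.arrowEquiv_lsubst (A := A) (B := B) g f
  Ψ_map {A A' B} a _ _ f := QL.arrowEquiv_at (A := A) (A' := A') (B := B) a f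

/-- Its linear function types. -/
noncomputable def synLolliTypes (S : Signature.{u}) : LolliTypes (synL S) where
  lolli σ ρ := SynC.of (.lolli σ ρ)
  Λ A σ ρ := QL.lolliEquiv A σ ρ
  Λ_map {A A'} _ _ _ f := (QC.llam_subst (Γ := [A]) (Δ := [A']) f _).symm

/-- The term model. -/
noncomputable def synModel (S : Signature.{u}) : CategoricalModel.{u, 0} where
  C := SynC S
  L := synL S
  biadditive := synBiadditive S
  tensorTypes := synTensorTypes S
  arrowTypes := synArrowTypes S
  lolliTypes := synLolliTypes S

/-! ## The interpretation in the term model -/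

-- True only by induction on types, not by computation; hence the casts in `synInterp` and the
-- heterogeneous equalities that follow.
mutual
theorem CTy.interp_syn (S : Signature.{u}) : ∀ τ : CTy,
    @Eq CTy (τ.interp (synModel S) (fun n => SynC.of (S := S) (.real n)) fun n => LTy.real n) τ
  | .real _ => rfl
  | .unit => rfl
  | .prod τ₁ τ₂ => congrArg₂ CTy.prod (CTy.interp_syn S τ₁) (CTy.interp_syn S τ₂)
  | .arrow τ₁ τ₂ => congrArg₂ CTy.arrow (CTy.interp_syn S τ₁) (CTy.interp_syn S τ₂)
  | .lolli σ ρ => congrArg₂ CTy.lolli (LTy.interp_syn S σ) (LTy.interp_syn S ρ)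
theorem LTy.interp_syn (S : Signature.{u}) : ∀ σ : LTy,
    @Eq LTy (σ.interp (synModel S) (fun n => SynC.of (S := S) (.real n)) fun n => LTy.real n) σ
  | .real _ => rfl
  | .unit => rfl
  | .prod σ ρ => congrArg₂ LTy.prod (LTy.interp_syn S σ) (LTy.interp_syn S ρ)
  | .arrow τ ρ => congrArg₂ LTy.arrow (CTy.interp_syn S τ) (LTy.interp_syn S ρ)
  | .tensor τ ρ => congrArg₂ LTy.tensor (CTy.interp_syn S τ) (LTy.interp_syn S ρ)
end

/-- The interpretation of the language in its term model. -/
noncomputable def synInterp (S : Signature.{u}) : Interpretation S (synModel S) where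
  real n := SynC.of (.real n)
  lreal n := LTy.real n
  -- An operation is interpreted by itself applied to the only variable. The cast is needed because
  -- `CTy.reals ns` does not reduce for a variable list `ns`.
  op {ns m} o := cast
    (congrArg₂ (fun A B : CTy => QC S [A] B) (CTy.interp_syn S (CTy.reals ns)).symm
      (CTy.interp_syn S (.real m)).symm)
    (QC.op o (.var .zero))
  lop {ns ms m} o := cast
    ((congrArg₂ (fun (A : CTy) (σ : LTy) => QL S [A] σ (.real m))
      (CTy.interp_syn S (CTy.reals ns)).symm (LTy.interp_syn S (LTy.reals ms)).symm))
    (QL.lop o (.var .zero) .var)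

theorem synInterp_op {ns : List ℕ} {m : ℕ} (o : S.Op ns m) :
    (synInterp S).op o ≍ QC.op o (.var .zero : QC S [CTy.reals ns] _) :=
  cast_heq _ _

theorem synInterp_lop {ns ms : List ℕ} {m : ℕ} (o : S.LOp ns ms m) :
    (synInterp S).lop o ≍ QL.lop o (.var .zero : QC S [CTy.reals ns] _) .var :=
  cast_heq _ _

-- Contexts as products: projections and tuples.

/-- The product of the types in a context. -/
def Ctx.toTy : Ctx → CTy
  | [] => .unit
  | τ :: Γ => .prod (Ctx.toTy Γ) τ

theorem cty_syn (S : Signature.{u}) (τ : CTy) : (synInterp S).cty τ = τ := CTy.interp_syn S τ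

theorem lty_syn (S : Signature.{u}) (σ : LTy) : (synInterp S).lty σ = σ := LTy.interp_syn S σ

theorem ctx_syn (S : Signature.{u}) : ∀ Γ : Ctx, (synInterp S).ctx Γ = Ctx.toTy Γ
  | [] => rfl
  | τ :: Γ => congrArg₂ CTy.prod (ctx_syn S Γ) (cty_syn S τ)

/-- The projections from a product of types, given those from its first component. -/
noncomputable def QSub.projCons {Γ : Ctx} {G : CTy} (p : QSub S Γ [G]) (A : CTy) :
    QSub S (A :: Γ) [.prod G A] :=
  cons (.snd (.var .zero)) (p.comp (cons (.fst (.var .zero)) (nil _)))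

/-- The variables of a context as projections from the product of its types. -/
noncomputable def QSub.proj : ∀ Γ : Ctx, QSub S Γ [Ctx.toTy Γ]
  | [] => nil _
  | τ :: Γ => (QSub.proj Γ).projCons τ

/-- The tuple of the variables of a context. -/
noncomputable def QC.tuple : ∀ Γ : Ctx, QC S Γ (Ctx.toTy Γ)
  | [] => .unit
  | τ :: Γ => .pair ((QC.tuple Γ).subst (wk Γ τ)) (.var .zero)

/-- The weakening cancels the new variable, so the first entry becomes `q` after `p` at the first
projection, that is, the first projection itself; surjective pairing concludes. -/
theorem QC.pair_subst_projCons {Γ : Ctx} {G : CTy} {p : QSub S Γ [G]} {q : QC S Γ G}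
    (h : q.subst p = .var .zero) (A : CTy) :
    (QC.pair (q.subst (wk Γ A)) (.var .zero)).subst (p.projCons A) = .var .zero := by
  rw [QC.pair_subst, QSub.projCons, QC.subst_subst, QSub.wk_comp_cons, ← QC.subst_subst, h]
  simp

theorem QC.tuple_subst_proj : ∀ Γ : Ctx, (QC.tuple Γ).subst (QSub.proj (S := S) Γ) = .var .zero
  | [] => (QC.unit_eta _).symm
  | τ :: Γ => QC.pair_subst_projCons (QC.tuple_subst_proj Γ) τ

theorem QSub.projCons_comp_pair {Γ : Ctx} {G : CTy} {p : QSub S Γ [G]} {q : QC S Γ G}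
    (h : p.comp (cons q (nil _)) = QSub.id Γ) (A : CTy) :
    (p.projCons A).comp (cons (.pair (q.subst (wk Γ A)) (.var .zero)) (nil _)) =
      QSub.id (A :: Γ) := by
  have e : cons (q.subst (wk Γ A)) (nil (A :: Γ)) = (cons q (nil Γ)).comp (wk Γ A) := by simp
  have e' : (QSub.id (A :: Γ) : QSub S _ _) = cons (.var .zero) ((QSub.id Γ).comp (wk Γ A)) := by
    rw [QSub.eq_cons (QSub.id (A :: Γ))]
    congr 1
    funext _ x
    exact (QC.var_subst _ _).symm
  -- On the old variables both sides are `p` followed by the weakened tuple: `e` moves the weakening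
  -- outside the tuple, and `e'` with `h` gives the identity the same shape.
  rw [e', ← h, QSub.projCons, QSub.cons_comp, QSub.comp_assoc, QSub.comp_assoc, ← e]
  simp

theorem QSub.proj_comp_tuple : ∀ Γ : Ctx,
    (QSub.proj (S := S) Γ).comp (cons (QC.tuple Γ) (nil _)) = QSub.id Γ
  | [] => (QSub.eq_nil _).trans (QSub.eq_nil _).symm
  | τ :: Γ => QSub.projCons_comp_pair (QSub.proj_comp_tuple Γ) τ

/-! ### The operations of the term model -/

namespace QC

/-- Abstraction over the second component of the variable. -/
noncomputable def lamLast {G A B : CTy} (t : QC S [.prod G A] B) : QC S [G] (.arrow A B) :=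
  lam (substOne t (pair (var (.succ .zero)) (var .zero)))

/-- `curryEquiv` abstracts over the first factor while contexts grow on the right; the swap in the
interpretation of λ compensates for this. -/
theorem curryEquiv_swap {G A B : CTy} (t : QC S [.prod G A] B) :
    curryEquiv A G B (substOne t (pair (snd (var .zero)) (fst (var .zero)))) = lamLast t := by
  simp [curryEquiv, lamLast]

theorem ev_at_pair {G A B : CTy} (t : QC S [G] (.arrow A B)) (s : QC S [G] A) :
    substOne ((curryEquiv A (.arrow A B) B).symm (var .zero)) (pair s t) = app t s := by
  simp [curryEquiv]

/-- The binder case of `synInterp_tm`: under `p.projCons A` the bound variable is the second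
projection, which is the component that `lamLast` abstracts. -/
theorem lamLast_subst_projCons {Γ : Ctx} {G : CTy} {A B : CTy} (t : QC S (A :: Γ) B)
    (p : QSub S Γ [G]) : lamLast (t.subst (p.projCons A)) = (lam t).subst p := by
  simp [lamLast, QSub.projCons, QSub.comp_assoc, QSub.lift]

end QC

namespace QL

/-- Abstraction over the second component of the Cartesian variable. -/
noncomputable def lamLast {G A : CTy} {σ ρ : LTy} (t : QL S [.prod G A] σ ρ) :
    QL S [G] σ (.arrow A ρ) :=
  lam (substOne t (.pair (.var (.succ .zero)) (.var .zero)))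

/-- Matching that binds the second component of the Cartesian variable. -/
noncomputable def matchLast {G A : CTy} {σ ρ ρ' : LTy} (t : QL S [G] σ (.tensor A ρ))
    (s : QL S [.prod G A] ρ ρ') : QL S [G] σ ρ' :=
  tmatch t (substOne s (.pair (.var (.succ .zero)) (.var .zero)))

theorem arrowEquiv_symm_at {G A : CTy} {σ ρ : LTy} (t : QL S [G] σ (.arrow A ρ)) (s : QC S [G] A) :
    substOne ((arrowEquiv G A σ ρ).symm t) (.pair (.var .zero) s) = app t s := by
  simp [arrowEquiv]

theorem tensorEquiv_var_at {G A : CTy} {σ ρ : LTy} (t : QC S [G] A) (s : QL S [G] σ ρ) :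
    (substOne (tensorEquiv G A ρ (.tensor A ρ) var) (.pair (.var .zero) t)).lsubst s =
      tens t s := by
  simp [tensorEquiv]

theorem tensorEquiv_symm_lsubst {G A : CTy} {σ ρ ρ' : LTy} (t : QL S [G] σ (.tensor A ρ))
    (s : QL S [.prod G A] ρ ρ') :
    ((tensorEquiv G A ρ ρ').symm s).lsubst t = matchLast t s := by
  simp [tensorEquiv, matchLast]

theorem lolliEquiv_symm_lsubst {G : CTy} {σ ρ ρ' : LTy} (t : QC S [G] (.lolli ρ ρ'))
    (s : QL S [G] σ ρ) : ((lolliEquiv G ρ ρ').symm t).lsubst s = lapp t s := by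
  simp [lolliEquiv]

theorem copair_lsubst_diag {G : CTy} {σ ρ : LTy} (t s : QL S [G] σ ρ) :
    (copair t s).lsubst (pair var var) = add t s := by
  simp [copair]

theorem fst_var_lsubst {G : CTy} {σ ρ₁ ρ₂ : LTy} (t : QL S [G] σ (.prod ρ₁ ρ₂)) :
    (fst var).lsubst t = fst t := by simp

theorem snd_var_lsubst {G : CTy} {σ ρ₁ ρ₂ : LTy} (t : QL S [G] σ (.prod ρ₁ ρ₂)) :
    (snd var).lsubst t = snd t := by simp

theorem lamLast_subst_projCons {Γ : Ctx} {G : CTy} {A : CTy} {σ ρ : LTy} (t : QL S (A :: Γ) σ ρ)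
    (p : QSub S Γ [G]) : lamLast (t.subst (p.projCons A)) = (lam t).subst p := by
  simp [lamLast, QSub.projCons, QSub.comp_assoc, QSub.lift]

theorem matchLast_subst_projCons {Γ : Ctx} {G A : CTy} {σ ρ ρ' : LTy}
    (t : QL S Γ σ (.tensor A ρ)) (s : QL S (A :: Γ) ρ ρ') (p : QSub S Γ [G]) :
    matchLast (t.subst p) (s.subst (p.projCons A)) = (tmatch t s).subst p := by
  simp [matchLast, QSub.projCons, QSub.comp_assoc, QSub.lift]

end QL

/-! ### The interpretation of terms in the term model -/

section Heq

variable {G G' A A' B B' : CTy} {σ σ' ρ ρ' θ θ' : LTy}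

/-- The constructors respect heterogeneous equality along equalities of types. This transports them
between an interpreted type and the type itself. -/
theorem QC.at_heq (hG : G = G') (hA : A = A') (hB : B = B') {f : QC S [A] B} {f' : QC S [A'] B'}
    {g : QC S [G] A} {g' : QC S [G'] A'} (hf : f ≍ f') (hg : g ≍ g') :
    substOne f g ≍ substOne f' g' := by
  subst hG hA hB; cases hf; cases hg; rfl

theorem QC.fst_heq (hG : G = G') (hA : A = A') (hB : B = B') {f : QC S [G] (.prod A B)}
    {f' : QC S [G'] (.prod A' B')} (hf : f ≍ f') : fst f ≍ fst f' := by
  subst hG hA hB; cases hf; rfl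

theorem QC.snd_heq (hG : G = G') (hA : A = A') (hB : B = B') {f : QC S [G] (.prod A B)}
    {f' : QC S [G'] (.prod A' B')} (hf : f ≍ f') : snd f ≍ snd f' := by
  subst hG hA hB; cases hf; rfl

theorem QC.pair_heq (hG : G = G') (hA : A = A') (hB : B = B') {f : QC S [G] A} {f' : QC S [G'] A'}
    {g : QC S [G] B} {g' : QC S [G'] B'} (hf : f ≍ f') (hg : g ≍ g') : pair f g ≍ pair f' g' := by
  subst hG hA hB; cases hf; cases hg; rfl

theorem QC.unit_heq (hG : G = G') : (unit : QC S [G] _) ≍ (unit : QC S [G'] _) := by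
  subst hG; rfl

theorem QC.var_heq (hG : G = G') : (var .zero : QC S [G] G) ≍ (var .zero : QC S [G'] G') := by
  subst hG; rfl

theorem QC.lamLast_heq (hG : G = G') (hA : A = A') (hB : B = B') {f : QC S [.prod G A] B}
    {f' : QC S [.prod G' A'] B'} (hf : f ≍ f') : lamLast f ≍ lamLast f' := by
  subst hG hA hB; cases hf; rfl

theorem QC.app_heq (hG : G = G') (hA : A = A') (hB : B = B') {f : QC S [G] (.arrow A B)}
    {f' : QC S [G'] (.arrow A' B')} {g : QC S [G] A} {g' : QC S [G'] A'} (hf : f ≍ f')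
    (hg : g ≍ g') : app f g ≍ app f' g' := by
  subst hG hA hB; cases hf; cases hg; rfl

theorem QC.llam_heq (hG : G = G') (hσ : σ = σ') (hρ : ρ = ρ') {f : QL S [G] σ ρ}
    {f' : QL S [G'] σ' ρ'} (hf : f ≍ f') : llam f ≍ llam f' := by
  subst hG hσ hρ; cases hf; rfl

theorem QL.var_heq (hG : G = G') (hσ : σ = σ') :
    (var : QL S [G] σ σ) ≍ (var : QL S [G'] σ' σ') := by
  subst hG hσ; rfl

theorem QL.at_heq (hG : G = G') (hA : A = A') (hσ : σ = σ') (hρ : ρ = ρ') {f : QL S [A] σ ρ}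
    {f' : QL S [A'] σ' ρ'} {g : QC S [G] A} {g' : QC S [G'] A'} (hf : f ≍ f') (hg : g ≍ g') :
    substOne f g ≍ substOne f' g' := by
  subst hG hA hσ hρ; cases hf; cases hg; rfl

theorem QL.lsubst_heq (hG : G = G') (hσ : σ = σ') (hρ : ρ = ρ') (hθ : θ = θ') {f : QL S [G] ρ θ}
    {f' : QL S [G'] ρ' θ'} {g : QL S [G] σ ρ} {g' : QL S [G'] σ' ρ'} (hf : f ≍ f') (hg : g ≍ g') :
    lsubst f g ≍ lsubst f' g' := by
  subst hG hσ hρ hθ; cases hf; cases hg; rfl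

theorem QL.unit_heq (hG : G = G') (hσ : σ = σ') :
    (unit : QL S [G] σ _) ≍ (unit : QL S [G'] σ' _) := by
  subst hG hσ; rfl

theorem QL.pair_heq (hG : G = G') (hσ : σ = σ') (hρ : ρ = ρ') (hθ : θ = θ') {f : QL S [G] σ ρ}
    {f' : QL S [G'] σ' ρ'} {g : QL S [G] σ θ} {g' : QL S [G'] σ' θ'} (hf : f ≍ f') (hg : g ≍ g') :
    pair f g ≍ pair f' g' := by
  subst hG hσ hρ hθ; cases hf; cases hg; rfl

theorem QL.fst_heq (hG : G = G') (hσ : σ = σ') (hρ : ρ = ρ') (hθ : θ = θ')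
    {f : QL S [G] σ (.prod ρ θ)} {f' : QL S [G'] σ' (.prod ρ' θ')} (hf : f ≍ f') :
    fst f ≍ fst f' := by
  subst hG hσ hρ hθ; cases hf; rfl

theorem QL.snd_heq (hG : G = G') (hσ : σ = σ') (hρ : ρ = ρ') (hθ : θ = θ')
    {f : QL S [G] σ (.prod ρ θ)} {f' : QL S [G'] σ' (.prod ρ' θ')} (hf : f ≍ f') :
    snd f ≍ snd f' := by
  subst hG hσ hρ hθ; cases hf; rfl

theorem QL.lamLast_heq (hG : G = G') (hA : A = A') (hσ : σ = σ') (hρ : ρ = ρ')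
    {f : QL S [.prod G A] σ ρ} {f' : QL S [.prod G' A'] σ' ρ'} (hf : f ≍ f') :
    lamLast f ≍ lamLast f' := by
  subst hG hA hσ hρ; cases hf; rfl

theorem QL.app_heq (hG : G = G') (hA : A = A') (hσ : σ = σ') (hρ : ρ = ρ')
    {f : QL S [G] σ (.arrow A ρ)} {f' : QL S [G'] σ' (.arrow A' ρ')} {g : QC S [G] A}
    {g' : QC S [G'] A'} (hf : f ≍ f') (hg : g ≍ g') : app f g ≍ app f' g' := by
  subst hG hA hσ hρ; cases hf; cases hg; rfl

theorem QL.tens_heq (hG : G = G') (hA : A = A') (hσ : σ = σ') (hρ : ρ = ρ') {f : QC S [G] A}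
    {f' : QC S [G'] A'} {g : QL S [G] σ ρ} {g' : QL S [G'] σ' ρ'} (hf : f ≍ f') (hg : g ≍ g') :
    tens f g ≍ tens f' g' := by
  subst hG hA hσ hρ; cases hf; cases hg; rfl

theorem QL.matchLast_heq (hG : G = G') (hA : A = A') (hσ : σ = σ') (hρ : ρ = ρ') (hθ : θ = θ')
    {f : QL S [G] σ (.tensor A ρ)} {f' : QL S [G'] σ' (.tensor A' ρ')} {g : QL S [.prod G A] ρ θ}
    {g' : QL S [.prod G' A'] ρ' θ'} (hf : f ≍ f') (hg : g ≍ g') :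
    matchLast f g ≍ matchLast f' g' := by
  subst hG hA hσ hρ hθ; cases hf; cases hg; rfl

theorem QL.lapp_heq (hG : G = G') (hσ : σ = σ') (hρ : ρ = ρ') (hθ : θ = θ')
    {f : QC S [G] (.lolli ρ θ)} {f' : QC S [G'] (.lolli ρ' θ')} {g : QL S [G] σ ρ}
    {g' : QL S [G'] σ' ρ'} (hf : f ≍ f') (hg : g ≍ g') : lapp f g ≍ lapp f' g' := by
  subst hG hσ hρ hθ; cases hf; cases hg; rfl

theorem QL.zero_heq (hG : G = G') (hσ : σ = σ') (hρ : ρ = ρ') :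
    (zero : QL S [G] σ ρ) ≍ (zero : QL S [G'] σ' ρ') := by
  subst hG hσ hρ; rfl

theorem QL.add_heq (hG : G = G') (hσ : σ = σ') (hρ : ρ = ρ') {f g : QL S [G] σ ρ}
    {f' g' : QL S [G'] σ' ρ'} (hf : f ≍ f') (hg : g ≍ g') : add f g ≍ add f' g' := by
  subst hG hσ hρ; cases hf; cases hg; rfl

end Heq

theorem synInterp_var : ∀ {Γ : Ctx} {τ : CTy} (x : Var Γ τ),
    (synInterp S).var x ≍ QSub.proj (S := S) Γ x
  | _, _, .zero (Γ := Γ) (τ := τ) =>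
    QC.snd_heq (S := S) (ctx_syn S (τ :: Γ)) (ctx_syn S Γ) (cty_syn S τ)
      (QC.var_heq (ctx_syn S (τ :: Γ)))
  | _, _, .succ (Γ := Γ) (τ := τ) (τ' := τ') x =>
    QC.at_heq (S := S) (ctx_syn S (τ' :: Γ)) (ctx_syn S Γ) (cty_syn S τ) (synInterp_var x)
      (QC.fst_heq (S := S) (ctx_syn S (τ' :: Γ)) (ctx_syn S Γ) (cty_syn S τ')
        (QC.var_heq (ctx_syn S (τ' :: Γ))))

/-- A term is interpreted in the term model by its own class, with its variables replaced by
projections. -/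
theorem synInterp_tm (S : Signature.{u}) :
    (∀ {Γ : Ctx} {τ : CTy} (t : CTm S Γ τ),
      (synInterp S).ctm t ≍ (QC.mk t).subst (QSub.proj Γ)) ∧
    (∀ {Γ : Ctx} {σ ρ : LTy} (t : LTm S Γ σ ρ),
      (synInterp S).ltm t ≍ (QL.mk t).subst (QSub.proj Γ)) := by
  have hC := cty_syn S
  have hL := lty_syn S
  have hX := ctx_syn S
  apply tm_induction
  · intro Γ τ x
    exact (synInterp_var x).trans (heq_of_eq (QC.var_subst x _).symm)
  · intro Γ ns m o t ih
    have h := QC.at_heq (S := S) (hX Γ) (hC _) (hC (.real m)) (synInterp_op o) ih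
    -- Composition with the interpreted operation is substitution into `op(x)`, so both sides become
    -- the operation applied to the same class.
    refine HEq.trans h (heq_of_eq ?_)
    exact (QC.op_subst o _ _).trans ((congrArg _ (QC.var_subst _ _)).trans
      (QC.op_subst o (QC.mk t) _).symm)
  · intro Γ
    exact QC.unit_heq (S := S) (hX Γ)
  · intro Γ τ₁ τ₂ t s ih ih'
    exact (QC.pair_heq (S := S) (hX Γ) (hC _) (hC _) ih ih').trans
      (heq_of_eq (QC.pair_subst (QC.mk t) (QC.mk s) _).symm)
  · intro Γ τ₁ τ₂ t ih
    -- As in most cases below, `e` identifies the model's operation with the term former. Congruence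
    -- along the type equalities and stability under substitution then finish.
    have e : (synInterp S).ctm t.fst = QC.fst ((synInterp S).ctm t) :=
      (QC.fst_subst _ _).trans (congrArg QC.fst (QC.var_subst _ _))
    exact (heq_of_eq e).trans ((QC.fst_heq (S := S) (hX Γ) (hC _) (hC _) ih).trans
      (heq_of_eq (QC.fst_subst (QC.mk t) _).symm))
  · intro Γ τ₁ τ₂ t ih
    have e : (synInterp S).ctm t.snd = QC.snd ((synInterp S).ctm t) :=
      (QC.snd_subst _ _).trans (congrArg QC.snd (QC.var_subst _ _))
    exact (heq_of_eq e).trans ((QC.snd_heq (S := S) (hX Γ) (hC _) (hC _) ih).trans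
      (heq_of_eq (QC.snd_subst (QC.mk t) _).symm))
  · intro Γ τ₁ τ₂ t ih
    have e : (synInterp S).ctm t.lam = QC.lamLast ((synInterp S).ctm t) :=
      (SynC.curry_def _).trans (QC.curryEquiv_swap _)
    exact (heq_of_eq e).trans ((QC.lamLast_heq (S := S) (hX Γ) (hC _) (hC _) ih).trans
      (heq_of_eq (QC.lamLast_subst_projCons (QC.mk t) _)))
  · intro Γ τ₁ τ₂ t s ih ih'
    have e : (synInterp S).ctm (t.app s) = QC.app ((synInterp S).ctm t) ((synInterp S).ctm s) :=
      QC.ev_at_pair _ _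
    exact (heq_of_eq e).trans ((QC.app_heq (S := S) (hX Γ) (hC _) (hC _) ih ih').trans
      (heq_of_eq (QC.app_subst (QC.mk t) (QC.mk s) _).symm))
  · intro Γ σ ρ t ih
    exact (QC.llam_heq (S := S) (hX Γ) (hL _) (hL _) ih).trans
      (heq_of_eq (QC.llam_subst (QL.mk t) _).symm)
  · intro Γ σ
    exact QL.var_heq (S := S) (hX Γ) (hL σ)
  · intro Γ σ ns ms m o t s ih ih'
    have h := QL.lsubst_heq (S := S) (hX Γ) (hL σ) (hL _) (hL (.real m))
      (QL.at_heq (S := S) (hX Γ) (hC _) (hL _) (hL (.real m)) (synInterp_lop o) ih) ih'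
    refine HEq.trans h (heq_of_eq ?_)
    refine Eq.trans ?_ (QL.lop_subst o (QC.mk t) (QL.mk s) _).symm
    simp
  · intro Γ σ
    exact QL.unit_heq (S := S) (hX Γ) (hL σ)
  · intro Γ σ ρ₁ ρ₂ t s ih ih'
    exact (QL.pair_heq (S := S) (hX Γ) (hL _) (hL _) (hL _) ih ih').trans
      (heq_of_eq (QL.pair_subst (QL.mk t) (QL.mk s) _).symm)
  · intro Γ σ ρ₁ ρ₂ t ih
    have e : (synInterp S).ltm t.fst = QL.fst ((synInterp S).ltm t) := QL.fst_var_lsubst _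
    exact (heq_of_eq e).trans ((QL.fst_heq (S := S) (hX Γ) (hL _) (hL _) (hL _) ih).trans
      (heq_of_eq (QL.fst_subst (QL.mk t) _).symm))
  · intro Γ σ ρ₁ ρ₂ t ih
    have e : (synInterp S).ltm t.snd = QL.snd ((synInterp S).ltm t) := QL.snd_var_lsubst _
    exact (heq_of_eq e).trans ((QL.snd_heq (S := S) (hX Γ) (hL _) (hL _) (hL _) ih).trans
      (heq_of_eq (QL.snd_subst (QL.mk t) _).symm))
  · intro Γ σ ρ τ t ih
    exact (QL.lamLast_heq (S := S) (hX Γ) (hC _) (hL _) (hL _) ih).trans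
      (heq_of_eq (QL.lamLast_subst_projCons (QL.mk t) _))
  · intro Γ σ ρ τ t s ih ih'
    have e : (synInterp S).ltm (t.app s) = QL.app ((synInterp S).ltm t) ((synInterp S).ctm s) :=
      QL.arrowEquiv_symm_at _ _
    exact (heq_of_eq e).trans ((QL.app_heq (S := S) (hX Γ) (hC _) (hL _) (hL _) ih ih').trans
      (heq_of_eq (QL.app_subst (QL.mk t) (QC.mk s) _).symm))
  · intro Γ σ ρ τ t s ih ih'
    have e : (synInterp S).ltm (.tens t s) = QL.tens ((synInterp S).ctm t) ((synInterp S).ltm s) :=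
      ((synInterp S).ltm_tens t s).trans (QL.tensorEquiv_var_at _ _)
    exact (heq_of_eq e).trans ((QL.tens_heq (S := S) (hX Γ) (hC _) (hL _) (hL _) ih ih').trans
      (heq_of_eq (QL.tens_subst (QC.mk t) (QL.mk s) _).symm))
  · intro Γ σ ρ ρ' τ t s ih ih'
    have e : (synInterp S).ltm (.tmatch t s) =
        QL.matchLast ((synInterp S).ltm t) ((synInterp S).ltm s) :=
      QL.tensorEquiv_symm_lsubst _ _
    exact (heq_of_eq e).trans ((QL.matchLast_heq (S := S) (hX Γ) (hC _) (hL _) (hL _) (hL _)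
      ih ih').trans (heq_of_eq (QL.matchLast_subst_projCons (QL.mk t) (QL.mk s) _)))
  · intro Γ σ ρ ρ' t s ih ih'
    have e : (synInterp S).ltm (.lapp t s) = QL.lapp ((synInterp S).ctm t) ((synInterp S).ltm s) :=
      QL.lolliEquiv_symm_lsubst _ _
    exact (heq_of_eq e).trans ((QL.lapp_heq (S := S) (hX Γ) (hL _) (hL _) (hL _) ih ih').trans
      (heq_of_eq (QL.lapp_subst (QC.mk t) (QL.mk s) _).symm))
  · intro Γ σ ρ
    have e : (synInterp S).ltm (.zero : LTm S Γ σ ρ) = QL.zero :=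
      QL.zero_lsubst (Γ := [(synInterp S).ctx Γ]) (.unit : QL S _ ((synInterp S).lty σ) .unit)
    exact (heq_of_eq e).trans (QL.zero_heq (S := S) (hX Γ) (hL σ) (hL ρ))
  · intro Γ σ ρ t s ih ih'
    have e : (synInterp S).ltm (.add t s) = QL.add ((synInterp S).ltm t) ((synInterp S).ltm s) :=
      QL.copair_lsubst_diag _ _
    exact (heq_of_eq e).trans ((QL.add_heq (S := S) (hX Γ) (hL _) (hL _) ih ih').trans
      (heq_of_eq (QL.add_subst (QL.mk t) (QL.mk s) _).symm))

-- Interpretation in the term model is bijective on classes.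

theorem QC.subst_proj_tuple {Γ : Ctx} {τ : CTy} (q : QC S Γ τ) :
    (q.subst (QSub.proj Γ)).subst (cons (QC.tuple Γ) (nil Γ)) = q := by
  rw [QC.subst_subst, QSub.proj_comp_tuple, QC.subst_id]

theorem QL.subst_proj_tuple {Γ : Ctx} {σ ρ : LTy} (q : QL S Γ σ ρ) :
    (q.subst (QSub.proj Γ)).subst (cons (QC.tuple Γ) (nil Γ)) = q := by
  rw [QL.subst_subst, QSub.proj_comp_tuple, QL.subst_id]

theorem QC.subst_tuple_proj {Γ : Ctx} {τ : CTy} (q : QC S [Ctx.toTy Γ] τ) :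
    (q.subst (cons (QC.tuple Γ) (nil Γ))).subst (QSub.proj Γ) = q := by
  rw [QC.subst_subst, QSub.cons_comp, QC.tuple_subst_proj, QSub.nil_comp, QC.subst_cons_nil]

theorem QL.subst_tuple_proj {Γ : Ctx} {σ ρ : LTy} (q : QL S [Ctx.toTy Γ] σ ρ) :
    (q.subst (cons (QC.tuple Γ) (nil Γ))).subst (QSub.proj Γ) = q := by
  rw [QL.subst_subst, QSub.cons_comp, QC.tuple_subst_proj, QSub.nil_comp, QL.subst_cons_nil]

theorem synInterp_isTermModel (S : Signature.{u}) : (synInterp S).IsTermModel where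
  cty_bijective := by
    have h : (synInterp S).cty = fun τ : CTy => (τ : CTy) := funext (cty_syn S)
    rw [h]
    exact Function.bijective_id
  lty_bijective := by
    have h : (synInterp S).lty = fun σ : LTy => (σ : LTy) := funext (lty_syn S)
    rw [h]
    exact Function.bijective_id
  ctm_surjective Γ τ q := by
    have e : QC S [(synInterp S).ctx Γ] ((synInterp S).cty τ) = QC S [Ctx.toTy Γ] τ :=
      congrArg₂ (fun A B : CTy => QC S [A] B) (ctx_syn S Γ) (cty_syn S τ)
    -- The preimage of `q` is obtained by replacing its only variable by the tuple of the variables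
    -- of `Γ`; substituting the projections recovers `q`.
    obtain ⟨t, ht⟩ := ((cast e q).subst (cons (QC.tuple Γ) (nil Γ))).mk_surjective
    refine ⟨t, eq_of_heq (((synInterp_tm S).1 t).trans ?_)⟩
    rw [ht, QC.subst_tuple_proj]
    exact cast_heq e q
  ltm_surjective Γ σ ρ q := by
    have e : QL S [(synInterp S).ctx Γ] ((synInterp S).lty σ) ((synInterp S).lty ρ) =
        QL S [Ctx.toTy Γ] σ ρ := by
      rw [ctx_syn, lty_syn, lty_syn]
    obtain ⟨t, ht⟩ := ((cast e q).subst (cons (QC.tuple Γ) (nil Γ))).mk_surjective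
    refine ⟨t, eq_of_heq (((synInterp_tm S).2 t).trans ?_)⟩
    rw [ht, QL.subst_tuple_proj]
    exact cast_heq e q
  ctm_eq_iff {Γ τ} t s := by
    refine ⟨fun h => QC.mk_eq_iff.1 ?_, (synInterp S).ctm_sound⟩
    -- Equal interpretations give equal classes after substituting the projections, and the tuple
    -- undoes that substitution.
    have h' := eq_of_heq (((synInterp_tm S).1 t).symm.trans
      ((heq_of_eq h).trans ((synInterp_tm S).1 s)))
    rw [← (QC.mk t).subst_proj_tuple, h', QC.subst_proj_tuple]
  ltm_eq_iff {Γ σ ρ} t s := by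
    refine ⟨fun h => QL.mk_eq_iff.1 ?_, (synInterp S).ltm_sound⟩
    have h' := eq_of_heq (((synInterp_tm S).2 t).symm.trans
      ((heq_of_eq h).trans ((synInterp_tm S).2 s)))
    rw [← (QL.mk t).subst_proj_tuple, h', QL.subst_proj_tuple]

end LinLang

/-- The equivalences quantify only over models at the universe levels of the term model: its objects
are types, in level `0`, and its morphisms are classes of terms, in level `u`. Restricting the class
of models strengthens completeness, while soundness is given at all levels separately. -/
theorem mainTheorem8 (S : LinLang.Signature.{u}) :
    -- for terms `Γ ⊢ t : τ`, equality in the theory is equality in all models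
    (∀ (Γ : LinLang.Ctx) (τ : LinLang.CTy) (t s : LinLang.CTm S Γ τ),
      LinLang.CEq t s ↔
        ∀ (M : LinLang.CategoricalModel.{u, 0}) (I : LinLang.Interpretation S M),
          I.ctm t = I.ctm s) ∧
    -- the same for terms `Γ; x : σ ⊢ t : ρ`
    (∀ (Γ : LinLang.Ctx) (σ ρ : LinLang.LTy) (t s : LinLang.LTm S Γ σ ρ),
      LinLang.LEq t s ↔
        ∀ (M : LinLang.CategoricalModel.{u, 0}) (I : LinLang.Interpretation S M),
          I.ltm t = I.ltm s) ∧
    -- soundness holds for models of arbitrary size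
    (∀ (M : LinLang.CategoricalModel.{v, w}) (I : LinLang.Interpretation S M),
      (∀ (Γ : LinLang.Ctx) (τ : LinLang.CTy) (t s : LinLang.CTm S Γ τ),
        LinLang.CEq t s → I.ctm t = I.ctm s) ∧
      (∀ (Γ : LinLang.Ctx) (σ ρ : LinLang.LTy) (t s : LinLang.LTm S Γ σ ρ),
        LinLang.LEq t s → I.ltm t = I.ltm s)) ∧
    -- completeness is witnessed by a single model, the term model
    (∃ (M : LinLang.CategoricalModel.{u, 0}) (I : LinLang.Interpretation S M),
      I.IsTermModel) := by
  refine ⟨fun Γ τ t s => ⟨fun h M I => I.ctm_sound h, fun h => ?_⟩,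
    fun Γ σ ρ t s => ⟨fun h M I => I.ltm_sound h, fun h => ?_⟩,
    fun M I => ⟨fun _ _ _ _ h => I.ctm_sound h, fun _ _ _ _ _ h => I.ltm_sound h⟩,
    LinLang.synModel S, LinLang.synInterp S, LinLang.synInterp_isTermModel S⟩
  -- An equation valid in all models is tested in the term model, where validity is derivability.
  · exact ((LinLang.synInterp_isTermModel S).ctm_eq_iff t s).1 (h _ _)
  · exact ((LinLang.synInterp_isTermModel S).ltm_eq_iff t s).1 (h _ _)
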